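/- Let $(M^4,g,J,\omega)$ be an almost Hermitian manifold of real dimension $4$: a smooth manifold (Hausdorff, without boundary) with a smooth Riemannian metric $g=\langle\cdot,\cdot\rangle$, a smooth $g$-orthogonal endomorphism field $J$ with $J^2=-\mathrm{Id}$, and the fundamental form $\omega(X,Y)=g(JX,Y)$. Let $\nabla$ be the Levi-Civita connection of $g$, let $(J\alpha)(X)=-\alpha(JX)$ for a 1-form $\alpha$, let $\theta=J\delta\omega$ be the Lee form, where $\delta\omega=-\sum_i(\nabla_{e_i}\omega)(e_i,\cdot)$ for a local orthonormal frame $(e_i)$, and let $\theta^\sharp$ be the vector field dual to $\theta$. Let $$N(A,B)=[JA,JB]-[A,B]-J[JA,B]-J[A,JB],\qquad N_X(A,B)=\langle N(A,B),X\rangle,$$ so that each $N_X$ is a 2-form, and let $\Phi$ be the 2-form $$\Phi(X,Y)=\tfrac14\langle J(\nabla_XJ),\nabla_YJ\rangle .$$ Here $\langle A,B\rangle=\sum_i\langle Ae_i,Be_i\rangle$ for endomorphisms and $\langle\varphi,\psi\rangle=\sum_{i<j}\varphi(e_i,e_j)\psi(e_i,e_j)$ for 2-forms, and $d\alpha(X,Y)=X(\alpha(Y))-Y(\alpha(X))-\alpha([X,Y])$.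 Then the equality $-4\Phi=d(J\theta)$ holds on $M$ if and only if, for all vector fields $X,Y$, $$(\nabla_X\theta)(JY)-(\nabla_Y\theta)(JX)=-\tfrac12\langle N_{JX},N_Y\rangle-\tfrac12N_{J\theta^\sharp}(X,Y).$$ Moreover, if $M$ is compact, the equality $-4\Phi=d(J\theta)$ holds if and only if $(g,J)$ is Vaisman, that is, $J$ is integrable ($N=0$) and $\nabla\theta=0$. -/

import Mathlib

open Bundle Manifold ContDiff VectorField

noncomputable section

namespace AlmostHermitian

variable {E : Type*} [NormedAddCommGroup E] [NormedSpace ℝ E]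
  {H : Type*} [TopologicalSpace H] (I : ModelWithCorners ℝ E H)
  {M : Type*} [TopologicalSpace M] [ChartedSpace H M]

/-! ### Vector fields and 1-forms -/

/-- The vector field `X` on `M` is smooth. -/
def IsSmoothField [IsManifold I ∞ M] (X : Π x : M, TangentSpace I x) : Prop :=
  ContMDiff I I.tangent ∞ (fun x ↦ (⟨x, X x⟩ : TangentBundle I M))

/-- The directional derivative `X(f)` of a function along a vector field, at the point `x`. -/
def lieDeriv (X : Π x : M, TangentSpace I x) (f : M → ℝ) (x : M) : ℝ :=
  mvfderiv I f x (X x)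

/-- The exterior derivative of a 1-form,
`(dα)(X, Y) = X(α(Y)) - Y(α(X)) - α([X, Y])`, on vector fields `X`, `Y`. -/
def extDerivOneForm (α : Π x : M, TangentSpace I x →L[ℝ] ℝ)
    (X Y : Π x : M, TangentSpace I x) (x : M) : ℝ :=
  lieDeriv I X (fun y ↦ α y (Y y)) x - lieDeriv I Y (fun y ↦ α y (X y)) x
    - α x (mlieBracket I X Y x)

/-! ### The Levi-Civita connection -/

section LeviCivita

variable [RiemannianBundle (fun x : M ↦ TangentSpace I x)]

/-- Half of the right-hand side of the Koszul formula, that is, the function which the Levi-Civita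
connection has to satisfy `⟨∇_X Y, Z⟩ = koszul X Y Z`. -/
def koszul (X Y Z : Π x : M, TangentSpace I x) (x : M) : ℝ :=
  (1 / 2) * (lieDeriv I X (fun y ↦ inner ℝ (Y y) (Z y)) x
    + lieDeriv I Y (fun y ↦ inner ℝ (X y) (Z y)) x
    - lieDeriv I Z (fun y ↦ inner ℝ (X y) (Y y)) x
    + inner ℝ (mlieBracket I X Y x) (Z x)
    - inner ℝ (mlieBracket I X Z x) (Y x)
    - inner ℝ (mlieBracket I Y Z x) (X x))

variable [IsManifold I ∞ M]
  [IsContMDiffRiemannianBundle I ∞ E (fun x : M ↦ TangentSpace I x)]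

variable {I} {x : M} {X X' Y Y' Z Z' : Π x : M, TangentSpace I x}

theorem mdifferentiableAt_inner (hX : MDiffAt (T% X) x) (hY : MDiffAt (T% Y) x) :
    MDiffAt (fun y ↦ (inner ℝ (X y) (Y y) : ℝ)) x :=
  MDifferentiableAt.inner_bundle (b := fun y : M ↦ y) hX hY

variable [FiniteDimensional ℝ E]

instance finiteDimensional_tangentSpace (x : M) : FiniteDimensional ℝ (TangentSpace I x) :=
  inferInstanceAs (FiniteDimensional ℝ E)

theorem koszul_tensorial_left (hY : MDiffAt (T% Y) x) (hZ : MDiffAt (T% Z) x) :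
    TensorialAt I E (fun X ↦ koszul I X Y Z x) x where
  smul {f X} hf hX := by
    have := FiniteDimensional.complete ℝ E
    simp only [koszul, lieDeriv, Pi.smul_apply', real_inner_smul_left, mlieBracket_smul_left hf hX,
      mvfderiv_fun_mul hf (mdifferentiableAt_inner hX hZ),
      mvfderiv_fun_mul hf (mdifferentiableAt_inner hX hY), inner_add_left, real_inner_smul_right]
    simp [real_inner_comm]
    ring
  add {X X'} hX hX' := by
    have := FiniteDimensional.complete ℝ E
    simp only [koszul, lieDeriv, Pi.add_apply, inner_add_left, inner_add_right,
      mlieBracket_add_left hX hX',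
      mvfderiv_fun_add (mdifferentiableAt_inner hX hZ) (mdifferentiableAt_inner hX' hZ),
      mvfderiv_fun_add (mdifferentiableAt_inner hX hY) (mdifferentiableAt_inner hX' hY)]
    simp
    ring

theorem koszul_tensorial_right (hX : MDiffAt (T% X) x) (hY : MDiffAt (T% Y) x) :
    TensorialAt I E (fun Z ↦ koszul I X Y Z x) x where
  smul {f Z} hf hZ := by
    have := FiniteDimensional.complete ℝ E
    simp only [koszul, lieDeriv, Pi.smul_apply', real_inner_smul_right, mlieBracket_smul_right hf hZ,
      mvfderiv_fun_mul hf (mdifferentiableAt_inner hX hZ),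
      mvfderiv_fun_mul hf (mdifferentiableAt_inner hY hZ), inner_add_left, real_inner_smul_left]
    simp [real_inner_comm]
    ring
  add {Z Z'} hZ hZ' := by
    have := FiniteDimensional.complete ℝ E
    simp only [koszul, lieDeriv, Pi.add_apply, inner_add_left, inner_add_right,
      mlieBracket_add_right hZ hZ',
      mvfderiv_fun_add (mdifferentiableAt_inner hX hZ) (mdifferentiableAt_inner hX hZ'),
      mvfderiv_fun_add (mdifferentiableAt_inner hY hZ) (mdifferentiableAt_inner hY hZ')]
    simp
    ring

theorem koszul_smul_middle {f : M → ℝ} (hf : MDiffAt f x) (hX : MDiffAt (T% X) x)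
    (hY : MDiffAt (T% Y) x) (hZ : MDiffAt (T% Z) x) :
    koszul I X (f • Y) Z x
      = f x * koszul I X Y Z x + mvfderiv I f x (X x) * inner ℝ (Y x) (Z x) := by
  have := FiniteDimensional.complete ℝ E
  simp only [koszul, lieDeriv, Pi.smul_apply', real_inner_smul_left, real_inner_smul_right,
    mlieBracket_smul_right hf hY, mlieBracket_smul_left hf hY,
    mvfderiv_fun_mul hf (mdifferentiableAt_inner hX hY),
    mvfderiv_fun_mul hf (mdifferentiableAt_inner hY hZ), inner_add_left]
  simp [real_inner_comm]
  ring

theorem koszul_add_middle (hX : MDiffAt (T% X) x)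
    (hY : MDiffAt (T% Y) x) (hY' : MDiffAt (T% Y') x) (hZ : MDiffAt (T% Z) x) :
    koszul I X (Y + Y') Z x = koszul I X Y Z x + koszul I X Y' Z x := by
  have := FiniteDimensional.complete ℝ E
  simp only [koszul, lieDeriv, Pi.add_apply, inner_add_left, inner_add_right,
    mlieBracket_add_right hY hY', mlieBracket_add_left hY hY',
    mvfderiv_fun_add (mdifferentiableAt_inner hX hY) (mdifferentiableAt_inner hX hY'),
    mvfderiv_fun_add (mdifferentiableAt_inner hY hZ) (mdifferentiableAt_inner hY' hZ)]
  simp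
  ring

/-- The vector `∇_v Y ∈ T_x M` given by the Koszul formula
(set to `0` if `Y` is not differentiable at `x`). -/
def leviCivitaFun (Y : Π x : M, TangentSpace I x) (x : M) :
    TangentSpace I x →L[ℝ] TangentSpace I x := by
  classical
  exact
  if hY : MDiffAt (T% Y) x then
    LinearMap.toContinuousLinearMap
      { toFun := fun v ↦ (InnerProductSpace.toDual ℝ (TangentSpace I x)).symm
          (TensorialAt.mkHom₂ (I := I) (F := E) (F' := E) (fun X Z ↦ koszul I X Y Z x) x
            (fun _ hZ ↦ koszul_tensorial_left hY hZ)
            (fun _ hX ↦ koszul_tensorial_right hX hY) v)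
        map_add' := fun v w ↦ by simp only [map_add]
        map_smul' := fun c v ↦ by simp }
  else 0

theorem inner_leviCivitaFun (hX : MDiffAt (T% X) x) (hY : MDiffAt (T% Y) x)
    (hZ : MDiffAt (T% Z) x) :
    inner ℝ (leviCivitaFun Y x (X x)) (Z x) = koszul I X Y Z x := by
  simp only [leviCivitaFun, dif_pos hY]
  simp only [LinearMap.coe_toContinuousLinearMap', LinearMap.coe_mk, AddHom.coe_mk,
    InnerProductSpace.toDual_symm_apply]
  exact TensorialAt.mkHom₂_apply _ _ hX hZ

variable (I M) in
/-- The Levi-Civita connection of the Riemannian manifold `M`: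
`leviCivita Y x v` is `∇_v Y ∈ T_x M`. -/
def leviCivita : CovariantDerivative I E (fun x : M ↦ TangentSpace I x) where
  toFun := leviCivitaFun
  isCovariantDerivativeOnUniv :=
    { add := by
        intro Y Y' x hY hY' _
        ext v
        refine ext_inner_right ℝ fun w ↦ ?_
        have hv := FiberBundle.mdifferentiableAt_extend I E v
        have hw := FiberBundle.mdifferentiableAt_extend I E w
        have hs := mdifferentiableAt_add_section hY hY'
        have h1 := inner_leviCivitaFun hv hs hw
        have h2 := inner_leviCivitaFun hv hY hw
        have h3 := inner_leviCivitaFun hv hY' hw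
        rw [koszul_add_middle hv hY hY' hw, ← h2, ← h3] at h1
        simpa [inner_add_left] using h1
      leibniz := by
        intro Y f x hY hf _
        ext v
        refine ext_inner_right ℝ fun w ↦ ?_
        have hv := FiberBundle.mdifferentiableAt_extend I E v
        have hw := FiberBundle.mdifferentiableAt_extend I E w
        have hs := hf.smul_section hY
        have h1 := inner_leviCivitaFun hv hs hw
        have h2 := inner_leviCivitaFun hv hY hw
        rw [koszul_smul_middle hf hv hY hw, ← h2] at h1
        simpa [inner_add_left, real_inner_smul_left] using h1 }

theorem inner_leviCivita (hX : MDiffAt (T% X) x) (hY : MDiffAt (T% Y) x)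
    (hZ : MDiffAt (T% Z) x) :
    inner ℝ (leviCivita I M Y x (X x)) (Z x) = koszul I X Y Z x :=
  inner_leviCivitaFun hX hY hZ

variable (I M) in
/-- The Levi-Civita connection is torsion-free. -/
theorem leviCivita_torsion [CompleteSpace E] : (leviCivita I M).torsion = 0 := by
  rw [CovariantDerivative.torsion_eq_zero_iff]
  intro X Y x hX hY
  refine ext_inner_right ℝ fun w ↦ ?_
  have hw := FiberBundle.mdifferentiableAt_extend I E w
  have h1 := inner_leviCivita hX hY hw
  have h2 := inner_leviCivita hY hX hw
  simp only [FiberBundle.extend_apply_self] at h1 h2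
  rw [inner_sub_left, h1, h2]
  simp only [koszul, mlieBracket_swap_apply (V := Y) (W := X), real_inner_comm,
    FiberBundle.extend_apply_self, inner_neg_left]
  ring

/-- The Levi-Civita connection is compatible with the metric. -/
theorem leviCivita_metric (hX : MDiffAt (T% X) x) (hY : MDiffAt (T% Y) x)
    (hZ : MDiffAt (T% Z) x) :
    lieDeriv I X (fun y ↦ inner ℝ (Y y) (Z y)) x
      = inner ℝ (leviCivita I M Y x (X x)) (Z x) + inner ℝ (Y x) (leviCivita I M Z x (X x)) := by
  have h1 := inner_leviCivita hX hY hZ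
  have h2 := inner_leviCivita hX hZ hY
  rw [real_inner_comm] at h2
  rw [h1, h2]
  simp only [koszul, lieDeriv, mlieBracket_swap_apply (V := Z) (W := Y), real_inner_comm,
    inner_neg_left]
  ring

end LeviCivita

section Structure

variable (M) [RiemannianBundle (fun x : M ↦ TangentSpace I x)] [IsManifold I ∞ M]

/-- An almost Hermitian structure on the Riemannian manifold `(M, g)`:
a smooth field `J` of endomorphisms of the tangent spaces which satisfies `J² = -Id` and which is
orthogonal with respect to the metric. -/
structure AlmostHermitianStructure where
  /-- the almost complex structure -/
  J (x : M) : TangentSpace I x →L[ℝ] TangentSpace I x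
  contMDiff_J : ContMDiff I (I.prod 𝓘(ℝ, E →L[ℝ] E)) ∞
    (fun x ↦ TotalSpace.mk' (E →L[ℝ] E)
      (E := fun x : M ↦ (TangentSpace I x →L[ℝ] TangentSpace I x)) x (J x))
  J_J (x : M) (v : TangentSpace I x) : J x (J x v) = -v
  inner_J_J (x : M) (v w : TangentSpace I x) : inner ℝ (J x v) (J x w) = inner ℝ v w

namespace AlmostHermitianStructure

variable {I M}
variable (S : AlmostHermitianStructure I M)

/-- The vector field `JX`. -/
def mapField (X : Π x : M, TangentSpace I x) : Π x : M, TangentSpace I x :=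
  fun x ↦ S.J x (X x)

/-- The 1-form `Jα`, `(Jα)(X) = -α(JX)`. -/
def mapOneForm (α : Π x : M, TangentSpace I x →L[ℝ] ℝ) : Π x : M, TangentSpace I x →L[ℝ] ℝ :=
  fun x ↦ -(α x ∘L S.J x)

/-- The expression `[JA, JB] - [A, B] - J[JA, B] - J[A, JB]` in two vector fields. -/
def nijenhuisField (A B : Π x : M, TangentSpace I x) (x : M) : TangentSpace I x :=
  mlieBracket I (S.mapField A) (S.mapField B) x - mlieBracket I A B x
    - S.J x (mlieBracket I (S.mapField A) B x) - S.J x (mlieBracket I A (S.mapField B) x)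

theorem nijenhuisField_swap (X Y : Π x : M, TangentSpace I x) (x : M) :
    S.nijenhuisField X Y x = - S.nijenhuisField Y X x := by
  simp only [nijenhuisField, mlieBracket_swap_apply (V := X),
    mlieBracket_swap_apply (V := S.mapField X), map_neg]
  module

variable {x : M} {X Y : Π x : M, TangentSpace I x}

theorem mdifferentiableAt_mapField (hX : MDiffAt (T% X) x) : MDiffAt (T% (S.mapField X)) x :=
  MDifferentiableAt.clm_bundle_apply (b := fun y : M ↦ y)
    ((S.contMDiff_J x).mdifferentiableAt (by simp)) hX

variable [FiniteDimensional ℝ E]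

theorem nijenhuisField_tensorial_left (Y : Π x : M, TangentSpace I x) (x : M) :
    TensorialAt I E (fun X ↦ S.nijenhuisField X Y x) x where
  smul {f X} hf hX := by
    have := FiniteDimensional.complete ℝ E
    have e : S.mapField (f • X) = f • S.mapField X := by ext y; simp [mapField]
    simp only [nijenhuisField, e, mlieBracket_smul_left hf hX,
      mlieBracket_smul_left hf (S.mdifferentiableAt_mapField hX), map_add, map_smul]
    simp only [mapField, S.J_J]
    module
  add {X X'} hX hX' := by
    have := FiniteDimensional.complete ℝ E
    have e : S.mapField (X + X') = S.mapField X + S.mapField X' := by ext y; simp [mapField]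
    simp only [nijenhuisField, e, mlieBracket_add_left hX hX', mlieBracket_add_left
      (S.mdifferentiableAt_mapField hX) (S.mdifferentiableAt_mapField hX'), map_add]
    module

theorem nijenhuisField_tensorial_right (X : Π x : M, TangentSpace I x) (x : M) :
    TensorialAt I E (fun Y ↦ S.nijenhuisField X Y x) x where
  smul {f Y} hf hY := by
    simp only [S.nijenhuisField_swap X]
    rw [(S.nijenhuisField_tensorial_left X x).smul hf hY, smul_neg]
  add {Y Y'} hY hY' := by
    simp only [S.nijenhuisField_swap X]
    rw [(S.nijenhuisField_tensorial_left X x).add hY hY', neg_add]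

/-- The Nijenhuis tensor `N(A, B) = [JA, JB] - [A, B] - J[JA, B] - J[A, JB]`,
as a bilinear map on each tangent space. -/
def nijenhuis (x : M) : TangentSpace I x →L[ℝ] TangentSpace I x →L[ℝ] TangentSpace I x :=
  TensorialAt.mkHom₂ (I := I) (F := E) (F' := E) (fun A B ↦ S.nijenhuisField A B x) x
    (fun B _ ↦ S.nijenhuisField_tensorial_left B x)
    (fun A _ ↦ S.nijenhuisField_tensorial_right A x)

theorem nijenhuis_apply (hX : MDiffAt (T% X) x) (hY : MDiffAt (T% Y) x) :
    S.nijenhuis x (X x) (Y x) = S.nijenhuisField X Y x :=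
  TensorialAt.mkHom₂_apply _ _ hX hY

/-- The 2-form `N_w(a, b) = ⟨N(a, b), w⟩`, for `w ∈ T_x M`. -/
def nijenhuisForm (x : M) (w a b : TangentSpace I x) : ℝ :=
  inner ℝ (S.nijenhuis x a b) w

/-- The almost complex structure is integrable: its Nijenhuis tensor vanishes. -/
def IsIntegrable : Prop :=
  ∀ x : M, S.nijenhuis x = 0

variable [IsContMDiffRiemannianBundle I ∞ E (fun x : M ↦ TangentSpace I x)]

theorem nablaJ_tensorial (x : M) :
    TensorialAt I E (fun Y ↦ leviCivita I M (S.mapField Y) x - S.J x ∘L leviCivita I M Y x) x where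
  smul {f Y} hf hY := by
    have e : S.mapField (f • Y) = f • S.mapField Y := by ext y; simp [mapField]
    rw [e, (leviCivita I M).isCovariantDerivativeOn.leibniz hY hf,
      (leviCivita I M).isCovariantDerivativeOn.leibniz (S.mdifferentiableAt_mapField hY) hf]
    ext v
    simp [mapField]
    module
  add {Y Y'} hY hY' := by
    have e : S.mapField (Y + Y') = S.mapField Y + S.mapField Y' := by ext y; simp [mapField]
    rw [e, (leviCivita I M).isCovariantDerivativeOn.add hY hY',
      (leviCivita I M).isCovariantDerivativeOn.add (S.mdifferentiableAt_mapField hY)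
        (S.mdifferentiableAt_mapField hY')]
    ext v
    simp
    module

/-- The covariant derivative of `J`: `S.nablaJ x v` is the endomorphism `∇_v J` of `T_x M`, given
by `(∇_X J) Y = ∇_X (JY) - J (∇_X Y)`. -/
def nablaJ (x : M) : TangentSpace I x →L[ℝ] TangentSpace I x →L[ℝ] TangentSpace I x :=
  (TensorialAt.mkHom (I := I) (F := E)
    (fun Y ↦ leviCivita I M (S.mapField Y) x - S.J x ∘L leviCivita I M Y x) x
    (S.nablaJ_tensorial x)).flip

theorem nablaJ_apply (hY : MDiffAt (T% Y) x) (v : TangentSpace I x) :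
    S.nablaJ x v (Y x) = leviCivita I M (S.mapField Y) x v - S.J x (leviCivita I M Y x v) := by
  simp only [nablaJ, ContinuousLinearMap.flip_apply]
  rw [TensorialAt.mkHom_apply (S.nablaJ_tensorial x) hY]
  rfl

/-- The fundamental form `ω(u, v) = ⟨Ju, v⟩`. -/
def omega (x : M) (u v : TangentSpace I x) : ℝ :=
  inner ℝ (S.J x u) v

/-- The covariant derivative of `ω`, `(∇_u ω)(v, w) = ⟨(∇_u J) v, w⟩`. -/
def nablaOmega (x : M) (u v : TangentSpace I x) : TangentSpace I x →L[ℝ] ℝ :=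
  innerSL ℝ (S.nablaJ x u v)

/-- The codifferential `δω = -∑ᵢ (∇_{eᵢ} ω)(eᵢ, ·)`, with `(eᵢ)` an orthonormal basis of `T_x M`. -/
def codiffOmega (x : M) : TangentSpace I x →L[ℝ] ℝ :=
  -∑ i, S.nablaOmega x (stdOrthonormalBasis ℝ (TangentSpace I x) i)
    (stdOrthonormalBasis ℝ (TangentSpace I x) i)

/-- The Lee form `θ = J δω`. -/
def lee : Π x : M, TangentSpace I x →L[ℝ] ℝ :=
  S.mapOneForm S.codiffOmega

/-- The vector field `θ^♯` which is dual to the Lee form. -/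
def leeSharp (x : M) : TangentSpace I x :=
  (InnerProductSpace.toDual ℝ (TangentSpace I x)).symm (S.lee x)

/-- The 2-form `Φ(u, v) = (1/4) ⟨J(∇_u J), ∇_v J⟩`, where
`⟨A, B⟩ = ∑ᵢ ⟨A eᵢ, B eᵢ⟩` is the inner product of endomorphisms of `T_x M`. -/
def Phi (x : M) (u v : TangentSpace I x) : ℝ :=
  (1 / 4) * ∑ i, inner ℝ (S.J x (S.nablaJ x u (stdOrthonormalBasis ℝ (TangentSpace I x) i)))
    (S.nablaJ x v (stdOrthonormalBasis ℝ (TangentSpace I x) i))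

end AlmostHermitianStructure

end Structure

section Forms

variable [RiemannianBundle (fun x : M ↦ TangentSpace I x)] [IsManifold I ∞ M]
  [FiniteDimensional ℝ E]

variable {I} in
/-- The inner product of 2-forms on `T_x M`, `⟨φ, ψ⟩ = ∑_{i < j} φ(eᵢ, eⱼ) ψ(eᵢ, eⱼ)
= (1/2) ∑_{i, j} φ(eᵢ, eⱼ) ψ(eᵢ, eⱼ)`, with `(eᵢ)` an orthonormal basis of `T_x M`. -/
def twoFormInner (x : M) (φ ψ : TangentSpace I x → TangentSpace I x → ℝ) : ℝ :=
  (1 / 2) * ∑ i, ∑ j,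
    φ (stdOrthonormalBasis ℝ (TangentSpace I x) i) (stdOrthonormalBasis ℝ (TangentSpace I x) j)
    * ψ (stdOrthonormalBasis ℝ (TangentSpace I x) i) (stdOrthonormalBasis ℝ (TangentSpace I x) j)

variable [IsContMDiffRiemannianBundle I ∞ E (fun x : M ↦ TangentSpace I x)]

/-- The covariant derivative of a 1-form, `(∇_X α)(Y) = X(α(Y)) - α(∇_X Y)`,
on vector fields `X`, `Y`. -/
def nablaOneForm (α : Π x : M, TangentSpace I x →L[ℝ] ℝ)
    (X Y : Π x : M, TangentSpace I x) (x : M) : ℝ :=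
  lieDeriv I X (fun y ↦ α y (Y y)) x - α x (leviCivita I M Y x (X x))

variable {I} in
/-- The structure is Vaisman: `J` is integrable and `∇θ = 0`. -/
def AlmostHermitianStructure.IsVaisman (S : AlmostHermitianStructure I M) : Prop :=
  S.IsIntegrable ∧ ∀ X Y : Π x : M, TangentSpace I x, IsSmoothField I X → IsSmoothField I Y →
    ∀ x : M, nablaOneForm I S.lee X Y x = 0

variable {I} in
/-- The equality of 2-forms `-4Φ = d(Jθ)`. -/
def AlmostHermitianStructure.NegFourPhiEq (S : AlmostHermitianStructure I M) : Prop :=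
  ∀ X Y : Π x : M, TangentSpace I x, IsSmoothField I X → IsSmoothField I Y →
    ∀ x : M, -4 * S.Phi x (X x) (Y x) = extDerivOneForm I (S.mapOneForm S.lee) X Y x

end Forms

end AlmostHermitian

end

noncomputable section

/-- The algebraic skeleton of the Levi-Civita calculus on a compact Riemannian manifold:
`A` is the ring of smooth functions, `L` is the module of smooth vector fields, and the metric has a
finite pair of dual global frames. -/
structure LeviCivitaCalculus (A L : Type*) [CommRing A] [Algebra ℝ A] [AddCommGroup L]
    [Module A L] where
  /-- the metric -/
  g : L →ₗ[A] L →ₗ[A] A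
  /-- the derivative of a function along a vector field -/
  der : L →ₗ[A] Derivation ℝ A A
  /-- the connection -/
  nabla : L →ₗ[A] L →+ L
  g_symm (X Y : L) : g X Y = g Y X
  nabla_smul (X Y : L) (f : A) : nabla X (f • Y) = f • nabla X Y + der X f • Y
  der_g (Z X Y : L) : der Z (g X Y) = g (nabla Z X) Y + g X (nabla Z Y)
  der_bracket (X Y : L) (f : A) :
    der (nabla X Y - nabla Y X) f = der X (der Y f) - der Y (der X f)
  jacobi (X Y Z : L) :
    nabla X (nabla Y Z - nabla Z Y) - nabla (nabla Y Z - nabla Z Y) X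
      = (nabla (nabla X Y - nabla Y X) Z - nabla Z (nabla X Y - nabla Y X))
        + (nabla Y (nabla X Z - nabla Z X) - nabla (nabla X Z - nabla Z X) Y)
  /-- the index set of the frames -/
  ι : Type
  [fintype_ι : Fintype ι]
  /-- the frame -/
  e : ι → L
  /-- the dual frame -/
  e' : ι → L
  sum_frame (X : L) : ∑ i, g X (e' i) • e i = X

namespace LeviCivitaCalculus

attribute [instance] LeviCivitaCalculus.fintype_ι

variable {A L : Type*} [CommRing A] [Algebra ℝ A] [AddCommGroup L] [Module A L]
  (C : LeviCivitaCalculus A L)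

theorem eq_of_two_mul {a b : A} (h : 2 * a = 2 * b) : a = b := by
  have h2 : (algebraMap ℝ A (1 / 2)) * 2 = 1 := by
    rw [← map_ofNat (algebraMap ℝ A) 2, ← map_mul]; norm_num
  calc a = algebraMap ℝ A (1 / 2) * (2 * a) := by rw [← mul_assoc, h2, one_mul]
    _ = b := by rw [h, ← mul_assoc, h2, one_mul]

theorem ext_g {X Y : L} (h : ∀ Z, C.g X Z = C.g Y Z) : X = Y := by
  rw [← C.sum_frame X, ← C.sum_frame Y]
  simp only [h]

/-! ### Contractions -/

/-- A map of two vector fields which is linear over the functions in both variables. -/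
structure IsBilin {P : Type*} [AddCommGroup P] [Module A P] (B : L → L → P) : Prop where
  left (Y : L) : IsLinearMap A (fun X ↦ B X Y)
  right (X : L) : IsLinearMap A (B X)

omit [Algebra ℝ A] in
theorem IsBilin.sum_left {P : Type*} [AddCommGroup P] [Module A P] {B : L → L → P}
    (hB : IsBilin (A := A) B) {κ : Type*} (s : Finset κ) (c : κ → A) (X : κ → L) (Y : L) :
    B (∑ k ∈ s, c k • X k) Y = ∑ k ∈ s, c k • B (X k) Y := by
  exact (map_sum ((hB.left Y).mk' _) (fun k ↦ c k • X k) s).trans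
    (Finset.sum_congr rfl fun k _ ↦ (hB.left Y).map_smul (c k) (X k))

omit [Algebra ℝ A] in
theorem IsBilin.sum_right {P : Type*} [AddCommGroup P] [Module A P] {B : L → L → P}
    (hB : IsBilin (A := A) B) {κ : Type*} (s : Finset κ) (c : κ → A) (X : L) (Y : κ → L) :
    B X (∑ k ∈ s, c k • Y k) = ∑ k ∈ s, c k • B X (Y k) := by
  exact (map_sum ((hB.right X).mk' _) (fun k ↦ c k • Y k) s).trans
    (Finset.sum_congr rfl fun k _ ↦ (hB.right X).map_smul (c k) (Y k))

theorem sum_bilin_eq {P : Type*} [AddCommGroup P] [Module A P] {B : L → L → P}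
    (hB : IsBilin (A := A) B) {κ : Type*} [Fintype κ] (a b : κ → L) :
    ∑ k, B (a k) (b k)
      = ∑ i, ∑ j, (∑ k, C.g (C.e' i) (a k) * C.g (b k) (C.e' j)) • B (C.e i) (C.e j) := by
  have h (k : κ) : B (a k) (b k)
      = ∑ i, ∑ j, (C.g (C.e' i) (a k) * C.g (b k) (C.e' j)) • B (C.e i) (C.e j) := by
    conv_lhs => rw [← C.sum_frame (a k), ← C.sum_frame (b k)]
    rw [hB.sum_left]
    refine Finset.sum_congr rfl fun i _ ↦ ?_
    rw [hB.sum_right, Finset.smul_sum]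
    refine Finset.sum_congr rfl fun j _ ↦ ?_
    rw [smul_smul, C.g_symm (a k)]
  simp only [h, Finset.sum_smul]
  rw [Finset.sum_comm]
  refine Finset.sum_congr rfl fun i _ ↦ ?_
  rw [Finset.sum_comm]

/-- Two sums of tensor products agree as soon as they agree after pairing with the metric. -/
theorem sum_congr_g {P : Type*} [AddCommGroup P] [Module A P] {B : L → L → P}
    (hB : IsBilin (A := A) B) {κ κ' : Type*} [Fintype κ] [Fintype κ'] {a b : κ → L} {c d : κ' → L}
    (h : ∀ X Y, ∑ k, C.g X (a k) * C.g (b k) Y = ∑ k, C.g X (c k) * C.g (d k) Y) :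
    ∑ k, B (a k) (b k) = ∑ k, B (c k) (d k) := by
  simp only [C.sum_bilin_eq hB, h]

theorem sum_g_mul_g (X Y : L) : ∑ i, C.g X (C.e i) * C.g (C.e' i) Y = C.g X Y := by
  have h := congrArg (C.g X) (C.sum_frame Y)
  simp only [map_sum, map_smul, smul_eq_mul] at h
  rw [← h]
  exact Finset.sum_congr rfl fun i _ ↦ by rw [C.g_symm Y, mul_comm]

theorem sum_g_mul_g' (X Y : L) : ∑ i, C.g X (C.e' i) * C.g (C.e i) Y = C.g X Y := by
  rw [C.g_symm X Y, ← C.sum_g_mul_g Y X]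
  exact Finset.sum_congr rfl fun i _ ↦ by rw [C.g_symm X, C.g_symm Y, mul_comm]

theorem sum_frame' (X : L) : ∑ i, C.g X (C.e i) • C.e' i = X :=
  C.ext_g fun Z ↦ by simp [← C.sum_g_mul_g X Z]

variable {P : Type*} [AddCommGroup P] [Module A P] {B : L → L → P}

theorem sum_swap (hB : IsBilin (A := A) B) :
    ∑ i, B (C.e' i) (C.e i) = ∑ i, B (C.e i) (C.e' i) :=
  C.sum_congr_g hB fun X Y ↦ by rw [sum_g_mul_g', sum_g_mul_g]

theorem contract_left {f : L → P} (hf : IsLinearMap A f) (X : L) :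
    ∑ i, C.g X (C.e' i) • f (C.e i) = f X := by
  conv_rhs => rw [← C.sum_frame X]
  exact ((map_sum (hf.mk' _) (fun i ↦ C.g X (C.e' i) • C.e i) Finset.univ).trans
    (Finset.sum_congr rfl fun i _ ↦ hf.map_smul _ _)).symm

theorem contract_right {f : L → P} (hf : IsLinearMap A f) (X : L) :
    ∑ i, C.g X (C.e i) • f (C.e' i) = f X := by
  conv_rhs => rw [← C.sum_frame' X]
  exact ((map_sum (hf.mk' _) (fun i ↦ C.g X (C.e i) • C.e' i) Finset.univ).trans
    (Finset.sum_congr rfl fun i _ ↦ hf.map_smul _ _)).symm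

/-- The contraction with the metric is parallel. -/
theorem sum_nabla_frame (hB : IsBilin (A := A) B) (Z : L) :
    ∑ i, (B (C.nabla Z (C.e i)) (C.e' i) + B (C.e i) (C.nabla Z (C.e' i))) = 0 := by
  have h := C.sum_congr_g hB (κ := C.ι ⊕ C.ι) (κ' := Empty)
    (a := Sum.elim (fun i ↦ C.nabla Z (C.e i)) C.e)
    (b := Sum.elim C.e' (fun i ↦ C.nabla Z (C.e' i))) (c := Empty.elim) (d := Empty.elim)
    fun X Y ↦ by
      have h1 := congrArg (C.der Z) (C.sum_g_mul_g X Y)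
      have h2 := C.sum_g_mul_g (C.nabla Z X) Y
      have h3 := C.sum_g_mul_g X (C.nabla Z Y)
      simp only [map_sum, Derivation.leibniz, C.der_g, smul_eq_mul] at h1
      simp only [Fintype.sum_sum_type, Sum.elim_inl, Sum.elim_inr, Finset.univ_eq_empty,
        Finset.sum_empty]
      rw [← h2, ← h3] at h1
      rw [← sub_eq_zero] at h1
      rw [← h1]
      simp only [← Finset.sum_add_distrib, ← Finset.sum_sub_distrib]
      exact Finset.sum_congr rfl fun i _ ↦ by ring
  simpa [Finset.sum_add_distrib] using h

theorem sum_skew (hB : IsBilin (A := A) B) {K : L → L} (hK : ∀ X Y, C.g (K X) Y = - C.g X (K Y)) :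
    ∑ i, B (K (C.e i)) (C.e' i) = - ∑ i, B (C.e i) (K (C.e' i)) := by
  rw [eq_neg_iff_add_eq_zero]
  have h := C.sum_congr_g hB (κ := C.ι ⊕ C.ι) (κ' := Empty)
    (a := Sum.elim (fun i ↦ K (C.e i)) C.e)
    (b := Sum.elim C.e' (fun i ↦ K (C.e' i))) (c := Empty.elim) (d := Empty.elim)
    fun X Y ↦ by
      have h2 := C.sum_g_mul_g (K X) Y
      have h3 := C.sum_g_mul_g X (K Y)
      simp only [hK] at h2
      simp only [Fintype.sum_sum_type, Sum.elim_inl, Sum.elim_inr, Finset.univ_eq_empty,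
        Finset.sum_empty, hK]
      have h2' : ∑ i, C.g X (K (C.e i)) * C.g (C.e' i) Y = C.g X (K Y) := by
        rw [← neg_inj, ← h2, ← Finset.sum_neg_distrib]
        exact Finset.sum_congr rfl fun i _ ↦ by ring
      rw [h2', ← h3, ← Finset.sum_add_distrib]
      exact Finset.sum_eq_zero fun i _ ↦ by ring
  simpa using h

/-! ### Divergence -/

/-- The divergence of a vector field. -/
def div (X : L) : A := ∑ i, C.g (C.nabla (C.e i) X) (C.e' i)

theorem div_add (X Y : L) : C.div (X + Y) = C.div X + C.div Y := by
  simp [div, Finset.sum_add_distrib]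

theorem div_sub (X Y : L) : C.div (X - Y) = C.div X - C.div Y := by
  simp [div, Finset.sum_sub_distrib]

theorem div_smul (f : A) (X : L) : C.div (f • X) = f * C.div X + C.der X f := by
  have h := congrArg (fun Z ↦ C.der Z f) (C.sum_frame X)
  replace h : ∑ i, C.g X (C.e' i) * C.der (C.e i) f = C.der X f := by
    rw [← h]
    have hl : IsLinearMap A (fun Z ↦ C.der Z f) := ⟨fun _ _ ↦ by simp, fun _ _ ↦ by simp⟩
    exact ((map_sum (hl.mk' _) (fun i ↦ C.g X (C.e' i) • C.e i) Finset.univ).trans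
      (Finset.sum_congr rfl fun i _ ↦ hl.map_smul _ _)).symm
  simp only [div, C.nabla_smul, map_add, map_smul, LinearMap.add_apply, LinearMap.smul_apply,
    smul_eq_mul, Finset.sum_add_distrib, Finset.mul_sum, ← h]
  congr 1
  exact Finset.sum_congr rfl fun i _ ↦ mul_comm _ _

theorem div_eq_sum {X : L} {β : L → A} (h : ∀ Y, C.g X Y = β Y) :
    C.div X = ∑ i, (C.der (C.e i) (β (C.e' i)) - β (C.nabla (C.e i) (C.e' i))) := by
  simp only [div, ← h, C.der_g]
  exact Finset.sum_congr rfl fun i _ ↦ by ring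

/-- The vector field which is dual to a 1-form. -/
def sharp (β : L → A) : L := ∑ i, β (C.e i) • C.e' i

theorem g_sharp {β : L → A} (hβ : IsLinearMap A β) (Y : L) : C.g (C.sharp β) Y = β Y := by
  rw [← C.contract_left hβ Y]
  simp only [sharp, map_sum, map_smul, LinearMap.sum_apply, LinearMap.smul_apply, smul_eq_mul]
  exact Finset.sum_congr rfl fun i _ ↦ by rw [C.g_symm, mul_comm]

/-! ### Curvature -/

/-- The curvature tensor `R(X, Y)Z`. -/
def R (X Y Z : L) : L :=
  C.nabla X (C.nabla Y Z) - C.nabla Y (C.nabla X Z) - C.nabla (C.nabla X Y - C.nabla Y X) Z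

/-- The curvature tensor `⟨R(X, Y)Z, W⟩`. -/
def Rm (X Y Z W : L) : A := C.g (C.R X Y Z) W

theorem R_swap (X Y Z : L) : C.R X Y Z = - C.R Y X Z := by
  simp only [R, map_sub, AddMonoidHom.sub_apply]; abel

theorem R_bianchi (X Y Z : L) : C.R X Y Z + C.R Y Z X + C.R Z X Y = 0 := by
  have h := C.jacobi X Y Z
  simp only [R, map_sub, AddMonoidHom.sub_apply] at h ⊢
  rw [← sub_eq_zero] at h
  rw [← h]
  abel

theorem Rm_swap (X Y Z W : L) : C.Rm X Y Z W = - C.Rm Y X Z W := by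
  simp only [Rm, C.R_swap X Y]; simp

theorem Rm_bianchi (X Y Z W : L) : C.Rm X Y Z W + C.Rm Y Z X W + C.Rm Z X Y W = 0 := by
  simp only [Rm, ← LinearMap.add_apply, ← map_add, C.R_bianchi]; simp

theorem Rm_skew (X Y Z W : L) : C.Rm X Y Z W = - C.Rm X Y W Z := by
  have h := C.der_g (C.nabla X Y - C.nabla Y X) Z W
  rw [C.der_bracket] at h
  simp only [map_add, C.der_g, R, Rm, map_sub, LinearMap.sub_apply, AddMonoidHom.sub_apply] at h ⊢
  rw [C.g_symm (C.nabla X (C.nabla Y W)), C.g_symm (C.nabla Y (C.nabla X W)),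
    C.g_symm (C.nabla (C.nabla X Y) W), C.g_symm (C.nabla (C.nabla Y X) W)]
  linear_combination h

theorem Rm_pair (X Y Z W : L) : C.Rm X Y Z W = C.Rm Z W X Y := by
  apply eq_of_two_mul
  have b1 := C.Rm_bianchi X Y Z W
  have b2 := C.Rm_bianchi Y Z W X
  have b3 := C.Rm_bianchi Z W X Y
  have b4 := C.Rm_bianchi W X Y Z
  rw [C.Rm_skew Y Z W, C.Rm_skew Z W Y, C.Rm_swap W Y] at b2
  rw [C.Rm_swap W X, C.Rm_skew X W, C.Rm_swap X Z, C.Rm_skew Z X] at b3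
  rw [C.Rm_swap W X, C.Rm_skew X Y, C.Rm_skew Y W] at b4
  linear_combination b1 + b2 - b3 - b4

end LeviCivitaCalculus


namespace LeviCivitaCalculus

variable {A L : Type*} [CommRing A] [Algebra ℝ A] [AddCommGroup L] [Module A L]
  (C : LeviCivitaCalculus A L)

section CurvatureTensor

variable (X X' Y Z W V : L) (f : A)

theorem Rm_add₄ : C.Rm X Y Z (W + X') = C.Rm X Y Z W + C.Rm X Y Z X' := by simp [Rm]

theorem Rm_smul₄ : C.Rm X Y Z (f • W) = f * C.Rm X Y Z W := by simp [Rm]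

theorem Rm_add₃ : C.Rm X Y (Z + X') W = C.Rm X Y Z W + C.Rm X Y X' W := by
  simp only [C.Rm_skew X Y _ W, Rm_add₄]; ring

theorem Rm_smul₃ : C.Rm X Y (f • Z) W = f * C.Rm X Y Z W := by
  simp only [C.Rm_skew X Y _ W, Rm_smul₄]; ring

theorem Rm_add₂ : C.Rm X (Y + X') Z W = C.Rm X Y Z W + C.Rm X X' Z W := by
  simp only [C.Rm_pair X _ Z W, Rm_add₄]

theorem Rm_smul₂ : C.Rm X (f • Y) Z W = f * C.Rm X Y Z W := by
  simp only [C.Rm_pair X _ Z W, Rm_smul₄]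

theorem Rm_add₁ : C.Rm (X + X') Y Z W = C.Rm X Y Z W + C.Rm X' Y Z W := by
  simp only [C.Rm_pair _ Y Z W, Rm_add₃]

theorem Rm_smul₁ : C.Rm (f • X) Y Z W = f * C.Rm X Y Z W := by
  simp only [C.Rm_pair _ Y Z W, Rm_smul₃]

/-- The covariant derivative of the curvature tensor. -/
def DRm : A :=
  C.der V (C.Rm X Y Z W) - C.Rm (C.nabla V X) Y Z W - C.Rm X (C.nabla V Y) Z W
    - C.Rm X Y (C.nabla V Z) W - C.Rm X Y Z (C.nabla V W)

theorem DRm_swap : C.DRm X Y Z W V = - C.DRm Y X Z W V := by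
  simp only [DRm, C.Rm_swap X, C.Rm_swap (C.nabla V X), map_neg]; ring

theorem DRm_skew : C.DRm X Y Z W V = - C.DRm X Y W Z V := by
  simp only [DRm, C.Rm_skew _ _ _ W, C.Rm_skew _ _ _ (C.nabla V W), map_neg]; ring

theorem DRm_bianchi : C.DRm X Y Z W V + C.DRm Y V Z W X + C.DRm V X Z W Y = 0 := by
  have key : C.nabla V (C.R X Y Z) - C.R (C.nabla V X) Y Z - C.R X (C.nabla V Y) Z
      - C.R X Y (C.nabla V Z)
      + (C.nabla X (C.R Y V Z) - C.R (C.nabla X Y) V Z - C.R Y (C.nabla X V) Z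
      - C.R Y V (C.nabla X Z))
      + (C.nabla Y (C.R V X Z) - C.R (C.nabla Y V) X Z - C.R V (C.nabla Y X) Z
      - C.R V X (C.nabla Y Z)) = 0 := by
    have h := congrArg (fun U ↦ C.nabla U Z) (C.jacobi V X Y)
    simp only [R, map_sub, map_add, AddMonoidHom.sub_apply, AddMonoidHom.add_apply] at h ⊢
    rw [← sub_eq_zero] at h
    rw [← neg_eq_zero, ← h]
    abel
  have h := congrArg (fun U ↦ C.g U W) key
  simp only [map_sub, map_add, LinearMap.sub_apply, LinearMap.add_apply, map_zero,
    LinearMap.zero_apply] at h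
  simp only [DRm, Rm, C.der_g]
  linear_combination h

end CurvatureTensor

omit [Algebra ℝ A] in
theorem isBilin_iff {P : Type*} [AddCommGroup P] [Module A P] {B : L → L → P} :
    IsBilin (A := A) B ↔ (∀ X X' Y, B (X + X') Y = B X Y + B X' Y) ∧
      (∀ (f : A) X Y, B (f • X) Y = f • B X Y) ∧ (∀ X Y Y', B X (Y + Y') = B X Y + B X Y') ∧
      ∀ (f : A) X Y, B X (f • Y) = f • B X Y :=
  ⟨fun h ↦ ⟨fun X X' Y ↦ (h.left Y).map_add X X', fun f X Y ↦ (h.left Y).map_smul f X,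
    fun X Y Y' ↦ (h.right X).map_add Y Y', fun f X Y ↦ (h.right X).map_smul f Y⟩,
  fun h ↦ ⟨fun Y ↦ ⟨fun X X' ↦ h.1 X X' Y, fun f X ↦ h.2.1 f X Y⟩,
    fun X ↦ ⟨fun Y Y' ↦ h.2.2.1 X Y Y', fun f Y ↦ h.2.2.2 f X Y⟩⟩⟩

/-- The Ricci tensor. -/
def Ric (Y Z : L) : A := ∑ i, C.Rm (C.e i) Y Z (C.e' i)

theorem isBilin_Rm₁₄ (Y Z : L) : IsBilin (A := A) fun X W ↦ C.Rm X Y Z W :=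
  isBilin_iff.2 ⟨fun _ _ _ ↦ C.Rm_add₁ _ _ _ _ _, fun _ _ _ ↦ C.Rm_smul₁ _ _ _ _ _,
    fun _ _ _ ↦ C.Rm_add₄ _ _ _ _ _, fun _ _ _ ↦ C.Rm_smul₄ _ _ _ _ _⟩

theorem Ric_symm (Y Z : L) : C.Ric Y Z = C.Ric Z Y := by
  rw [Ric, Ric, ← C.sum_swap (C.isBilin_Rm₁₄ Z Y)]
  refine Finset.sum_congr rfl fun i _ ↦ ?_
  rw [C.Rm_pair, C.Rm_swap, C.Rm_skew, neg_neg]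

theorem isBilin_Ric : IsBilin (A := A) C.Ric :=
  isBilin_iff.2 ⟨fun _ _ _ ↦ by simp only [Ric, Rm_add₂, Finset.sum_add_distrib],
    fun _ _ _ ↦ by simp only [Ric, Rm_smul₂, Finset.mul_sum, smul_eq_mul],
    fun _ _ _ ↦ by simp only [Ric, Rm_add₃, Finset.sum_add_distrib],
    fun _ _ _ ↦ by simp only [Ric, Rm_smul₃, Finset.mul_sum, smul_eq_mul]⟩

/-- The covariant derivative of the Ricci tensor. -/
def DRic (V Y Z : L) : A := C.der V (C.Ric Y Z) - C.Ric (C.nabla V Y) Z - C.Ric Y (C.nabla V Z)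

theorem DRic_eq (V Y Z : L) : C.DRic V Y Z = ∑ i, C.DRm (C.e i) Y Z (C.e' i) V := by
  have h := C.sum_nabla_frame (C.isBilin_Rm₁₄ Y Z) V
  simp only [DRic, Ric, DRm, map_sum]
  rw [← sub_eq_zero, ← h]
  simp only [← Finset.sum_sub_distrib]
  exact Finset.sum_congr rfl fun i _ ↦ by ring

/-- The scalar curvature. -/
def scal : A := ∑ i, C.Ric (C.e i) (C.e' i)

theorem der_scal (V : L) : C.der V C.scal = ∑ i, C.DRic V (C.e i) (C.e' i) := by
  have h := C.sum_nabla_frame C.isBilin_Ric V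
  simp only [DRic, scal, map_sum]
  rw [← sub_eq_zero, ← h, ← Finset.sum_sub_distrib]
  exact Finset.sum_congr rfl fun i _ ↦ by ring

/-- The contracted second Bianchi identity. -/
theorem der_scal_eq (V : L) : C.der V C.scal = 2 * ∑ i, C.DRic (C.e i) V (C.e' i) := by
  simp only [der_scal, DRic_eq]
  have h1 : ∑ i, ∑ j, (C.DRm (C.e j) (C.e i) (C.e' i) (C.e' j) V
      + C.DRm (C.e i) V (C.e' i) (C.e' j) (C.e j)
      + C.DRm V (C.e j) (C.e' i) (C.e' j) (C.e i)) = 0 :=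
    Finset.sum_eq_zero fun i _ ↦ Finset.sum_eq_zero fun j _ ↦ C.DRm_bianchi _ _ _ _ _
  have h2 : ∑ i, ∑ j, C.DRm (C.e i) V (C.e' i) (C.e' j) (C.e j)
      = - ∑ i, ∑ j, C.DRm (C.e j) V (C.e' i) (C.e' j) (C.e i) := by
    rw [Finset.sum_comm, ← Finset.sum_neg_distrib]
    refine Finset.sum_congr rfl fun i _ ↦ ?_
    rw [← Finset.sum_neg_distrib]
    exact Finset.sum_congr rfl fun j _ ↦ C.DRm_skew _ _ _ _ _
  have h3 : ∑ i, ∑ j, C.DRm V (C.e j) (C.e' i) (C.e' j) (C.e i)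
      = - ∑ i, ∑ j, C.DRm (C.e j) V (C.e' i) (C.e' j) (C.e i) := by
    rw [← Finset.sum_neg_distrib]
    refine Finset.sum_congr rfl fun i _ ↦ ?_
    rw [← Finset.sum_neg_distrib]
    exact Finset.sum_congr rfl fun j _ ↦ C.DRm_swap _ _ _ _ _
  simp only [Finset.sum_add_distrib] at h1
  rw [h2, h3] at h1
  linear_combination h1

/-- The divergence of the Einstein tensor vanishes. -/
theorem div_einstein (X : L) :
    C.div ((2 : A) • C.sharp (C.Ric X) - C.scal • X)
      = 2 * ∑ i, C.Ric (C.nabla (C.e i) X) (C.e' i) - C.scal * C.div X := by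
  have h1 := C.div_eq_sum (C.g_sharp (C.isBilin_Ric.right X))
  have h2 : ∑ i, (C.der (C.e i) (C.Ric X (C.e' i)) - C.Ric X (C.nabla (C.e i) (C.e' i)))
      = ∑ i, C.DRic (C.e i) X (C.e' i) + ∑ i, C.Ric (C.nabla (C.e i) X) (C.e' i) := by
    rw [← Finset.sum_add_distrib]
    exact Finset.sum_congr rfl fun i _ ↦ by rw [DRic]; ring
  have h3 : C.der (C.sharp (C.Ric X)) (2 : A) = 0 := by
    rw [← map_ofNat (algebraMap ℝ A) 2, Derivation.map_algebraMap]
  rw [div_sub, div_smul, div_smul, h1, h2, der_scal_eq, h3]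
  ring

end LeviCivitaCalculus


namespace LeviCivitaCalculus

variable {A L : Type*} [CommRing A] [Algebra ℝ A] [AddCommGroup L] [Module A L]
  (C : LeviCivitaCalculus A L)

/-- The bilinear form `⟨∇_X ξ, Y⟩`. -/
def dform (ξ X Y : L) : A := C.g (C.nabla X ξ) Y

theorem isBilin_dform (ξ : L) : IsBilin (A := A) (C.dform ξ) :=
  isBilin_iff.2 ⟨fun _ _ _ ↦ by simp [dform], fun f X _ ↦ by
    simp [dform], fun _ _ _ ↦ by simp [dform], fun _ _ _ ↦ by simp [dform]⟩

section Endomorphism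

variable (J : L →ₗ[A] L)

/-- The covariant derivative `(∇_X J) Y` of an endomorphism field. -/
def dJ (X Y : L) : L := C.nabla X (J Y) - J (C.nabla X Y)

theorem isBilin_dJ : IsBilin (A := A) (C.dJ J) :=
  isBilin_iff.2 ⟨fun _ _ _ ↦ by simp only [dJ, map_add, AddMonoidHom.add_apply]; abel,
    fun f X Y ↦ by
      have h (U : L) : C.nabla (f • X) U = f • C.nabla X U := by rw [map_smul]; rfl
      simp only [dJ, h, J.map_smul, smul_sub],
    fun _ _ _ ↦ by simp only [dJ, map_add]; abel,
    fun f X Y ↦ by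
      simp only [dJ, J.map_smul, C.nabla_smul, map_add, smul_sub]; abel⟩

/-- The second covariant derivative `(∇²_{X, Y} J) Z` of an endomorphism field. -/
def ddJ (X Y Z : L) : L :=
  C.nabla X (C.dJ J Y Z) - C.dJ J (C.nabla X Y) Z - C.dJ J Y (C.nabla X Z)

theorem ddJ_sub (X Y Z : L) :
    C.ddJ J X Y Z - C.ddJ J Y X Z = C.R X Y (J Z) - J (C.R X Y Z) := by
  simp only [ddJ, dJ, R, map_sub, AddMonoidHom.sub_apply]; abel

theorem nabla_sum_dJ (Z : L) :
    C.nabla Z (∑ i, C.dJ J (C.e i) (C.e' i)) = ∑ i, C.ddJ J Z (C.e i) (C.e' i) := by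
  have h := C.sum_nabla_frame (C.isBilin_dJ J) Z
  rw [map_sum, ← sub_eq_zero, ← h, ← Finset.sum_sub_distrib]
  exact Finset.sum_congr rfl fun i _ ↦ by rw [ddJ]; abel

variable {J}

theorem g_dJ (hJ : ∀ X Y, C.g (J X) Y = - C.g X (J Y)) (X Y Z : L) :
    C.g (C.dJ J X Y) Z = - C.g Y (C.dJ J X Z) := by
  have h := congrArg (C.der X) (hJ Y Z)
  simp only [map_neg, C.der_g] at h
  simp only [dJ, map_sub, LinearMap.sub_apply, hJ (C.nabla X Y)]
  rw [hJ Y (C.nabla X Z)] at h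
  linear_combination h

theorem g_ddJ (hJ : ∀ X Y, C.g (J X) Y = - C.g X (J Y)) (X Y Z W : L) :
    C.g (C.ddJ J X Y Z) W = - C.g Z (C.ddJ J X Y W) := by
  have h := congrArg (C.der X) (C.g_dJ hJ Y Z W)
  simp only [map_neg, C.der_g] at h
  have h1 := C.g_dJ hJ Y Z (C.nabla X W)
  have h2 := C.g_dJ hJ (C.nabla X Y) Z W
  have h3 := C.g_dJ hJ Y (C.nabla X Z) W
  simp only [ddJ, map_sub, LinearMap.sub_apply]
  linear_combination h - h1 - h2 - h3

/-- The divergence of the divergence of a skew endomorphism field vanishes. -/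
theorem div_sum_dJ (hJ : ∀ X Y, C.g (J X) Y = - C.g X (J Y)) :
    C.div (∑ i, C.dJ J (C.e i) (C.e' i)) = 0 := by
  have hRic : ∑ i, C.Ric (C.e i) (J (C.e' i)) = 0 := by
    apply eq_of_two_mul
    have hB : IsBilin (A := A) fun X Y ↦ C.Ric X (J Y) := by
      have := isBilin_iff.1 C.isBilin_Ric
      exact isBilin_iff.2 ⟨fun _ _ _ ↦ this.1 _ _ _, fun _ _ _ ↦ this.2.1 _ _ _,
        fun _ _ _ ↦ by simp [this.2.2.1], fun _ _ _ ↦ by simp [this.2.2.2]⟩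
    have h1 := C.sum_skew C.isBilin_Ric hJ
    have h2 := C.sum_swap hB
    simp only [C.Ric_symm (J _)] at h1
    rw [h2] at h1
    linear_combination h1
  have hsum : C.div (∑ i, C.dJ J (C.e i) (C.e' i))
      = ∑ j, ∑ i, C.g (C.ddJ J (C.e j) (C.e i) (C.e' i)) (C.e' j) := by
    simp only [div, nabla_sum_dJ]
    simp only [map_sum, LinearMap.sum_apply]
  have hskew : ∑ j, ∑ i, C.g (C.ddJ J (C.e j) (C.e i) (C.e' i)) (C.e' j)
      = - ∑ j, ∑ i, C.g (C.ddJ J (C.e i) (C.e j) (C.e' i)) (C.e' j) := by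
    rw [Finset.sum_comm, ← Finset.sum_neg_distrib]
    refine Finset.sum_congr rfl fun i _ ↦ ?_
    rw [← Finset.sum_neg_distrib]
    refine Finset.sum_congr rfl fun j _ ↦ ?_
    rw [C.g_ddJ hJ, C.g_symm]
  have hR : ∑ j, ∑ i, (C.g (C.ddJ J (C.e j) (C.e i) (C.e' i)) (C.e' j)
      - C.g (C.ddJ J (C.e i) (C.e j) (C.e' i)) (C.e' j)) = 0 := by
    have h (i j : C.ι) : C.g (C.ddJ J (C.e j) (C.e i) (C.e' i)) (C.e' j)
        - C.g (C.ddJ J (C.e i) (C.e j) (C.e' i)) (C.e' j)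
        = C.Rm (C.e j) (C.e i) (J (C.e' i)) (C.e' j)
          + C.Rm (C.e i) (C.e j) (J (C.e' j)) (C.e' i) := by
      rw [← LinearMap.sub_apply, ← map_sub, ddJ_sub, map_sub, LinearMap.sub_apply, hJ,
        C.Rm_swap (C.e i), C.Rm_skew (C.e j) (C.e i) (J (C.e' j))]
      simp only [Rm]
      ring
    simp only [h, Finset.sum_add_distrib]
    have h1 : ∑ i, ∑ j, C.Rm (C.e j) (C.e i) (J (C.e' i)) (C.e' j) = 0 := hRic
    rw [Finset.sum_comm, h1, zero_add]
  simp only [Finset.sum_sub_distrib] at hR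
  apply eq_of_two_mul
  rw [hsum]
  linear_combination hskew + hR

variable {ξ : L}

/-- If `Jξ` is the divergence of the orthogonal almost complex structure `J`, then the contraction
of `∇ξ` with `J` vanishes. -/
theorem sum_dform_J (hJ : ∀ X Y, C.g (J X) Y = - C.g X (J Y))
    (hξ : J ξ = ∑ i, C.dJ J (C.e i) (C.e' i)) : ∑ i, C.dform ξ (C.e i) (J (C.e' i)) = 0 := by
  have h := C.div_sum_dJ hJ
  rw [← hξ, div] at h
  have h1 (i : C.ι) : C.g (C.nabla (C.e i) (J ξ)) (C.e' i)
      = - C.g ξ (C.dJ J (C.e i) (C.e' i)) - C.dform ξ (C.e i) (J (C.e' i)) := by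
    rw [← C.g_dJ hJ, dform, dJ, ← neg_eq_iff_eq_neg.2 (hJ _ _)]
    simp
  simp only [h1, Finset.sum_sub_distrib, Finset.sum_neg_distrib] at h
  have h2 : C.g ξ (J ξ) = 0 := eq_of_two_mul (by
    have := hJ ξ ξ
    rw [C.g_symm] at this
    linear_combination this)
  rw [← map_sum, ← hξ, h2] at h
  linear_combination -h

end Endomorphism

/-! ### The exterior derivative of a 1-form -/

section ExteriorDerivative

variable (ξ : L)

/-- The exterior derivative of the 1-form `⟨ξ, ·⟩`. -/
def ext (X Y : L) : A := C.dform ξ X Y - C.dform ξ Y X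

theorem ext_swap (X Y : L) : C.ext ξ X Y = - C.ext ξ Y X := by simp [ext]

theorem isBilin_ext : IsBilin (A := A) (C.ext ξ) := by
  have h := isBilin_iff.1 (C.isBilin_dform ξ)
  simp only [smul_eq_mul] at h
  exact isBilin_iff.2 ⟨fun _ _ _ ↦ by rw [ext, h.1, h.2.2.1, ext, ext]; ring,
    fun _ _ _ ↦ by rw [ext, h.2.1, h.2.2.2, ext]; simp [mul_sub],
    fun _ _ _ ↦ by rw [ext, h.1, h.2.2.1, ext, ext]; ring,
    fun _ _ _ ↦ by rw [ext, h.2.1, h.2.2.2, ext]; simp [mul_sub]⟩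

/-- The covariant derivative of the exterior derivative of the 1-form `⟨ξ, ·⟩`. -/
def dext (X Y Z : L) : A :=
  C.der X (C.ext ξ Y Z) - C.ext ξ (C.nabla X Y) Z - C.ext ξ Y (C.nabla X Z)

theorem dext_swap (X Y Z : L) : C.dext ξ X Y Z = - C.dext ξ X Z Y := by
  simp only [dext, C.ext_swap ξ _ Z, C.ext_swap ξ Y, map_neg]; ring

theorem dext_cyclic (X Y Z : L) : C.dext ξ X Y Z + C.dext ξ Y Z X + C.dext ξ Z X Y = 0 := by
  have h := C.Rm_bianchi X Y Z ξ
  rw [C.Rm_skew X Y, C.Rm_skew Y Z, C.Rm_skew Z X] at h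
  simp only [Rm, R, map_sub, LinearMap.sub_apply, AddMonoidHom.sub_apply] at h
  simp only [dext, ext, dform, map_sub, C.der_g]
  linear_combination -h

theorem isBilin_dext (Y : L) : IsBilin (A := A) fun X Z ↦ C.dext ξ X Y Z := by
  have h := isBilin_iff.1 (C.isBilin_ext ξ)
  simp only [smul_eq_mul] at h
  exact isBilin_iff.2 ⟨fun _ _ _ ↦ by
      simp only [dext, map_add, AddMonoidHom.add_apply, h.1, h.2.2.1, Derivation.add_apply]; ring,
    fun f X _ ↦ by
      have hn (U : L) : C.nabla (f • X) U = f • C.nabla X U := by rw [map_smul]; rfl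
      simp only [dext, hn, h.2.1, h.2.2.2, C.der.map_smul, Derivation.smul_apply, smul_eq_mul]
      ring,
    fun _ _ _ ↦ by simp only [dext, map_add, h.2.2.1]; ring,
    fun _ _ _ ↦ by
      simp only [dext, C.nabla_smul, h.2.2.1, h.2.2.2, Derivation.leibniz, smul_eq_mul]; ring⟩

theorem div_sharp_ext : 2 * C.div (C.sharp (C.ext ξ ξ))
    = 2 * ∑ i, C.dext ξ (C.e i) ξ (C.e' i)
      - ∑ i, ∑ j, C.ext ξ (C.e i) (C.e j) * C.ext ξ (C.e' i) (C.e' j) := by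
  have hF := C.isBilin_ext ξ
  have h1 := C.div_eq_sum (C.g_sharp (hF.right ξ))
  have h2 : ∑ i, (C.der (C.e i) (C.ext ξ ξ (C.e' i)) - C.ext ξ ξ (C.nabla (C.e i) (C.e' i)))
      = ∑ i, C.dext ξ (C.e i) ξ (C.e' i) + ∑ i, C.ext ξ (C.nabla (C.e i) ξ) (C.e' i) := by
    rw [← Finset.sum_add_distrib]
    exact Finset.sum_congr rfl fun i _ ↦ by rw [dext]; ring
  have h3 : ∑ i, C.ext ξ (C.nabla (C.e i) ξ) (C.e' i)
      = ∑ i, ∑ j, C.dform ξ (C.e i) (C.e j) * C.ext ξ (C.e' j) (C.e' i) :=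
    Finset.sum_congr rfl fun i _ ↦ (C.contract_right (hF.left (C.e' i)) _).symm
  have h4 : ∑ i, ∑ j, C.dform ξ (C.e i) (C.e j) * C.ext ξ (C.e' j) (C.e' i)
      = - ∑ i, ∑ j, C.dform ξ (C.e j) (C.e i) * C.ext ξ (C.e' j) (C.e' i) := by
    rw [Finset.sum_comm, ← Finset.sum_neg_distrib]
    refine Finset.sum_congr rfl fun i _ ↦ ?_
    rw [← Finset.sum_neg_distrib]
    refine Finset.sum_congr rfl fun j _ ↦ ?_
    rw [C.ext_swap ξ (C.e' i)]
    ring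
  have h5 : ∑ i, ∑ j, C.ext ξ (C.e i) (C.e j) * C.ext ξ (C.e' i) (C.e' j)
      = - ∑ i, ∑ j, C.dform ξ (C.e i) (C.e j) * C.ext ξ (C.e' j) (C.e' i)
        + ∑ i, ∑ j, C.dform ξ (C.e j) (C.e i) * C.ext ξ (C.e' j) (C.e' i) := by
    simp only [← Finset.sum_neg_distrib, ← Finset.sum_add_distrib]
    refine Finset.sum_congr rfl fun i _ ↦ Finset.sum_congr rfl fun j _ ↦ ?_
    rw [C.ext_swap ξ (C.e' i), ext]
    ring
  rw [h1, h2, h3, h5]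
  linear_combination h4

end ExteriorDerivative

end LeviCivitaCalculus


namespace LeviCivitaCalculus

variable {A L : Type*} [CommRing A] [Algebra ℝ A] [AddCommGroup L] [Module A L]
  (C : LeviCivitaCalculus A L)

/-- The data of a Hermitian surface: an orthogonal almost complex structure `J` and the vector field
`ξ` dual to its Lee form, which determines the covariant derivative of `J`. -/
structure IsHermitianSurface (J : L →ₗ[A] L) (ξ : L) : Prop where
  J_J (X : L) : J (J X) = -X
  g_J (X Y : L) : C.g (J X) Y = - C.g X (J Y)
  sum_g : ∑ i, C.g (C.e i) (C.e' i) = 4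
  J_lee : J ξ = ∑ i, C.dJ J (C.e i) (C.e' i)
  two_g_dJ (X Y Z : L) : 2 * C.g (C.dJ J X Y) Z = C.g ξ (J Y) * C.g X Z - C.g ξ Y * C.g (J X) Z
    - C.g X (J Y) * C.g ξ Z + C.g X Y * C.g (J ξ) Z

variable {C} {J : L →ₗ[A] L} {ξ : L} (h : C.IsHermitianSurface J ξ)

namespace IsHermitianSurface

include h

theorem two_bilin_dJ {B : L → L → A} (hB : IsBilin (A := A) B) (X Y Z : L) :
    2 * B Z (C.dJ J X Y) = C.g ξ (J Y) * B Z X - C.g ξ Y * B Z (J X)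
      - C.g X (J Y) * B Z ξ + C.g X Y * B Z (J ξ) := by
  have e : (2 : A) • C.dJ J X Y
      = C.g ξ (J Y) • X - C.g ξ Y • J X - C.g X (J Y) • ξ + C.g X Y • J ξ :=
    C.ext_g fun W ↦ by simp [h.two_g_dJ X Y W]
  have e' := congrArg ((hB.right Z).mk' _) e
  simpa only [map_add, map_sub, map_smul, smul_eq_mul, IsLinearMap.mk'_apply] using e'

theorem ext_J (hB : ∀ X Y, C.dform ξ (J X) (J Y) = - C.dform ξ Y X) (X Y : L) :
    C.ext ξ (J X) Y = - C.ext ξ X (J Y) := by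
  have h1 (X Y : L) : C.ext ξ (J X) (J Y) = C.ext ξ X Y := by rw [ext, hB, hB, ext]; ring
  have h2 := h1 (J X) Y
  have h3 := isBilin_iff.1 (C.isBilin_ext ξ)
  rw [h.J_J, ← neg_one_smul A X, h3.2.1] at h2
  simp only [smul_eq_mul, neg_mul, one_mul] at h2
  rw [← h2]

theorem sum_ext_J :
    ∑ i, C.ext ξ (C.e i) (J (C.e' i)) = 0 := by
  have hb := C.isBilin_dform ξ
  have hb' := isBilin_iff.1 hb
  have h1 := C.sum_dform_J h.g_J h.J_lee
  have h2 : ∑ i, C.dform ξ (J (C.e' i)) (C.e i) = - ∑ i, C.dform ξ (C.e i) (J (C.e' i)) := by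
    have hB' : IsBilin (A := A) fun X Y ↦ C.dform ξ (J X) Y :=
      isBilin_iff.2 ⟨fun _ _ _ ↦ by simp only [map_add, hb'.1],
        fun _ _ _ ↦ by simp only [map_smul, hb'.2.1], fun _ _ _ ↦ hb'.2.2.1 _ _ _,
        fun _ _ _ ↦ hb'.2.2.2 _ _ _⟩
    rw [C.sum_swap hB', C.sum_skew hb h.g_J]
  simp only [ext, Finset.sum_sub_distrib, h2, h1]
  simp

theorem sum_dext (hB : ∀ X Y, C.dform ξ (J X) (J Y) = - C.dform ξ Y X) (X : L) :
    ∑ i, C.dext ξ (C.e i) (C.e' i) X = 0 := by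
  have hF := C.isBilin_ext ξ
  have hF' := isBilin_iff.1 hF
  have hJ := h.ext_J hB
  have hprim := h.sum_ext_J
  have hneg (X Y : L) : C.ext ξ X (-Y) = - C.ext ξ X Y := by
    rw [← neg_one_smul A Y, hF'.2.2.2]; simp
  have contr (U W : L) : ∑ i, C.g U (C.e' i) * C.ext ξ (C.e i) W = C.ext ξ U W :=
    C.contract_left (hF.left W) U
  have contr' (U W : L) : ∑ i, C.g U (C.e i) * C.ext ξ (C.e' i) W = C.ext ξ U W :=
    C.contract_right (hF.left W) U
  have hBJ : IsBilin (A := A) fun X Y ↦ C.ext ξ X (J Y) :=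
    isBilin_iff.2 ⟨fun _ _ _ ↦ hF'.1 _ _ _, fun _ _ _ ↦ hF'.2.1 _ _ _,
      fun _ _ _ ↦ by simp only [map_add, hF'.2.2.1],
      fun _ _ _ ↦ by simp only [map_smul, hF'.2.2.2]⟩
  have key (X : L) : ∑ i, C.dext ξ (C.e i) (C.e' i) (J X) = 0 := by
    have h1 : ∑ i, C.dext ξ X (C.e i) (J (C.e' i))
        = - ∑ i, C.ext ξ (C.e i) (C.dJ J X (C.e' i)) := by
      have a1 := congrArg (C.der X) hprim
      have a2 := C.sum_nabla_frame hBJ X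
      simp only [map_sum, map_zero] at a1
      rw [← add_eq_zero_iff_eq_neg, ← Finset.sum_add_distrib]
      refine Eq.trans ?_ ((congrArg₂ (· - ·) a1 a2).trans (sub_zero 0))
      rw [← Finset.sum_sub_distrib]
      refine Finset.sum_congr rfl fun i _ ↦ ?_
      have a3 : C.nabla X (J (C.e' i)) = C.dJ J X (C.e' i) + J (C.nabla X (C.e' i)) := by
        rw [dJ]; abel
      rw [dext, a3, hF'.2.2.1]
      ring
    have h2 : ∑ i, C.dext ξ (J (C.e' i)) X (C.e i) = ∑ i, C.dext ξ (C.e i) (J (C.e' i)) X := by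
      have hD := C.isBilin_dext ξ X
      have hD' := isBilin_iff.1 hD
      have hBD : IsBilin (A := A) fun U V ↦ C.dext ξ (J U) X V :=
        isBilin_iff.2 ⟨fun _ _ _ ↦ by simp only [map_add, hD'.1],
          fun _ _ _ ↦ by simp only [map_smul, hD'.2.1], fun _ _ _ ↦ hD'.2.2.1 _ _ _,
          fun _ _ _ ↦ hD'.2.2.2 _ _ _⟩
      rw [C.sum_swap hBD, C.sum_skew hD h.g_J, ← Finset.sum_neg_distrib]
      exact Finset.sum_congr rfl fun i _ ↦ by rw [C.dext_swap ξ _ _ X]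
    have h3 : ∑ i, (C.dext ξ X (C.e i) (J (C.e' i)) + C.dext ξ (C.e i) (J (C.e' i)) X
        + C.dext ξ (J (C.e' i)) X (C.e i)) = 0 :=
      Finset.sum_eq_zero fun i _ ↦ C.dext_cyclic ξ _ _ _
    have h4 (i : C.ι) : C.dext ξ (C.e i) (J (C.e' i)) X = - C.dext ξ (C.e i) (C.e' i) (J X)
        - C.ext ξ (C.dJ J (C.e i) (C.e' i)) X - C.ext ξ (C.e' i) (C.dJ J (C.e i) X) := by
      have a3 (U : L) : C.nabla (C.e i) (J U) = C.dJ J (C.e i) U + J (C.nabla (C.e i) U) := by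
        rw [dJ]; abel
      simp only [dext, a3, hF'.1, hF'.2.2.1, hJ, map_neg]
      ring
    have h5 : ∑ i, C.ext ξ (C.dJ J (C.e i) (C.e' i)) X = C.ext ξ (J ξ) X := by
      rw [h.J_lee]
      exact (map_sum ((hF.left X).mk' _) _ _).symm
    have h6 : 2 * ∑ i, C.ext ξ (C.e i) (C.dJ J X (C.e' i)) = 0 := by
      have a (i : C.ι) : 2 * C.ext ξ (C.e i) (C.dJ J X (C.e' i))
          = - (C.g (J ξ) (C.e' i) * C.ext ξ (C.e i) X) - C.g ξ (C.e' i) * C.ext ξ (C.e i) (J X)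
            + C.g (J X) (C.e' i) * C.ext ξ (C.e i) ξ + C.g X (C.e' i) * C.ext ξ (C.e i) (J ξ) := by
        rw [h.two_bilin_dJ hF, h.g_J ξ, h.g_J X]; ring
      simp only [Finset.mul_sum, a, Finset.sum_add_distrib, Finset.sum_sub_distrib,
        Finset.sum_neg_distrib, contr]
      linear_combination hJ X ξ - hJ ξ X
    have h7 : 2 * ∑ i, C.ext ξ (C.e' i) (C.dJ J (C.e i) X) = 2 * C.ext ξ ξ (J X) := by
      have a (i : C.ι) : 2 * C.ext ξ (C.e' i) (C.dJ J (C.e i) X)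
          = C.g ξ (J X) * C.ext ξ (C.e' i) (C.e i) - C.g ξ X * C.ext ξ (C.e' i) (J (C.e i))
            - C.g (J X) (C.e i) * C.ext ξ (C.e' i) ξ + C.g X (C.e i) * C.ext ξ (C.e' i) (J ξ) := by
        rw [h.two_bilin_dJ hF, C.g_symm (C.e i) (J X), C.g_symm (C.e i) X]
      have b1 : ∑ i, C.ext ξ (C.e' i) (C.e i) = 0 := by
        apply eq_of_two_mul
        have := C.sum_swap hF
        have e2 : ∑ i, C.ext ξ (C.e i) (C.e' i) = - ∑ i, C.ext ξ (C.e' i) (C.e i) := by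
          rw [← Finset.sum_neg_distrib]
          exact Finset.sum_congr rfl fun i _ ↦ C.ext_swap ξ _ _
        linear_combination this + e2
      have b2 : ∑ i, C.ext ξ (C.e' i) (J (C.e i)) = 0 := (C.sum_swap hBJ).trans hprim
      simp only [Finset.mul_sum, a, Finset.sum_add_distrib, Finset.sum_sub_distrib, contr']
      rw [← Finset.mul_sum, ← Finset.mul_sum, b1, b2]
      linear_combination hJ X ξ - 2 * C.ext_swap ξ (J X) ξ
    simp only [Finset.sum_add_distrib, h1, h2] at h3
    have h8 : ∑ i, C.dext ξ (C.e i) (J (C.e' i)) X = - ∑ i, C.dext ξ (C.e i) (C.e' i) (J X)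
        - ∑ i, C.ext ξ (C.dJ J (C.e i) (C.e' i)) X - ∑ i, C.ext ξ (C.e' i) (C.dJ J (C.e i) X) := by
      simp only [h4, Finset.sum_sub_distrib, Finset.sum_neg_distrib]
    have h9 := eq_of_two_mul h7
    have h10 := eq_of_two_mul (h6.trans (mul_zero 2).symm)
    rw [h5, h9, hJ] at h8
    rw [h10, h8] at h3
    apply eq_of_two_mul
    linear_combination -h3
  rw [show X = J (-(J X)) by simp [h.J_J]]
  exact key _

/-- On a Hermitian surface whose `ξ` satisfies `⟨∇_{JX} ξ, JY⟩ = -⟨∇_Y ξ, X⟩`, the squared norm of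
the exterior derivative of the Lee form is a divergence. -/
theorem exists_div_eq_ext (hB : ∀ X Y, C.dform ξ (J X) (J Y) = - C.dform ξ Y X) :
    ∃ X, C.div X = ∑ i, ∑ j, C.ext ξ (C.e i) (C.e j) * C.ext ξ (C.e' i) (C.e' j) := by
  have h1 := C.div_sharp_ext ξ
  have h2 : ∑ i, C.dext ξ (C.e i) ξ (C.e' i) = 0 := by
    simp only [C.dext_swap ξ _ ξ, Finset.sum_neg_distrib, h.sum_dext hB ξ, neg_zero]
  refine ⟨(-2 : A) • C.sharp (C.ext ξ ξ), ?_⟩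
  have h3 : C.der (C.sharp (C.ext ξ ξ)) (-2 : A) = 0 := by
    rw [map_neg, ← map_ofNat (algebraMap ℝ A) 2, Derivation.map_algebraMap, neg_zero]
  rw [div_smul, h3]
  rw [h2] at h1
  linear_combination -h1

end IsHermitianSurface

end LeviCivitaCalculus


namespace LeviCivitaCalculus

variable {A L : Type*} [CommRing A] [Algebra ℝ A] [AddCommGroup L] [Module A L]
  {C : LeviCivitaCalculus A L} {J : L →ₗ[A] L} {ξ : L}

variable (C ξ) in
/-- Eight times the tensor whose Kulkarni-Nomizu product with the metric relates the Riemannian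
curvature to the curvature of the Weyl connection with Lee field `ξ`. -/
def schouten (X Y : L) : A :=
  4 * C.dform ξ X Y + 2 * (C.g ξ X * C.g ξ Y) - C.g ξ ξ * C.g X Y

variable (C ξ) in
/-- Eight times the curvature of the Weyl connection with Lee field `ξ`. -/
def weylRm (X Y Z W : L) : A :=
  8 * C.Rm X Y Z W + (C.schouten ξ Y Z * C.g X W - C.schouten ξ X Z * C.g Y W
    + C.g Y Z * C.schouten ξ X W - C.g X Z * C.schouten ξ Y W)

namespace IsHermitianSurface

variable (h : C.IsHermitianSurface J ξ)

include h

theorem four_g_ddJ (X Y Z W : L) : 4 * C.g (C.ddJ J X Y Z) W =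
    2 * (C.dform ξ X (J Z) * C.g Y W - C.dform ξ X Z * C.g (J Y) W - C.g Y (J Z) * C.dform ξ X W
      - C.g Y Z * C.dform ξ X (J W))
    + 2 * C.g ξ (C.dJ J X Z) * C.g Y W - C.g ξ Z * (2 * C.g (C.dJ J X Y) W)
    - 2 * C.g Y (C.dJ J X Z) * C.g ξ W + C.g Y Z * (2 * C.g (C.dJ J X ξ) W) := by
  have e1 := congrArg (C.der X) (h.two_g_dJ Y Z W)
  have e2 := h.two_g_dJ (C.nabla X Y) Z W
  have e3 := h.two_g_dJ Y (C.nabla X Z) W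
  have e4 := h.two_g_dJ Y Z (C.nabla X W)
  have a3 (U : L) : C.nabla X (J U) = C.dJ J X U + J (C.nabla X U) := by rw [dJ]; abel
  have h2 : C.der X (2 : A) = 0 := by
    rw [← map_ofNat (algebraMap ℝ A) 2, Derivation.map_algebraMap]
  simp only [map_add, map_sub, Derivation.leibniz, smul_eq_mul, C.der_g, h2, a3,
    LinearMap.add_apply] at e1
  simp only [ddJ, map_sub, LinearMap.sub_apply, dform]
  rw [← neg_eq_iff_eq_neg.2 (h.g_J (C.nabla X ξ) W)]
  linear_combination 2 * e1 - 2 * e2 - 2 * e3 - 2 * e4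

theorem weylRm_J (X Y Z W : L) :
    C.weylRm ξ X Y (J Z) W = - C.weylRm ξ X Y Z (J W) := by
  have e := congrArg (C.g · W) (C.ddJ_sub J X Y Z)
  simp only [map_sub, LinearMap.sub_apply, h.g_J (C.R X Y Z)] at e
  have e1 := h.four_g_ddJ X Y Z W
  have e2 := h.four_g_ddJ Y X Z W
  have s := C.g_symm
  have t1 := h.two_g_dJ X Z ξ
  have t2 := h.two_g_dJ X Z Y
  have t3 := h.two_g_dJ X Y W
  have t4 := h.two_g_dJ X ξ W
  have u1 := h.two_g_dJ Y Z ξ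
  have u2 := h.two_g_dJ Y Z X
  have u3 := h.two_g_dJ Y X W
  have u4 := h.two_g_dJ Y ξ W
  rw [s _ ξ] at t1 u1
  rw [s _ Y] at t2
  rw [s _ X] at u2
  have sJ (X Y : L) : C.g X (J Y) = - C.g Y (J X) := by rw [s, h.g_J]
  have sJ0 (X : L) : C.g X (J X) = 0 := eq_of_two_mul (by linear_combination sJ X X)
  simp only [h.g_J, sJ0, s X ξ, s Y ξ, s Y X, sJ X ξ, sJ Y ξ, sJ Y X]
    at e e1 e2 t1 t2 t3 t4 u1 u2 u3 u4
  simp only [weylRm, Rm, schouten]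
  linear_combination (-8) * e + 2 * e1 - 2 * e2
    + 2 * (t1 * C.g Y W - C.g ξ Z * t3 - t2 * C.g ξ W + C.g Y Z * t4)
    - 2 * (u1 * C.g X W - C.g ξ Z * u3 - u2 * C.g ξ W + C.g X Z * u4)

omit h in
theorem isBilin_schouten : IsBilin (A := A) (C.schouten ξ) := by
  have hb := isBilin_iff.1 (C.isBilin_dform ξ)
  simp only [smul_eq_mul] at hb
  exact isBilin_iff.2 ⟨fun _ _ _ ↦ by
      simp only [schouten, hb.1, map_add, LinearMap.add_apply]; ring,
    fun _ _ _ ↦ by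
      simp only [schouten, hb.2.1, map_smul, LinearMap.smul_apply, smul_eq_mul]; ring,
    fun _ _ _ ↦ by simp only [schouten, hb.2.2.1, map_add]; ring,
    fun _ _ _ ↦ by simp only [schouten, hb.2.2.2, map_smul, smul_eq_mul]; ring⟩

omit h in
theorem isBilin_weylRm (Y Z : L) : IsBilin (A := A) fun X W ↦ C.weylRm ξ X Y Z W := by
  have hb := isBilin_iff.1 (isBilin_schouten (C := C) (ξ := ξ))
  simp only [smul_eq_mul] at hb
  exact isBilin_iff.2 ⟨fun _ _ _ ↦ by
      simp only [weylRm, hb.1, Rm_add₁, map_add, LinearMap.add_apply]; ring,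
    fun _ _ _ ↦ by
      simp only [weylRm, hb.2.1, Rm_smul₁, map_smul, LinearMap.smul_apply, smul_eq_mul]; ring,
    fun _ _ _ ↦ by simp only [weylRm, hb.2.2.1, Rm_add₄, map_add]; ring,
    fun _ _ _ ↦ by simp only [weylRm, hb.2.2.2, Rm_smul₄, map_smul, smul_eq_mul]; ring⟩

omit h in
theorem weylRm_pair (hS : ∀ X Y, C.dform ξ X Y = C.dform ξ Y X) (X Y Z W : L) :
    C.weylRm ξ X Y Z W = C.weylRm ξ Z W X Y := by
  have hs (X Y : L) : C.schouten ξ X Y = C.schouten ξ Y X := by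
    rw [schouten, schouten, hS, C.g_symm X Y]; ring
  rw [weylRm, weylRm, C.Rm_pair, hs W X, hs Z X, hs W Y, hs Z Y, C.g_symm Z Y, C.g_symm W X,
    C.g_symm W Y, C.g_symm Z X]
  ring

theorem sum_J_J {B : L → L → A} (hB : IsBilin (A := A) B) :
    ∑ i, B (J (C.e i)) (J (C.e' i)) = ∑ i, B (C.e i) (C.e' i) := by
  have hb := isBilin_iff.1 hB
  have hB' : IsBilin (A := A) fun X Y ↦ B X (J Y) :=
    isBilin_iff.2 ⟨fun _ _ _ ↦ hb.1 _ _ _, fun _ _ _ ↦ hb.2.1 _ _ _,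
      fun _ _ _ ↦ by simp only [map_add, hb.2.2.1], fun _ _ _ ↦ by simp only [map_smul, hb.2.2.2]⟩
  rw [C.sum_skew hB' h.g_J, ← Finset.sum_neg_distrib]
  refine Finset.sum_congr rfl fun i _ ↦ ?_
  rw [h.J_J, ← neg_one_smul A (C.e' i), hb.2.2.2]
  simp

theorem sum_weylRm_J (hS : ∀ X Y, C.dform ξ X Y = C.dform ξ Y X) (Y Z : L) :
    ∑ i, C.weylRm ξ (C.e i) (J Y) (J Z) (C.e' i) = ∑ i, C.weylRm ξ (C.e i) Y Z (C.e' i) := by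
  have h34 (X Y Z W : L) : C.weylRm ξ X Y (J Z) (J W) = C.weylRm ξ X Y Z W := by
    rw [h.weylRm_J, h.J_J, ← neg_one_smul A W, (isBilin_iff.1 (isBilin_weylRm Y Z)).2.2.2]
    simp
  rw [← h.sum_J_J (isBilin_weylRm (J Y) (J Z))]
  refine Finset.sum_congr rfl fun i _ ↦ ?_
  rw [h34, weylRm_pair hS, h34, weylRm_pair hS]

theorem sum_weylRm (Y Z : L) : ∑ i, C.weylRm ξ (C.e i) Y Z (C.e' i)
    = 8 * C.Ric Y Z + 2 * C.schouten ξ Y Z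
      + (∑ i, C.schouten ξ (C.e i) (C.e' i)) * C.g Y Z := by
  have hb := isBilin_schouten (C := C) (ξ := ξ)
  have h1 : ∑ i, C.g Z (C.e i) * C.schouten ξ Y (C.e' i) = C.schouten ξ Y Z :=
    C.contract_right (hb.right Y) Z
  have h2 : ∑ i, C.g Y (C.e' i) * C.schouten ξ (C.e i) Z = C.schouten ξ Y Z :=
    C.contract_left (hb.left Z) Y
  have h3 (i : C.ι) : C.weylRm ξ (C.e i) Y Z (C.e' i) = 8 * C.Rm (C.e i) Y Z (C.e' i)
      + (C.schouten ξ Y Z * C.g (C.e i) (C.e' i) - C.g Y (C.e' i) * C.schouten ξ (C.e i) Z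
      + C.g Y Z * C.schouten ξ (C.e i) (C.e' i) - C.g Z (C.e i) * C.schouten ξ Y (C.e' i)) := by
    rw [weylRm, C.g_symm Z]; ring
  simp only [h3, Finset.sum_add_distrib, Finset.sum_sub_distrib, ← Finset.mul_sum, h1, h2, h.sum_g,
    Ric]
  ring

/-- On a Hermitian surface whose Lee field `ξ` is divergence free, closed and satisfies
`⟨∇_{JX} ξ, JY⟩ = -⟨∇_X ξ, Y⟩`, the squared norm of `∇ξ` is a divergence. -/
theorem exists_div_eq_dform (hB : ∀ X Y, C.dform ξ (J X) (J Y) = - C.dform ξ Y X)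
    (hS : ∀ X Y, C.dform ξ X Y = C.dform ξ Y X) (hdiv : C.div ξ = 0) :
    ∃ X, C.div X = ∑ i, ∑ j, C.dform ξ (C.e i) (C.e j) * C.dform ξ (C.e' i) (C.e' j) := by
  have hb := isBilin_iff.1 (C.isBilin_dform ξ)
  have hBJ (X Y : L) : C.dform ξ (J X) Y = C.dform ξ X (J Y) := by
    have := hB X (J Y)
    rw [h.J_J, ← neg_one_smul A Y, hb.2.2.2, hS (J Y)] at this
    simpa using this
  have hSJ (X : L) : C.nabla (J X) ξ = - J (C.nabla X ξ) := C.ext_g fun Y ↦ by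
    have := hBJ X Y
    simp only [dform] at this
    simp [this, h.g_J]
  have hsch := isBilin_schouten (C := C) (ξ := ξ)
  have hlin {D : L → L → A} (hD : IsBilin (A := A) D) :
      IsBilin (A := A) fun X Y ↦ D X (C.nabla Y ξ) := by
    have hd := isBilin_iff.1 hD
    exact isBilin_iff.2 ⟨fun _ _ _ ↦ hd.1 _ _ _, fun _ _ _ ↦ hd.2.1 _ _ _,
      fun _ _ _ ↦ by simp only [map_add, AddMonoidHom.add_apply, hd.2.2.1],
      fun f X Y ↦ by
        have hn : C.nabla (f • Y) ξ = f • C.nabla Y ξ := by rw [map_smul]; rfl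
        simp only [hn, hd.2.2.2]⟩
  set t := ∑ i, C.schouten ξ (C.e i) (C.e' i) with ht
  have hW : IsBilin (A := A) fun Y Z ↦ 8 * C.Ric Y Z + 2 * C.schouten ξ Y Z + t * C.g Y Z := by
    have h1 := isBilin_iff.1 C.isBilin_Ric
    have h2 := isBilin_iff.1 hsch
    simp only [smul_eq_mul] at h1 h2
    exact isBilin_iff.2 ⟨fun _ _ _ ↦ by simp only [h1.1, h2.1, map_add, LinearMap.add_apply]; ring,
      fun _ _ _ ↦ by
        simp only [h1.2.1, h2.2.1, map_smul, LinearMap.smul_apply, smul_eq_mul]; ring,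
      fun _ _ _ ↦ by simp only [h1.2.2.1, h2.2.2.1, map_add]; ring,
      fun _ _ _ ↦ by simp only [h1.2.2.2, h2.2.2.2, map_smul, smul_eq_mul]; ring⟩
  have hWJ (Y Z : L) : 8 * C.Ric (J Y) (J Z) + 2 * C.schouten ξ (J Y) (J Z) + t * C.g (J Y) (J Z)
      = 8 * C.Ric Y Z + 2 * C.schouten ξ Y Z + t * C.g Y Z := by
    rw [← h.sum_weylRm, ← h.sum_weylRm, h.sum_weylRm_J hS]
  have h0 : ∑ i, (8 * C.Ric (C.e i) (C.nabla (C.e' i) ξ)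
      + 2 * C.schouten ξ (C.e i) (C.nabla (C.e' i) ξ) + t * C.g (C.e i) (C.nabla (C.e' i) ξ))
      = 0 := by
    have h1 := h.sum_J_J (hlin hW)
    have h2 := (isBilin_iff.1 hW).2.2.2 (-1 : A)
    simp only [hSJ, ← neg_one_smul A (J _), h2, hWJ, smul_eq_mul, neg_mul, one_mul,
      Finset.sum_neg_distrib] at h1
    exact eq_of_two_mul (by linear_combination -h1)
  have htr : ∑ i, C.g (C.e i) (C.nabla (C.e' i) ξ) = 0 := by
    refine Eq.trans ?_ ((C.sum_swap (C.isBilin_dform ξ)).trans hdiv)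
    exact Finset.sum_congr rfl fun i _ ↦ C.g_symm _ _
  have hsq : ∑ i, C.dform ξ (C.e i) (C.nabla (C.e' i) ξ)
      = ∑ i, ∑ j, C.dform ξ (C.e i) (C.e j) * C.dform ξ (C.e' i) (C.e' j) := by
    refine Finset.sum_congr rfl fun i _ ↦ ?_
    rw [← C.contract_left ((C.isBilin_dform ξ).right (C.e i)) (C.nabla (C.e' i) ξ)]
    exact Finset.sum_congr rfl fun j _ ↦ by rw [smul_eq_mul, mul_comm]; rfl
  have hξξ : ∑ i, C.g ξ (C.e i) * C.g ξ (C.nabla (C.e' i) ξ) = C.dform ξ ξ ξ := by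
    refine (C.contract_right (f := fun Y ↦ C.g ξ (C.nabla Y ξ)) ⟨fun _ _ ↦ by simp, fun f Y ↦ ?_⟩
      ξ).trans (C.g_symm _ _)
    have hn : C.nabla (f • Y) ξ = f • C.nabla Y ξ := by rw [map_smul]; rfl
    change C.g ξ (C.nabla (f • Y) ξ) = _
    rw [hn, map_smul]
  have hRicS : ∑ i, C.Ric (C.nabla (C.e i) ξ) (C.e' i)
      = ∑ i, C.Ric (C.e i) (C.nabla (C.e' i) ξ) := by
    rw [← C.sum_swap (hlin C.isBilin_Ric)]
    exact Finset.sum_congr rfl fun i _ ↦ C.Ric_symm _ _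
  have hein := C.div_einstein ξ
  have hnorm := C.div_smul (C.g ξ ξ) ξ
  rw [hdiv] at hein hnorm
  rw [C.der_g] at hnorm
  rw [hRicS] at hein
  have hd : C.g (C.nabla ξ ξ) ξ = C.dform ξ ξ ξ := rfl
  rw [C.g_symm ξ (C.nabla ξ ξ), hd] at hnorm
  simp only [Finset.sum_add_distrib, ← Finset.mul_sum, htr, schouten, Finset.sum_sub_distrib, hξξ,
    hsq] at h0
  refine ⟨- ((algebraMap ℝ A (1 / 2)) • (((2 : A) • C.sharp (C.Ric ξ) - C.scal • ξ)
    + (algebraMap ℝ A (1 / 2)) • (C.g ξ ξ • ξ))), ?_⟩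
  have hder (X : L) (r : ℝ) : C.der X (algebraMap ℝ A r) = 0 := Derivation.map_algebraMap _ _
  have hneg (X : L) : C.div (-X) = - C.div X := by simp [div]
  have h2 : (algebraMap ℝ A (1 / 2)) * 2 = 1 := by
    rw [← map_ofNat (algebraMap ℝ A) 2, ← map_mul]; norm_num
  rw [hneg, div_smul, hder, div_add, div_smul, hder, hein, hnorm]
  set c := algebraMap ℝ A (1 / 2)
  have h8 : (8 : A) * c ^ 3 = 1 := by linear_combination (4 * c ^ 2 + 2 * c + 1) * h2
  set b := C.dform ξ ξ ξ
  set q := ∑ i, ∑ j, C.dform ξ (C.e i) (C.e j) * C.dform ξ (C.e' i) (C.e' j)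
  set r := ∑ i, C.Ric (C.e i) (C.nabla (C.e' i) ξ)
  linear_combination (-c ^ 3) * h0 + (r + q) * h8 - r * h2 + 2 * c ^ 2 * b * h2

end IsHermitianSurface

end LeviCivitaCalculus


namespace AlmostHermitian

section LinearAlgebra

variable {V : Type*} [NormedAddCommGroup V] [InnerProductSpace ℝ V]

/-- The contraction of a bilinear form may be computed in any pair of dual frames. -/
theorem sum_dual_eq_sum_orthonormalBasis {P : Type*} [AddCommGroup P] [Module ℝ P]
    {B : V →ₗ[ℝ] V →ₗ[ℝ] P} {ι κ : Type*}
    [Fintype ι] [Fintype κ] {a a' : κ → V} (b : OrthonormalBasis ι ℝ V)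
    (h : ∀ v, ∑ k, inner ℝ v (a' k) • a k = v) : ∑ k, B (a k) (a' k) = ∑ i, B (b i) (b i) := by
  have h1 (k : κ) : B (a k) (a' k) = ∑ i, inner ℝ (b i) (a' k) • B (a k) (b i) := by
    conv_lhs => rw [← b.sum_repr' (a' k)]
    simp
  have h2 (i : ι) : B (b i) (b i) = ∑ k, inner ℝ (b i) (a' k) • B (a k) (b i) := by
    have := congrArg (fun v ↦ B v (b i)) (h (b i))
    simp only [map_sum, map_smul, LinearMap.sum_apply, LinearMap.smul_apply] at this
    exact this.symm
  simp only [h1, h2]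
  exact Finset.sum_comm

theorem sum_orthonormalBasis_eq {P : Type*} [AddCommGroup P] [Module ℝ P]
    (B : V →ₗ[ℝ] V →ₗ[ℝ] P) {ι κ : Type*} [Fintype ι] [Fintype κ]
    (b : OrthonormalBasis ι ℝ V) (c : OrthonormalBasis κ ℝ V) :
    ∑ i, B (b i) (b i) = ∑ j, B (c j) (c j) :=
  sum_dual_eq_sum_orthonormalBasis c fun v ↦ by
    conv_rhs => rw [← b.sum_repr' v]
    simp only [real_inner_comm]

variable {J : V →L[ℝ] V}

theorem inner_J_left (hJ : ∀ v, J (J v) = -v) (hg : ∀ v w, inner ℝ (J v) (J w) = inner ℝ v w)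
    (v w : V) : inner ℝ (J v) w = - inner ℝ v (J w) := by
  rw [← hg v (J w), hJ, inner_neg_right, neg_neg]

theorem inner_J_self (hJ : ∀ v, J (J v) = -v) (hg : ∀ v w, inner ℝ (J v) (J w) = inner ℝ v w)
    (v : V) : inner ℝ v (J v) = 0 := by
  have h := inner_J_left hJ hg v v
  rw [real_inner_comm] at h
  linarith

/-- A four-dimensional Hermitian vector space has a unitary basis. -/
theorem exists_unitary_basis [FiniteDimensional ℝ V] (hV : Module.finrank ℝ V = 4)
    (hJ : ∀ v, J (J v) = -v) (hg : ∀ v w, inner ℝ (J v) (J w) = inner ℝ v w) :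
    ∃ u : OrthonormalBasis (Fin 4) ℝ V, J (u 0) = u 1 ∧ J (u 2) = u 3 := by
  have : Nontrivial V := Module.nontrivial_of_finrank_pos (R := ℝ) (by omega)
  obtain ⟨v, hv⟩ := exists_norm_eq V (zero_le_one (α := ℝ))
  have hlt : Module.finrank ℝ (Submodule.span ℝ (Set.range ![v, J v])) < 4 :=
    (finrank_range_le_card (R := ℝ) ![v, J v]).trans_lt (by simp)
  have hne : (Submodule.span ℝ (Set.range ![v, J v]))ᗮ ≠ ⊥ := by
    intro h
    have := Submodule.finrank_add_finrank_orthogonal (Submodule.span ℝ (Set.range ![v, J v]))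
    rw [h, finrank_bot] at this
    omega
  obtain ⟨w', hw', hw0⟩ := Submodule.exists_mem_ne_zero_of_ne_bot hne
  rw [Submodule.mem_orthogonal] at hw'
  have h1 : inner ℝ v w' = 0 := hw' v (Submodule.subset_span ⟨0, rfl⟩)
  have h2 : inner ℝ (J v) w' = 0 := hw' (J v) (Submodule.subset_span ⟨1, rfl⟩)
  set w := (‖w'‖⁻¹ : ℝ) • w' with hw
  have hwn : ‖w‖ = 1 := by rw [hw, norm_smul]; simp [hw0]
  have h1 : inner ℝ v w = 0 := by simp [hw, inner_smul_right, h1]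
  have h2 : inner ℝ (J v) w = 0 := by simp [hw, inner_smul_right, h2]
  have h3 : inner ℝ v (J w) = 0 := by rw [← neg_eq_zero, ← inner_J_left hJ hg, h2]
  have hvv : inner ℝ v v = (1 : ℝ) := by rw [real_inner_self_eq_norm_sq, hv]; norm_num
  have hww : inner ℝ w w = (1 : ℝ) := by rw [real_inner_self_eq_norm_sq, hwn]; norm_num
  have ho : Orthonormal ℝ ![v, J v, w, J w] := by
    rw [orthonormal_iff_ite]
    intro i j
    have h4 : inner ℝ w v = 0 := by rw [real_inner_comm, h1]
    have h5 : inner ℝ w (J v) = 0 := by rw [real_inner_comm, h2]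
    have h6 : inner ℝ (J w) v = 0 := by rw [real_inner_comm, h3]
    have h7 (x : V) : inner ℝ (J x) x = 0 := by rw [real_inner_comm, inner_J_self hJ hg]
    fin_cases i <;> fin_cases j <;>
      simp [-inner_self_eq_norm_sq_to_K,
        h1, h2, h3, h4, h5, h6, h7, hvv, hww, hg, inner_J_self hJ hg]
  refine ⟨OrthonormalBasis.mk ho ?_, ?_⟩
  · have := ho.linearIndependent.span_eq_top_of_card_eq_finrank (by simp [hV])
    exact this.ge
  · simp

end LinearAlgebra

end AlmostHermitian


namespace AlmostHermitian

section LinearAlgebra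

variable {V : Type*} [NormedAddCommGroup V] [InnerProductSpace ℝ V]

/-- The algebraic properties of the covariant derivative `T` of an orthogonal almost complex
structure `J` on a Euclidean vector space. -/
structure IsHermitianDerivative (J : V →L[ℝ] V) (T : V →L[ℝ] V →L[ℝ] V) : Prop where
  J_J (v : V) : J (J v) = -v
  inner_J_J (v w : V) : inner ℝ (J v) (J w) = inner ℝ v w
  skew (x v w : V) : inner ℝ (T x v) w = - inner ℝ v (T x w)
  anti (x v : V) : T x (J v) = - J (T x v)

/-- The Nijenhuis tensor in terms of the covariant derivative `T` of `J`. -/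
def nijenhuisOf (J : V →L[ℝ] V) (T : V →L[ℝ] V →L[ℝ] V) (v w : V) : V :=
  T (J v) w - T (J w) v + J (T w v) - J (T v w)

variable {J : V →L[ℝ] V} {T : V →L[ℝ] V →L[ℝ] V} (h : IsHermitianDerivative J T)

namespace IsHermitianDerivative

include h

theorem nijenhuisOf_J_right (v w : V) : nijenhuisOf J T v (J w) = - J (nijenhuisOf J T v w) := by
  simp only [nijenhuisOf, h.J_J, h.anti, map_neg, map_sub, map_add, neg_apply]
  abel

omit h in
theorem _root_.AlmostHermitian.nijenhuisOf_self (v : V) : nijenhuisOf J T v v = 0 := by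
  simp [nijenhuisOf]

theorem exists_basis [FiniteDimensional ℝ V] (hV : Module.finrank ℝ V = 4) :
    ∃ (u : OrthonormalBasis (Fin 4) ℝ V) (a b : V →ₗ[ℝ] ℝ),
      (J (u 0) = u 1 ∧ J (u 1) = - u 0 ∧ J (u 2) = u 3 ∧ J (u 3) = - u 2) ∧
      ∀ x, T x (u 0) = a x • u 2 + b x • u 3 ∧ T x (u 1) = b x • u 2 - a x • u 3 ∧
        T x (u 2) = - (a x • u 0) - b x • u 1 ∧ T x (u 3) = a x • u 1 - b x • u 0 := by
  obtain ⟨u, h01, h23⟩ := exists_unitary_basis hV h.J_J h.inner_J_J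
  have h10 : J (u 1) = - u 0 := by rw [← h01, h.J_J]
  have h32 : J (u 3) = - u 2 := by rw [← h23, h.J_J]
  have hs (x v : V) : inner ℝ v (T x v) = 0 := by
    have := h.skew x v v
    rw [real_inner_comm] at this
    linarith
  have hs' (x v : V) : inner ℝ (J v) (T x v) = 0 := by
    have h1 := h.skew x v (J v)
    have h2 := inner_J_left h.J_J h.inner_J_J v (T x v)
    rw [h.anti, inner_neg_right, neg_neg, real_inner_comm] at h1
    linarith
  have e0 (x : V) : T x (u 0)
      = inner ℝ (u 2) (T x (u 0)) • u 2 + inner ℝ (u 3) (T x (u 0)) • u 3 := by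
    conv_lhs => rw [← u.sum_repr' (T x (u 0)), Fin.sum_univ_four, hs, ← h01, hs']
    simp
  have e1 (x : V) : T x (u 1)
      = inner ℝ (u 3) (T x (u 0)) • u 2 - inner ℝ (u 2) (T x (u 0)) • u 3 := by
    rw [← h01, h.anti, e0, map_add, map_smul, map_smul, h23, h32]
    simp only [← e0]
    module
  have e2 (x : V) : T x (u 2) = - (inner ℝ (u 2) (T x (u 0)) • u 0)
      - inner ℝ (u 3) (T x (u 0)) • u 1 := by
    have i0 : inner ℝ (u 0) (T x (u 2)) = - inner ℝ (u 2) (T x (u 0)) := by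
      rw [real_inner_comm, h.skew]
    have i1 : inner ℝ (u 1) (T x (u 2)) = - inner ℝ (u 3) (T x (u 0)) := by
      rw [real_inner_comm, h.skew, e1]
      simp [inner_sub_right, inner_smul_right]
    have i3 : inner ℝ (u 3) (T x (u 2)) = 0 := by rw [← h23, hs']
    conv_lhs => rw [← u.sum_repr' (T x (u 2)), Fin.sum_univ_four, hs, i0, i1, i3]
    module
  have e3 (x : V) : T x (u 3) = inner ℝ (u 2) (T x (u 0)) • u 1
      - inner ℝ (u 3) (T x (u 0)) • u 0 := by
    rw [← h23, h.anti, e2, map_sub, map_neg, map_smul, map_smul, h01, h10, h23]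
    module
  refine ⟨u, (innerₛₗ ℝ (u 2)) ∘ₗ (T.flip (u 0)).toLinearMap,
    (innerₛₗ ℝ (u 3)) ∘ₗ (T.flip (u 0)).toLinearMap, ⟨h01, h10, h23, h32⟩, fun x ↦ ?_⟩
  exact ⟨e0 x, e1 x, e2 x, e3 x⟩

end IsHermitianDerivative

theorem exists_coord (u : OrthonormalBasis (Fin 4) ℝ V) (x : V) :
    ∃ x0 x1 x2 x3 : ℝ, x = x0 • u 0 + x1 • u 1 + x2 • u 2 + x3 • u 3 :=
  ⟨_, _, _, _, by conv_lhs => rw [← u.sum_repr' x, Fin.sum_univ_four]⟩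

theorem inner_basis (u : OrthonormalBasis (Fin 4) ℝ V) :
    (inner ℝ (u 0) (u 0) : ℝ) = 1 ∧ (inner ℝ (u 1) (u 1) : ℝ) = 1 ∧ (inner ℝ (u 2) (u 2) : ℝ) = 1 ∧
    (inner ℝ (u 3) (u 3) : ℝ) = 1 ∧ (inner ℝ (u 0) (u 1) : ℝ) = 0 ∧ (inner ℝ (u 0) (u 2) : ℝ) = 0 ∧
    (inner ℝ (u 0) (u 3) : ℝ) = 0 ∧ (inner ℝ (u 1) (u 0) : ℝ) = 0 ∧ (inner ℝ (u 1) (u 2) : ℝ) = 0 ∧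
    (inner ℝ (u 1) (u 3) : ℝ) = 0 ∧ (inner ℝ (u 2) (u 0) : ℝ) = 0 ∧ (inner ℝ (u 2) (u 1) : ℝ) = 0 ∧
    (inner ℝ (u 2) (u 3) : ℝ) = 0 ∧ (inner ℝ (u 3) (u 0) : ℝ) = 0 ∧ (inner ℝ (u 3) (u 1) : ℝ) = 0 ∧
    (inner ℝ (u 3) (u 2) : ℝ) = 0 := by
  simp only [u.inner_eq_ite]
  simp

namespace IsHermitianDerivative

include h

/-- The Lee vector of `(J, T)` and the Nijenhuis tensor in a suitable unitary basis. -/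
theorem exists_coordinates [FiniteDimensional ℝ V] (hV : Module.finrank ℝ V = 4) :
    ∃ (u : OrthonormalBasis (Fin 4) ℝ V) (a b : V →ₗ[ℝ] ℝ),
      (J (u 0) = u 1 ∧ J (u 1) = - u 0 ∧ J (u 2) = u 3 ∧ J (u 3) = - u 2) ∧
      (∀ x, T x (u 0) = a x • u 2 + b x • u 3 ∧ T x (u 1) = b x • u 2 - a x • u 3 ∧
        T x (u 2) = - (a x • u 0) - b x • u 1 ∧ T x (u 3) = a x • u 1 - b x • u 0) ∧
      (J (∑ i, T (u i) (u i)) = (b (u 2) - a (u 3)) • u 0 - (a (u 2) + b (u 3)) • u 1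
        + (a (u 1) - b (u 0)) • u 2 + (a (u 0) + b (u 1)) • u 3) ∧
      ∃ n : V, n = - (a (u 1) + b (u 0)) • u 0 + (a (u 0) - b (u 1)) • u 1
          - (a (u 3) + b (u 2)) • u 2 + (a (u 2) - b (u 3)) • u 3 ∧
        nijenhuisOf J T (u 0) (u 1) = 0 ∧ nijenhuisOf J T (u 1) (u 0) = 0 ∧
        nijenhuisOf J T (u 2) (u 3) = 0 ∧ nijenhuisOf J T (u 3) (u 2) = 0 ∧
        nijenhuisOf J T (u 0) (u 2) = n ∧ nijenhuisOf J T (u 2) (u 0) = -n ∧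
        nijenhuisOf J T (u 0) (u 3) = - J n ∧ nijenhuisOf J T (u 3) (u 0) = J n ∧
        nijenhuisOf J T (u 1) (u 2) = - J n ∧ nijenhuisOf J T (u 2) (u 1) = J n ∧
        nijenhuisOf J T (u 1) (u 3) = - n ∧ nijenhuisOf J T (u 3) (u 1) = n := by
  obtain ⟨u, a, b, ⟨J0, J1, J2, J3⟩, hT⟩ := h.exists_basis hV
  have T0 := fun x ↦ (hT x).1
  have T1 := fun x ↦ (hT x).2.1
  have T2 := fun x ↦ (hT x).2.2.1
  have T3 := fun x ↦ (hT x).2.2.2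
  refine ⟨u, a, b, ⟨J0, J1, J2, J3⟩, hT, ?_, _, rfl, ?_⟩
  · simp only [Fin.sum_univ_four, T0, T1, T2, T3, map_add, map_sub, map_neg, map_smul, J0, J1, J2,
      J3]
    module
  · refine ⟨?_, ?_, ?_, ?_, ?_, ?_, ?_, ?_, ?_, ?_, ?_, ?_⟩ <;>
    · simp only [nijenhuisOf, T0, T1, T2, T3, map_add, map_sub, map_neg, map_smul, J0, J1, J2,
        J3, neg_apply, smul_neg, neg_smul]
      module

/-- The relation between `T`, its Nijenhuis tensor and its Lee vector in dimension four. -/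
theorem sum_inner_J_T [FiniteDimensional ℝ V] (hV : Module.finrank ℝ V = 4) {ι : Type*}
    [Fintype ι] (e : OrthonormalBasis ι ℝ V) {ξ : V} (hξ : ξ = - J (∑ i, T (e i) (e i)))
    (x y : V) :
    ∑ i, inner ℝ (J (T x (e i))) (T y (e i)) - inner ℝ ξ (T x y - T y x)
      = -(1 / 2) * ((1 / 2) * ∑ i, ∑ j, inner ℝ (nijenhuisOf J T (e i) (e j)) (J x)
          * inner ℝ (nijenhuisOf J T (e i) (e j)) y)
        - (1 / 2) * inner ℝ (nijenhuisOf J T x y) (J ξ) := by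
  obtain ⟨u, a, b, ⟨J0, J1, J2, J3⟩, hT, hξu, n, hn, N01, N10, N23, N32, N02, N20, N03, N30, N12,
    N21, N13, N31⟩ := h.exists_coordinates hV
  have T0 := fun x ↦ (hT x).1
  have T1 := fun x ↦ (hT x).2.1
  have T2 := fun x ↦ (hT x).2.2.1
  have T3 := fun x ↦ (hT x).2.2.2
  have e1 := sum_orthonormalBasis_eq (LinearMap.mk₂ ℝ (fun v w ↦ T v w) (by simp) (by simp)
    (by simp) (by simp)) e u
  have e2 := sum_orthonormalBasis_eq (LinearMap.mk₂ ℝ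
    (fun v w ↦ (inner ℝ (J (T x v)) (T y w) : ℝ)) (by simp [inner_add_left])
    (by simp [inner_smul_left]) (by simp [inner_add_right]) (by simp [inner_smul_right])) e u
  have e3 (v : V) := sum_orthonormalBasis_eq (LinearMap.mk₂ ℝ
    (fun w w' ↦ (inner ℝ (nijenhuisOf J T v w) (J x) * inner ℝ (nijenhuisOf J T v w') y : ℝ))
    (by simp [nijenhuisOf, inner_add_left, inner_sub_left]; intros; ring)
    (by simp [nijenhuisOf, inner_add_left, inner_sub_left, inner_smul_left]; intros; ring)
    (by simp [nijenhuisOf, inner_add_left, inner_sub_left]; intros; ring)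
    (by simp [nijenhuisOf, inner_add_left, inner_sub_left, inner_smul_left]; intros; ring)) e u
  have e4 := sum_orthonormalBasis_eq (LinearMap.mk₂ ℝ
    (fun v v' ↦ ∑ j, (inner ℝ (nijenhuisOf J T v (u j)) (J x)
      * inner ℝ (nijenhuisOf J T v' (u j)) y : ℝ))
    (by
      intros
      rw [← Finset.sum_add_distrib]
      refine Finset.sum_congr rfl fun j _ ↦ ?_
      simp [nijenhuisOf, inner_add_left, inner_sub_left]; ring)
    (by
      intros
      rw [Finset.smul_sum]
      refine Finset.sum_congr rfl fun j _ ↦ ?_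
      simp [nijenhuisOf, inner_add_left, inner_sub_left, inner_smul_left]; ring)
    (by
      intros
      rw [← Finset.sum_add_distrib]
      refine Finset.sum_congr rfl fun j _ ↦ ?_
      simp [nijenhuisOf, inner_add_left, inner_sub_left]; ring)
    (by
      intros
      rw [Finset.smul_sum]
      refine Finset.sum_congr rfl fun j _ ↦ ?_
      simp [nijenhuisOf, inner_add_left, inner_sub_left, inner_smul_left]; ring)) e u
  simp only [LinearMap.mk₂_apply] at e1 e2 e3 e4
  rw [e2]
  simp only [e3]
  rw [e4]
  rw [e1, hξu] at hξ
  obtain ⟨x0, x1, x2, x3, rfl⟩ := exists_coord u x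
  obtain ⟨y0, y1, y2, y3, rfl⟩ := exists_coord u y
  obtain ⟨i00, i11, i22, i33, i01, i02, i03, i10, i12, i13, i20, i21, i23, i30, i31, i32⟩ :=
    inner_basis u
  have hlin (v v' w : V) :
      nijenhuisOf J T (v + v') w = nijenhuisOf J T v w + nijenhuisOf J T v' w := by
    simp [nijenhuisOf]; abel
  have hlin' (v v' w : V) :
      nijenhuisOf J T w (v + v') = nijenhuisOf J T w v + nijenhuisOf J T w v' := by
    simp [nijenhuisOf]; abel
  have hsm (c : ℝ) (v w : V) : nijenhuisOf J T (c • v) w = c • nijenhuisOf J T v w := by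
    simp [nijenhuisOf]; module
  have hsm' (c : ℝ) (v w : V) : nijenhuisOf J T w (c • v) = c • nijenhuisOf J T w v := by
    simp [nijenhuisOf]; module
  simp only [Fin.sum_univ_four, hlin, hlin', hsm, hsm', nijenhuisOf_self, N01, N10, N23, N32, N02,
    N20, N03, N30, N12, N21, N13, N31, hn, hξ]
  simp only [T0, T1, T2, T3, map_add, map_sub, map_neg, map_smul, J0, J1, J2, J3, inner_add_left,
    inner_add_right, inner_sub_left, inner_sub_right, inner_neg_left, inner_neg_right,
    real_inner_smul_left, real_inner_smul_right, i00, i11, i22, i33, i01, i02, i03, i10, i12, i13,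
    i20, i21, i23, i30, i31, i32, inner_zero_left, smul_zero, mul_zero,
    add_zero, zero_add, mul_one, add_apply, smul_apply]
  ring

/-- In dimension four, `J` with vanishing Nijenhuis tensor is locally conformally parallel:
`T` is determined by the Lee vector. -/
theorem two_inner_T [FiniteDimensional ℝ V] (hV : Module.finrank ℝ V = 4) {ι : Type*}
    [Fintype ι] (e : OrthonormalBasis ι ℝ V) {ξ : V} (hξ : ξ = - J (∑ i, T (e i) (e i)))
    (hN : ∀ v w, nijenhuisOf J T v w = 0) (x y z : V) :
    2 * inner ℝ (T x y) z = inner ℝ ξ (J y) * inner ℝ x z - inner ℝ ξ y * inner ℝ (J x) z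
      - inner ℝ x (J y) * inner ℝ ξ z + inner ℝ x y * inner ℝ (J ξ) z := by
  obtain ⟨u, a, b, ⟨J0, J1, J2, J3⟩, hT, hξu, n, hn, -, -, -, -, N02, -⟩ := h.exists_coordinates hV
  have T0 := fun x ↦ (hT x).1
  have T1 := fun x ↦ (hT x).2.1
  have T2 := fun x ↦ (hT x).2.2.1
  have T3 := fun x ↦ (hT x).2.2.2
  have e1 := sum_orthonormalBasis_eq (LinearMap.mk₂ ℝ (fun v w ↦ T v w) (by simp) (by simp)
    (by simp) (by simp)) e u
  simp only [LinearMap.mk₂_apply] at e1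
  rw [e1, hξu] at hξ
  obtain ⟨i00, i11, i22, i33, i01, i02, i03, i10, i12, i13, i20, i21, i23, i30, i31, i32⟩ :=
    inner_basis u
  rw [hN] at N02
  rw [← N02] at hn
  have hk (k : Fin 4) := congrArg (inner ℝ (u k)) hn
  have h0 := hk 0
  have h1 := hk 1
  have h2 := hk 2
  have h3 := hk 3
  simp only [inner_add_right, inner_sub_right, real_inner_smul_right, i00, i11, i22, i33, i01, i02,
    i03, i10, i12, i13, i20, i21, i23, i30, i31, i32, inner_zero_right, mul_zero, mul_one, add_zero,
    zero_add, sub_zero, zero_sub, neg_add_rev] at h0 h1 h2 h3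
  have b0 : b (u 0) = - a (u 1) := by linarith
  have b1 : b (u 1) = a (u 0) := by linarith
  have b2 : b (u 2) = - a (u 3) := by linarith
  have b3 : b (u 3) = a (u 2) := by linarith
  obtain ⟨x0, x1, x2, x3, rfl⟩ := exists_coord u x
  obtain ⟨y0, y1, y2, y3, rfl⟩ := exists_coord u y
  obtain ⟨z0, z1, z2, z3, rfl⟩ := exists_coord u z
  simp only [hξ, T0, T1, T2, T3, map_add, map_sub, map_neg, map_smul, J0, J1, J2, J3,
    inner_add_left, inner_add_right, inner_sub_left, inner_neg_left, inner_neg_right,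
    real_inner_smul_left, real_inner_smul_right, i00, i11, i22, i33, i01, i02, i03, i10, i12, i13,
    i20, i21, i23, i30, i31, i32, mul_zero,
    add_zero, zero_add, mul_one, add_apply, smul_apply, b0, b1, b2, b3]
  ring

end IsHermitianDerivative

end LinearAlgebra

end AlmostHermitian


namespace AlmostHermitian

variable {E : Type*} [NormedAddCommGroup E] [NormedSpace ℝ E]
  {H : Type*} [TopologicalSpace H] {I : ModelWithCorners ℝ E H}
  {M : Type*} [TopologicalSpace M] [ChartedSpace H M]
  [RiemannianBundle (fun x : M ↦ TangentSpace I x)] [IsManifold I ∞ M]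

section Torsion

variable [IsContMDiffRiemannianBundle I ∞ E (fun x : M ↦ TangentSpace I x)]
  [FiniteDimensional ℝ E] {x : M} {X Y : Π x : M, TangentSpace I x}

theorem mlieBracket_eq (hX : MDiffAt (T% X) x) (hY : MDiffAt (T% Y) x) :
    mlieBracket I X Y x = leviCivita I M Y x (X x) - leviCivita I M X x (Y x) := by
  have := FiniteDimensional.complete ℝ E
  have : IsManifold I 2 M := IsManifold.of_le (n := ∞) (by norm_cast)
  exact ((CovariantDerivative.torsion_eq_zero_iff _).1 (leviCivita_torsion I M) hX hY).symm

theorem leviCivita_smul_const (c : ℝ) (hX : MDiffAt (T% X) x) :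
    leviCivita I M (c • X) x = c • leviCivita I M X x :=
  (leviCivita I M).isCovariantDerivativeOn.smul_const c hX

end Torsion

namespace AlmostHermitianStructure

variable (S : AlmostHermitianStructure I M)

theorem inner_mapField_left (X Y : Π x : M, TangentSpace I x) (x : M) :
    inner ℝ (S.mapField X x) (Y x) = - inner ℝ (X x) (S.mapField Y x) :=
  inner_J_left (S.J_J x) (S.inner_J_J x) _ _

theorem mapField_mapField (X : Π x : M, TangentSpace I x) :
    S.mapField (S.mapField X) = (-1 : ℝ) • X := by
  ext x; simp [mapField, S.J_J]

theorem _root_.AlmostHermitian.IsSmoothField.mapField {X : Π x : M, TangentSpace I x}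
    (hX : IsSmoothField I X) : IsSmoothField I (S.mapField X) :=
  fun x ↦ ContMDiffAt.clm_bundle_apply (b := fun y : M ↦ y) (S.contMDiff_J x) (hX x)

variable [FiniteDimensional ℝ E] [IsContMDiffRiemannianBundle I ∞ E (fun x : M ↦ TangentSpace I x)]

theorem isHermitianDerivative (x : M) : IsHermitianDerivative (S.J x) (S.nablaJ x) where
  J_J := S.J_J x
  inner_J_J := S.inner_J_J x
  skew u v w := by
    have hu := FiberBundle.mdifferentiableAt_extend I E u
    have hv := FiberBundle.mdifferentiableAt_extend I E v
    have hw := FiberBundle.mdifferentiableAt_extend I E w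
    have h1 := leviCivita_metric hu (S.mdifferentiableAt_mapField hv) hw
    have h2 := leviCivita_metric hu hv (S.mdifferentiableAt_mapField hw)
    have h3 := S.nablaJ_apply hv u
    have h4 := S.nablaJ_apply hw u
    simp only [S.inner_mapField_left] at h1
    rw [lieDeriv, mvfderiv_fun_neg] at h1
    rw [lieDeriv] at h2
    simp only [FiberBundle.extend_apply_self, neg_apply, mapField] at h1 h2 h3 h4
    rw [h3, h4, inner_sub_left, inner_sub_right,
      inner_J_left (S.J_J x) (S.inner_J_J x) (leviCivita I M _ x u)]
    rw [inner_J_left (S.J_J x) (S.inner_J_J x) v] at h1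
    linarith
  anti u v := by
    have hv := FiberBundle.mdifferentiableAt_extend I E v
    have hJv := S.mdifferentiableAt_mapField hv
    have h1 := S.nablaJ_apply hv u
    have h2 := S.nablaJ_apply hJv u
    rw [mapField_mapField, leviCivita_smul_const _ hv] at h2
    simp only [FiberBundle.extend_apply_self, mapField, smul_apply] at h1 h2
    rw [h1, h2, map_sub, S.J_J]
    module

theorem nijenhuis_eq (x : M) (v w : TangentSpace I x) :
    S.nijenhuis x v w = nijenhuisOf (S.J x) (S.nablaJ x) v w := by
  have hv := FiberBundle.mdifferentiableAt_extend I E v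
  have hw := FiberBundle.mdifferentiableAt_extend I E w
  have hJv := S.mdifferentiableAt_mapField hv
  have hJw := S.mdifferentiableAt_mapField hw
  have h := S.nijenhuis_apply hv hw
  have h1 := S.nablaJ_apply hv w
  have h2 := S.nablaJ_apply hw v
  have h3 := S.nablaJ_apply hv (S.J x w)
  have h4 := S.nablaJ_apply hw (S.J x v)
  rw [nijenhuisField, mlieBracket_eq hv hw, mlieBracket_eq hJv hw, mlieBracket_eq hv hJw,
    mlieBracket_eq hJv hJw] at h
  simp only [FiberBundle.extend_apply_self, mapField] at h h1 h2 h3 h4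
  rw [h, nijenhuisOf, h1, h2, h3, h4]
  simp only [map_sub, S.J_J]
  module

theorem lee_apply (x : M) (v : TangentSpace I x) : S.lee x v = inner ℝ (S.leeSharp x) v := by
  simp [leeSharp]

theorem leeSharp_eq (x : M) :
    S.leeSharp x = - S.J x (∑ i, S.nablaJ x (stdOrthonormalBasis ℝ (TangentSpace I x) i)
      (stdOrthonormalBasis ℝ (TangentSpace I x) i)) := by
  refine ext_inner_right ℝ fun v ↦ ?_
  rw [← lee_apply, inner_neg_left, inner_J_left (S.J_J x) (S.inner_J_J x), sum_inner]
  simp [lee, mapOneForm, codiffOmega, nablaOmega]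

theorem extDerivOneForm_mapOneForm_lee {X Y : Π x : M, TangentSpace I x} {x : M}
    (hX : MDiffAt (T% X) x) (hY : MDiffAt (T% Y) x) :
    extDerivOneForm I (S.mapOneForm S.lee) X Y x
      = - (nablaOneForm I S.lee X (S.mapField Y) x - nablaOneForm I S.lee Y (S.mapField X) x)
        - inner ℝ (S.leeSharp x) (S.nablaJ x (X x) (Y x) - S.nablaJ x (Y x) (X x)) := by
  rw [S.nablaJ_apply hX, S.nablaJ_apply hY, extDerivOneForm, mlieBracket_eq hX hY, ← lee_apply]
  simp only [mapOneForm, nablaOneForm, lieDeriv, neg_apply, ContinuousLinearMap.comp_apply,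
    mvfderiv_fun_neg, map_sub, mapField]
  ring

variable (hI : Module.finrank ℝ E = 4)
include hI

theorem extDerivOneForm_add_Phi {X Y : Π x : M, TangentSpace I x} {x : M}
    (hX : MDiffAt (T% X) x) (hY : MDiffAt (T% Y) x) :
    4 * S.Phi x (X x) (Y x) + extDerivOneForm I (S.mapOneForm S.lee) X Y x
      = - (nablaOneForm I S.lee X (S.mapField Y) x - nablaOneForm I S.lee Y (S.mapField X) x)
        + (-(1 / 2) * twoFormInner x (S.nijenhuisForm x (S.J x (X x))) (S.nijenhuisForm x (Y x))
          - (1 / 2) * S.nijenhuisForm x (S.J x (S.leeSharp x)) (X x) (Y x)) := by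
  have h := (S.isHermitianDerivative x).sum_inner_J_T hI
    (stdOrthonormalBasis ℝ (TangentSpace I x)) (S.leeSharp_eq x) (X x) (Y x)
  simp only [← nijenhuis_eq] at h
  rw [extDerivOneForm_mapOneForm_lee S hX hY]
  simp only [twoFormInner, nijenhuisForm, Phi]
  rw [← h]
  ring

theorem negFourPhiEq_iff : S.NegFourPhiEq ↔
    ∀ X Y : Π x : M, TangentSpace I x, IsSmoothField I X → IsSmoothField I Y → ∀ x : M,
      nablaOneForm I S.lee X (S.mapField Y) x - nablaOneForm I S.lee Y (S.mapField X) x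
        = -(1 / 2) * twoFormInner x (S.nijenhuisForm x (S.J x (X x))) (S.nijenhuisForm x (Y x))
          - (1 / 2) * S.nijenhuisForm x (S.J x (S.leeSharp x)) (X x) (Y x) := by
  refine forall_congr' fun X ↦ forall_congr' fun Y ↦ forall_congr' fun hX ↦ forall_congr' fun hY ↦
    forall_congr' fun x ↦ ?_
  have h := S.extDerivOneForm_add_Phi hI ((hX x).mdifferentiableAt (by simp))
    ((hY x).mdifferentiableAt (by simp))
  constructor <;> intro h' <;> linarith

theorem IsVaisman.negFourPhiEq (h : S.IsVaisman) : S.NegFourPhiEq := by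
  rw [negFourPhiEq_iff S hI]
  intro X Y hX hY x
  rw [h.2 X _ hX (hY.mapField S), h.2 Y _ hY (hX.mapField S)]
  simp [twoFormInner, nijenhuisForm, h.1 x]

end AlmostHermitianStructure

end AlmostHermitian


namespace AlmostHermitian

section LinearAlgebra

variable {V : Type*} [NormedAddCommGroup V] [InnerProductSpace ℝ V]

/-- Reconstruction of a vector from its inner products with an orthogonal family of the size of
the dimension. -/
theorem sum_inner_smul_of_pairwise_orthogonal [FiniteDimensional ℝ V] {ι : Type*} [Fintype ι]
    [DecidableEq ι] (hι : Fintype.card ι = Module.finrank ℝ V) {f : ι → V} (h0 : ∀ i, f i ≠ 0)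
    (h : ∀ i j, i ≠ j → inner ℝ (f i) (f j) = 0) (z : V) :
    ∑ i, (inner ℝ z (f i) / inner ℝ (f i) (f i)) • f i = z := by
  cases isEmpty_or_nonempty ι
  · have := Module.finrank_zero_iff.1 (hι.symm.trans Fintype.card_eq_zero)
    exact Subsingleton.elim _ _
  have ho : Orthonormal ℝ fun i ↦ (‖f i‖⁻¹ : ℝ) • f i := by
    refine ⟨fun i ↦ ?_, fun i j hij ↦ ?_⟩
    · rw [norm_smul, norm_inv, norm_norm, inv_mul_cancel₀ (norm_ne_zero_iff.2 (h0 i))]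
    · simp [inner_smul_left, inner_smul_right, h i j hij]
  let b := OrthonormalBasis.mk ho (ho.linearIndependent.span_eq_top_of_card_eq_finrank hι).ge
  conv_rhs => rw [← b.sum_repr' z]
  refine Finset.sum_congr rfl fun i _ ↦ ?_
  simp only [b, OrthonormalBasis.coe_mk, inner_smul_left, smul_smul]
  congr 1
  rw [real_inner_self_eq_norm_sq, real_inner_comm]
  simp only [conj_trivial]
  ring

/-- The component of `w` orthogonal to `v` and `J v`, multiplied with `|v|²`. -/
def orthogonalPart (J : V →L[ℝ] V) (v w : V) : V :=
  inner ℝ v v • w - inner ℝ w v • v - inner ℝ w (J v) • J v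

theorem smul_sum_unitary [FiniteDimensional ℝ V] (hV : Module.finrank ℝ V = 4) {J : V →L[ℝ] V}
    (hJ : ∀ v, J (J v) = -v) (hg : ∀ v w, inner ℝ (J v) (J w) = inner ℝ v w) (v w z : V) :
    let w' := orthogonalPart J v w
    inner ℝ w' w' • (inner ℝ z v • v + inner ℝ z (J v) • J v)
        + inner ℝ v v • (inner ℝ z w' • w' + inner ℝ z (J w') • J w')
      = (inner ℝ v v * inner ℝ w' w') • z := by
  intro w'
  by_cases hv : v = 0
  · simp [w', hv, orthogonalPart]
  by_cases hw : w' = 0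
  · simp [hw]
  have hJ0 {u : V} (hu : u ≠ 0) : J u ≠ 0 := fun h ↦ hu (by simpa [h] using (hJ u).symm)
  have hvv : (inner ℝ v v : ℝ) ≠ 0 := inner_self_ne_zero.2 hv
  have hww : (inner ℝ w' w' : ℝ) ≠ 0 := inner_self_ne_zero.2 hw
  have h1 : inner ℝ w' v = 0 := by
    simp only [w', orthogonalPart, inner_sub_left, inner_smul_left, inner_J_left hJ hg v v,
      inner_J_self hJ hg v, conj_trivial]
    ring
  have h2 : inner ℝ w' (J v) = 0 := by
    simp only [w', orthogonalPart, inner_sub_left, inner_smul_left, hg,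
      inner_J_self hJ hg v, conj_trivial]
    ring
  have h1' : inner ℝ v w' = 0 := by rw [real_inner_comm, h1]
  have h2' : inner ℝ (J v) w' = 0 := by rw [real_inner_comm, h2]
  have h3 : inner ℝ (J w') v = 0 := by rw [inner_J_left hJ hg, h2, neg_zero]
  have h3' : inner ℝ v (J w') = 0 := by rw [real_inner_comm, h3]
  have h7 (x : V) : inner ℝ (J x) x = 0 := by rw [real_inner_comm, inner_J_self hJ hg]
  have h := sum_inner_smul_of_pairwise_orthogonal (f := ![v, J v, w', J w']) (by simp [hV])
    (by intro i; fin_cases i <;> simp [hv, hw, hJ0 hv, hJ0 hw])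
    (by
      intro i j hij
      fin_cases i <;> fin_cases j <;>
        simp [hg, h1, h2, h1', h2', h3, h3', h7, inner_J_self hJ hg] at hij ⊢) z
  simp only [Fin.sum_univ_four, Matrix.cons_val, hg] at h
  conv_rhs => rw [← h]
  match_scalars <;> field_simp

end LinearAlgebra

variable {E : Type*} [NormedAddCommGroup E] [NormedSpace ℝ E]
  {H : Type*} [TopologicalSpace H] {I : ModelWithCorners ℝ E H}
  {M : Type*} [TopologicalSpace M] [ChartedSpace H M] [IsManifold I ∞ M]

namespace IsSmoothField

variable {X Y : Π x : M, TangentSpace I x} {f : M → ℝ}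

theorem mdifferentiableAt (hX : IsSmoothField I X) (x : M) : MDiffAt (T% X) x :=
  (hX x).mdifferentiableAt (by simp)

theorem sub (hX : IsSmoothField I X) (hY : IsSmoothField I Y) : IsSmoothField I (X - Y) :=
  ContMDiff.sub_section hX hY

theorem smul (hf : CMDiff ∞ f) (hX : IsSmoothField I X) : IsSmoothField I (f • X) :=
  ContMDiff.smul_section hf hX

theorem sum {ι : Type*} {s : Finset ι} {X : ι → Π x : M, TangentSpace I x}
    (hX : ∀ i ∈ s, IsSmoothField I (X i)) : IsSmoothField I (fun x ↦ ∑ i ∈ s, X i x) :=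
  ContMDiff.sum_section hX

theorem contMDiff_lieDeriv (hX : IsSmoothField I X) (hf : CMDiff ∞ f) :
    CMDiff ∞ (lieDeriv I X f) := by
  have h1 : ContMDiff I.tangent (𝓘(ℝ, ℝ)).tangent ∞ (tangentMap I 𝓘(ℝ, ℝ) f) :=
    hf.contMDiff_tangentMap (by simp)
  have h2 := h1.comp hX
  have h3 := (contMDiff_snd_tangentBundle_modelSpace ℝ 𝓘(ℝ, ℝ) (n := ∞)).comp h2
  exact h3

theorem contMDiff_inner [RiemannianBundle (fun x : M ↦ TangentSpace I x)]
    [IsContMDiffRiemannianBundle I ∞ E (fun x : M ↦ TangentSpace I x)]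
    (hX : IsSmoothField I X) (hY : IsSmoothField I Y) :
    CMDiff ∞ (fun x ↦ (inner ℝ (X x) (Y x) : ℝ)) :=
  ContMDiff.inner_bundle hX hY

theorem mlieBracket [CompleteSpace E] (hX : IsSmoothField I X) (hY : IsSmoothField I Y) :
    IsSmoothField I (mlieBracket I X Y) := by
  have : IsManifold I ((⊤ : ℕ∞) + 1) M := by simpa using ‹IsManifold I ∞ M›
  have : IsManifold I (minSmoothness ℝ 2) M := IsManifold.of_le (n := ∞) (by simp; norm_cast)
  exact ContDiff.mlieBracket_vectorField (m := ⊤) (n := ⊤) hX hY (by simp)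

end IsSmoothField

theorem exists_isSmoothField_apply_eq [FiniteDimensional ℝ E] [T2Space M] [SigmaCompactSpace M]
    (x : M) (v : TangentSpace I x) :
    ∃ X : Π x : M, TangentSpace I x, IsSmoothField I X ∧ X x = v := by
  classical
  obtain ⟨s, hs⟩ := exists_contMDiffSection_forall_mem_convex_of_local (n := ⊤) I
    (F_fiber := E) (fun x : M ↦ TangentSpace I x) (fun y ↦ {w | ∀ h : x = y, w = h ▸ v})
    (fun y ↦ by
      by_cases h : x = y
      · subst h
        simp
      · simpa [h] using convex_univ) fun y ↦ by
    by_cases h : x = y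
    · subst h
      obtain ⟨U, hU, hs⟩ := FiberBundle.exists_contMDiffOn_extend (k := ∞) I E v
      refine ⟨U, hU, _, hs, fun y hy h ↦ ?_⟩
      subst h
      simp
    · refine ⟨{x}ᶜ, isOpen_compl_singleton.mem_nhds (Ne.symm h), 0, ?_, fun y hy h' ↦
        absurd h'.symm hy⟩
      exact (ContMDiff.contMDiffOn (s := {x}ᶜ)
        (0 : Cₛ^∞⟮I; E, (fun x : M ↦ TangentSpace I x)⟯).contMDiff)
  exact ⟨s, s.contMDiff, hs x rfl⟩

end AlmostHermitian


namespace AlmostHermitian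

variable {E : Type*} [NormedAddCommGroup E] [NormedSpace ℝ E]
  {H : Type*} [TopologicalSpace H] {I : ModelWithCorners ℝ E H}
  {M : Type*} [TopologicalSpace M] [ChartedSpace H M] [IsManifold I ∞ M]

section Bracket

variable [CompleteSpace E] {X Y Z : Π x : M, TangentSpace I x} {f : M → ℝ}

theorem mlieBracket_jacobi (hX : IsSmoothField I X) (hY : IsSmoothField I Y)
    (hZ : IsSmoothField I Z) :
    mlieBracket I X (mlieBracket I Y Z)
      = mlieBracket I (mlieBracket I X Y) Z + mlieBracket I Y (mlieBracket I X Z) := by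
  have : IsManifold I (minSmoothness ℝ 3) M := IsManifold.of_le (n := ∞) (by simp; norm_cast)
  refine leibniz_identity_mlieBracket (hX.of_le ?_) (hY.of_le ?_) (hZ.of_le ?_) <;>
  · simp; norm_cast

theorem lieDeriv_mlieBracket [FiniteDimensional ℝ E] [Nontrivial E] [T2Space M]
    [SigmaCompactSpace M] (hX : IsSmoothField I X) (hY : IsSmoothField I Y) (hf : CMDiff ∞ f)
    (x : M) :
    lieDeriv I (mlieBracket I X Y) f x
      = lieDeriv I X (lieDeriv I Y f) x - lieDeriv I Y (lieDeriv I X f) x := by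
  have : Nontrivial (TangentSpace I x) := inferInstanceAs (Nontrivial E)
  obtain ⟨v, hv⟩ := exists_ne (0 : TangentSpace I x)
  obtain ⟨Z, hZ, hZx⟩ := exists_isSmoothField_apply_eq (I := I) x v
  have hfd : MDiff f := hf.mdifferentiable (by simp)
  have hb {X Y : Π x : M, TangentSpace I x} {g : M → ℝ} (hg : CMDiff ∞ g)
      (hY : IsSmoothField I Y) :
      mlieBracket I X (g • Y) = lieDeriv I X g • Y + g • mlieBracket I X Y := by
    ext y
    rw [mlieBracket_smul_right (hg.mdifferentiable (by simp) y) (hY.mdifferentiableAt y)]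
    rfl
  have ha {X Y Z : Π x : M, TangentSpace I x} (hY : IsSmoothField I Y) (hZ : IsSmoothField I Z) :
      mlieBracket I X (Y + Z) = mlieBracket I X Y + mlieBracket I X Z := by
    ext y
    rw [mlieBracket_add_right (hY.mdifferentiableAt y) (hZ.mdifferentiableAt y)]
    rfl
  have h1 := mlieBracket_jacobi hX hY (IsSmoothField.smul hf hZ)
  have h2 := mlieBracket_jacobi hX hY hZ
  have hXf := hX.contMDiff_lieDeriv hf
  have hYf := hY.contMDiff_lieDeriv hf
  rw [hb hf hZ, hb hf hZ, hb hf hZ, ha (.smul hYf hZ) (.smul hf (hY.mlieBracket hZ)),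
    ha (.smul hXf hZ) (.smul hf (hX.mlieBracket hZ)), hb hYf hZ, hb hXf hZ,
    hb hf (hY.mlieBracket hZ), hb hf (hX.mlieBracket hZ), h2] at h1
  have h3 := congrFun h1 x
  simp only [Pi.add_apply, Pi.smul_apply', hZx] at h3
  have h4 : (lieDeriv I (mlieBracket I X Y) f x
      - (lieDeriv I X (lieDeriv I Y f) x - lieDeriv I Y (lieDeriv I X f) x)) • v = 0 := by
    have h6 : lieDeriv I X (lieDeriv I Y f) x • v - lieDeriv I (mlieBracket I X Y) f x • v
        - lieDeriv I Y (lieDeriv I X f) x • v = 0 := by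
      rw [← sub_eq_zero] at h3
      rw [← h3]
      module
    rw [← neg_eq_zero, ← h6]
    module
  have h5 := (smul_eq_zero.1 h4).resolve_right hv
  linarith

end Bracket

variable (I M) in
/-- The smooth vector fields on `M`. -/
abbrev SmoothField := Cₛ^∞⟮I; E, (fun x : M ↦ TangentSpace I x)⟯

variable (I M) in
/-- The smooth functions on `M`. -/
abbrev SmoothFunction := C^∞⟮I, M; 𝓘(ℝ), ℝ⟯

namespace SmoothField

theorem isSmoothField (X : SmoothField I M) : IsSmoothField I X := X.contMDiff

instance : SMul (SmoothFunction I M) (SmoothField I M) where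
  smul f X := ⟨fun x ↦ f x • X x, IsSmoothField.smul f.contMDiff X.isSmoothField⟩

@[simp]
theorem smul_apply (f : SmoothFunction I M) (X : SmoothField I M) (x : M) :
    (f • X) x = f x • X x := rfl

@[simp]
theorem add_apply (X Y : SmoothField I M) (x : M) : (X + Y) x = X x + Y x := rfl

@[simp]
theorem neg_apply (X : SmoothField I M) (x : M) : (-X) x = - X x := rfl

instance : Module (SmoothFunction I M) (SmoothField I M) where
  one_smul X := by ext x; simp
  mul_smul f g X := by ext x; simp [mul_smul]
  smul_zero f := by ext x; simp
  smul_add f X Y := by ext x; simp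
  add_smul f g X := by ext x; simp [add_smul]
  zero_smul X := by ext x; simp

@[simp]
theorem sum_apply {κ : Type*} (s : Finset κ) (X : κ → SmoothField I M) (x : M) :
    (∑ i ∈ s, X i) x = ∑ i ∈ s, X i x :=
  (congrFun (map_sum (ContMDiffSection.coeAddHom I E ∞ (fun x : M ↦ TangentSpace I x)) X s) x).trans
    (Finset.sum_apply _ _ _)

theorem exists_apply_eq [FiniteDimensional ℝ E] [T2Space M] [SigmaCompactSpace M]
    (x : M) (v : TangentSpace I x) : ∃ X : SmoothField I M, X x = v :=
  let ⟨X, hX, h⟩ := exists_isSmoothField_apply_eq x v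
  ⟨⟨X, hX⟩, h⟩

end SmoothField

omit [IsManifold I ∞ M] in
theorem SmoothFunction.sum_apply {κ : Type*} (s : Finset κ) (f : κ → SmoothFunction I M) (x : M) :
    (∑ i ∈ s, f i) x = ∑ i ∈ s, f i x := by
  classical
  induction s using Finset.induction_on with
  | empty => simp
  | insert a s ha ih => simp [Finset.sum_insert ha, ih]

variable [RiemannianBundle (fun x : M ↦ TangentSpace I x)]

variable (I M) in
/-- Finite families of globally defined smooth vector fields `e`, `e'` which are dual to each other
in the sense that `∑ᵢ ⟨v, e'ᵢ⟩ eᵢ = v`. -/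
structure DualFrame where
  /-- the index type -/
  ι : Type
  [fintype_ι : Fintype ι]
  /-- the frame -/
  e : ι → SmoothField I M
  /-- the dual frame -/
  e' : ι → SmoothField I M
  sum_frame (x : M) (v : TangentSpace I x) : ∑ i, (inner ℝ v (e' i x) : ℝ) • e i x = v

attribute [instance] DualFrame.fintype_ι

variable [FiniteDimensional ℝ E] [IsContMDiffRiemannianBundle I ∞ E (fun x : M ↦ TangentSpace I x)]

/-- A compact almost Hermitian surface has global dual frames. -/
theorem AlmostHermitianStructure.nonempty_dualFrame [CompactSpace M] [T2Space M]
    (hE : Module.finrank ℝ E = 4) (S : AlmostHermitianStructure I M) :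
    Nonempty (DualFrame I M) := by
  have hloc (x : M) : ∃ X Y : SmoothField I M,
      0 < (inner ℝ (X x) (X x) * inner ℝ (orthogonalPart (S.J x) (X x) (Y x))
        (orthogonalPart (S.J x) (X x) (Y x)) : ℝ) := by
    obtain ⟨u, hu, -⟩ := exists_unitary_basis (V := TangentSpace I x) hE (S.J_J x) (S.inner_J_J x)
    obtain ⟨X, hX⟩ := SmoothField.exists_apply_eq x (u 0)
    obtain ⟨Y, hY⟩ := SmoothField.exists_apply_eq x (u 2)
    refine ⟨X, Y, ?_⟩
    simp only [hX, hY, orthogonalPart, hu, u.inner_eq_ite]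
    simp
  choose X Y hXY using hloc
  obtain ⟨W, hW⟩ : ∃ W : M → SmoothField I M,
      ∀ x y, W x y = orthogonalPart (S.J y) (X x y) (Y x y) :=
    ⟨fun x ↦ ⟨_, ((IsSmoothField.smul ((X x).isSmoothField.contMDiff_inner (X x).isSmoothField)
      (Y x).isSmoothField).sub (.smul ((Y x).isSmoothField.contMDiff_inner (X x).isSmoothField)
      (X x).isSmoothField)).sub (.smul ((Y x).isSmoothField.contMDiff_inner
      ((X x).isSmoothField.mapField S)) ((X x).isSmoothField.mapField S))⟩, fun _ _ ↦ rfl⟩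
  obtain ⟨JF, hJF⟩ : ∃ JF : SmoothField I M → SmoothField I M, ∀ X x, JF X x = S.J x (X x) :=
    ⟨fun X ↦ ⟨_, X.isSmoothField.mapField S⟩, fun _ _ ↦ rfl⟩
  obtain ⟨g, hg⟩ : ∃ g : SmoothField I M → SmoothFunction I M, ∀ X x, g X x = inner ℝ (X x) (X x) :=
    ⟨fun X ↦ ⟨_, X.isSmoothField.contMDiff_inner X.isSmoothField⟩, fun _ _ ↦ rfl⟩
  simp only [← hW] at hXY
  have hopen (x : M) : {y | 0 < (g (X x) * g (W x)) y} ∈ nhds x :=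
    (isOpen_lt continuous_const (g (X x) * g (W x)).contMDiff.continuous).mem_nhds
      (by simpa [hg] using hXY x)
  obtain ⟨t, -, ht⟩ := isCompact_univ.elim_nhds_subcover _ fun x _ ↦ hopen x
  let c : Fin t.card → M := fun k ↦ t.equivFin.symm k
  let φ : SmoothFunction I M := ∑ k, g (X (c k)) * g (W (c k))
  have hφ (y : M) : φ y ≠ 0 := by
    obtain ⟨x, hx, hy⟩ := Set.mem_iUnion₂.1 (ht (Set.mem_univ y))
    simp only [φ, SmoothFunction.sum_apply]
    refine (Finset.sum_pos' (fun k _ ↦ ?_) ⟨t.equivFin ⟨x, hx⟩, Finset.mem_univ _, ?_⟩).ne'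
    · rw [ContMDiffMap.coe_mul, Pi.mul_apply, hg, hg]
      exact mul_nonneg real_inner_self_nonneg real_inner_self_nonneg
    · simpa [c] using hy
  obtain ⟨ψ, hψ⟩ : ∃ ψ : SmoothFunction I M, ∀ x, ψ x = (φ x)⁻¹ :=
    ⟨⟨_, φ.contMDiff.inv₀ hφ⟩, fun _ ↦ rfl⟩
  refine ⟨⟨Fin t.card × Fin 4,
    fun p ↦ ![X (c p.1), JF (X (c p.1)), W (c p.1), JF (W (c p.1))] p.2,
    fun p ↦ ![(ψ * g (W (c p.1))) • X (c p.1), (ψ * g (W (c p.1))) • JF (X (c p.1)),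
      (ψ * g (X (c p.1))) • W (c p.1), (ψ * g (X (c p.1))) • JF (W (c p.1))] p.2, ?_⟩⟩
  intro x v
  have h := fun k ↦ smul_sum_unitary hE (S.J_J x) (S.inner_J_J x) (X (c k) x) (Y (c k) x) v
  have h' : φ x • v
      = ∑ k, (inner ℝ (X (c k) x) (X (c k) x) * inner ℝ (W (c k) x) (W (c k) x) : ℝ) • v := by
    rw [← Finset.sum_smul]
    simp only [φ, SmoothFunction.sum_apply, ContMDiffMap.coe_mul, Pi.mul_apply, hg]
  calc _ = (φ x)⁻¹ • (φ x • v) := by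
        rw [h', Fintype.sum_prod_type, Finset.smul_sum]
        refine Finset.sum_congr rfl fun k _ ↦ ?_
        have h1 := h k
        simp only [← hW] at h1
        rw [← h1]
        simp only [Fin.sum_univ_four, Matrix.cons_val, SmoothField.smul_apply, hJF, hψ, hg,
          inner_smul_right, ContMDiffMap.coe_mul, Pi.mul_apply]
        module
    _ = v := by rw [smul_smul, inv_mul_cancel₀ (hφ x), one_smul]

end AlmostHermitian


namespace AlmostHermitian

variable {E : Type*} [NormedAddCommGroup E] [NormedSpace ℝ E] [FiniteDimensional ℝ E]
  {H : Type*} [TopologicalSpace H] {I : ModelWithCorners ℝ E H}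
  {M : Type*} [TopologicalSpace M] [ChartedSpace H M] [IsManifold I ∞ M]
  [RiemannianBundle (fun x : M ↦ TangentSpace I x)]
  [IsContMDiffRiemannianBundle I ∞ E (fun x : M ↦ TangentSpace I x)]

section Smooth

variable {X Y Z : Π x : M, TangentSpace I x}

theorem IsSmoothField.contMDiff_koszul (hX : IsSmoothField I X) (hY : IsSmoothField I Y)
    (hZ : IsSmoothField I Z) : CMDiff ∞ (koszul I X Y Z) := by
  have := FiniteDimensional.complete ℝ E
  have h := (((((hX.contMDiff_lieDeriv (hY.contMDiff_inner hZ)).add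
    (hY.contMDiff_lieDeriv (hX.contMDiff_inner hZ))).sub
    (hZ.contMDiff_lieDeriv (hX.contMDiff_inner hY))).add
    ((hX.mlieBracket hY).contMDiff_inner hZ)).sub
    ((hX.mlieBracket hZ).contMDiff_inner hY)).sub ((hY.mlieBracket hZ).contMDiff_inner hX)
  exact contMDiff_const.mul h

theorem DualFrame.isSmoothField_leviCivita (F : DualFrame I M) (hX : IsSmoothField I X)
    (hY : IsSmoothField I Y) : IsSmoothField I (fun x ↦ leviCivita I M Y x (X x)) := by
  have h : (fun x ↦ leviCivita I M Y x (X x))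
      = fun x ↦ ∑ i, (koszul I X Y (F.e' i) • ⇑(F.e i)) x := by
    ext x
    rw [← F.sum_frame x (leviCivita I M Y x (X x))]
    refine Finset.sum_congr rfl fun i _ ↦ ?_
    rw [inner_leviCivita (hX.mdifferentiableAt x) (hY.mdifferentiableAt x)
      ((F.e' i).isSmoothField.mdifferentiableAt x)]
    rfl
  rw [h]
  exact IsSmoothField.sum fun i _ ↦
    IsSmoothField.smul (hX.contMDiff_koszul hY (F.e' i).isSmoothField) (F.e i).isSmoothField

end Smooth

namespace SmoothField

variable (I M) in
/-- The Riemannian metric on smooth vector fields. -/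
def metric : SmoothField I M →ₗ[SmoothFunction I M] SmoothField I M →ₗ[SmoothFunction I M]
    SmoothFunction I M :=
  LinearMap.mk₂ _ (fun X Y ↦ ⟨_, X.isSmoothField.contMDiff_inner Y.isSmoothField⟩)
    (fun X X' Y ↦ by ext x; exact inner_add_left (𝕜 := ℝ) (X x) (X' x) (Y x))
    (fun f X Y ↦ by ext x; exact real_inner_smul_left (X x) (Y x) (f x))
    (fun X Y Y' ↦ by ext x; exact inner_add_right (𝕜 := ℝ) (X x) (Y x) (Y' x))
    (fun f X Y ↦ by ext x; exact real_inner_smul_right (X x) (Y x) (f x))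

omit [FiniteDimensional ℝ E] [RiemannianBundle (fun x : M ↦ TangentSpace I x)]
  [IsContMDiffRiemannianBundle I ∞ E (fun x : M ↦ TangentSpace I x)]

variable (I M) in
/-- The directional derivatives of smooth functions along smooth vector fields. -/
def der : SmoothField I M →ₗ[SmoothFunction I M] Derivation ℝ (SmoothFunction I M)
    (SmoothFunction I M) where
  toFun X := Derivation.mk'
    { toFun f := ⟨_, X.isSmoothField.contMDiff_lieDeriv f.contMDiff⟩
      map_add' f f' := by
        ext x
        exact congrArg (fun L ↦ L (X x)) (mvfderiv_add (f.contMDiff.mdifferentiable (by simp) x)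
          (f'.contMDiff.mdifferentiable (by simp) x))
      map_smul' c f := by
        ext x
        have h := congrArg (fun L ↦ L (X x)) (mvfderiv_mul (f := fun _ : M ↦ c)
          mdifferentiableAt_const (f.contMDiff.mdifferentiable (by simp) x))
        rw [mvfderiv_const, smul_zero, add_zero] at h
        exact h }
    fun f f' ↦ by
      ext x
      exact congrArg (fun L ↦ L (X x)) (mvfderiv_mul (f.contMDiff.mdifferentiable (by simp) x)
        (f'.contMDiff.mdifferentiable (by simp) x))
  map_add' X X' := by
    ext f x
    exact map_add (mvfderiv I f x) _ _
  map_smul' a X := by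
    ext f x
    exact map_smul (mvfderiv I f x) _ _

/-- The Lie bracket of smooth vector fields. -/
def bracket [CompleteSpace E] (X Y : SmoothField I M) : SmoothField I M :=
  ⟨_, X.isSmoothField.mlieBracket Y.isSmoothField⟩

end SmoothField

namespace DualFrame

variable (F : DualFrame I M)

/-- The Levi-Civita connection on smooth vector fields. -/
def nabla : SmoothField I M →ₗ[SmoothFunction I M] SmoothField I M →+ SmoothField I M where
  toFun X :=
    { toFun Y := ⟨_, F.isSmoothField_leviCivita X.isSmoothField Y.isSmoothField⟩
      map_zero' := by
        ext x
        exact congrArg (fun L ↦ L x (X x)) (leviCivita I M).zero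
      map_add' Y Y' := by
        ext x
        exact congrArg (fun L ↦ L (X x)) ((leviCivita I M).isCovariantDerivativeOn.add
          (Y.isSmoothField.mdifferentiableAt x) (Y'.isSmoothField.mdifferentiableAt x)) }
  map_add' X X' := by
    ext Y x
    exact map_add (leviCivita I M Y x) _ _
  map_smul' a X := by
    ext Y x
    exact map_smul (leviCivita I M Y x) _ _

theorem nabla_sub_nabla [CompleteSpace E] (X Y : SmoothField I M) :
    F.nabla X Y - F.nabla Y X = SmoothField.bracket X Y := by
  ext x
  exact (mlieBracket_eq (X.isSmoothField.mdifferentiableAt x)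
    (Y.isSmoothField.mdifferentiableAt x)).symm

variable [T2Space M] [SigmaCompactSpace M] [Nontrivial E]

/-- The Levi-Civita calculus on the smooth vector fields of a Riemannian manifold with a global dual
frame. -/
def calculus : LeviCivitaCalculus (SmoothFunction I M) (SmoothField I M) where
  g := SmoothField.metric I M
  der := SmoothField.der I M
  nabla := F.nabla
  g_symm X Y := by ext x; exact real_inner_comm (Y x) (X x)
  nabla_smul X Y f := by
    ext x
    exact congrArg (fun L ↦ L (X x)) ((leviCivita I M).isCovariantDerivativeOn.leibniz
      (Y.isSmoothField.mdifferentiableAt x) (f.contMDiff.mdifferentiable (by simp) x))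
  der_g Z X Y := by
    ext x
    exact leviCivita_metric (Z.isSmoothField.mdifferentiableAt x)
      (X.isSmoothField.mdifferentiableAt x) (Y.isSmoothField.mdifferentiableAt x)
  der_bracket X Y f := by
    have := FiniteDimensional.complete ℝ E
    rw [nabla_sub_nabla]
    ext x
    exact lieDeriv_mlieBracket X.isSmoothField Y.isSmoothField f.contMDiff x
  jacobi X Y Z := by
    have := FiniteDimensional.complete ℝ E
    simp only [nabla_sub_nabla]
    ext x
    exact congrFun (mlieBracket_jacobi X.isSmoothField Y.isSmoothField Z.isSmoothField) x
  ι := F.ι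
  e := F.e
  e' := F.e'
  sum_frame X := by
    ext x
    simp only [SmoothField.sum_apply]
    exact F.sum_frame x (X x)

end DualFrame

end AlmostHermitian


namespace AlmostHermitian

section Calculus

open Matrix Polynomial in
theorem hasDerivAt_det_one_add_smul {n : Type*} [Fintype n] [DecidableEq n] (C : Matrix n n ℝ) :
    HasDerivAt (fun t : ℝ ↦ (1 + t • C).det) C.trace 0 := by
  rw [funext fun t ↦ Matrix.det_one_add_smul t C]
  set q := (det (1 + (X : ℝ[X]) • C.map Polynomial.C)).divX.divX
  have h := (((hasDerivAt_id (0 : ℝ)).const_mul C.trace).const_add 1).add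
    ((q.hasDerivAt 0).mul ((hasDerivAt_id (0 : ℝ)).pow 2))
  convert! h using 1
  simp

/-- The derivative of a determinant along a curve with velocity `Cᵀ A + A C`. -/
theorem hasDerivAt_det {n : Type*} [Fintype n] [DecidableEq n] {A : ℝ → Matrix n n ℝ}
    {C : Matrix n n ℝ}
    (hA : ∀ l m, HasDerivAt (fun t ↦ A t l m) ((C.transpose * A 0 + A 0 * C) l m) 0) :
    HasDerivAt (fun t ↦ (A t).det) (2 * C.trace * (A 0).det) 0 := by
  have hdet : Differentiable ℝ fun B : n → n → ℝ ↦ (Matrix.of B).det := by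
    simp only [Matrix.det_apply, Matrix.of_apply]
    fun_prop
  have h1 : HasDerivAt (fun t l m ↦ A t l m) (fun l m ↦ (C.transpose * A 0 + A 0 * C) l m) 0 :=
    hasDerivAt_pi.2 fun l ↦ hasDerivAt_pi.2 (hA l)
  let B (t : ℝ) : Matrix n n ℝ := (1 + t • C).transpose * A 0 * (1 + t • C)
  have hB (t : ℝ) : B t = A 0 + t • (C.transpose * A 0 + A 0 * C)
      + t ^ 2 • (C.transpose * A 0 * C) := by
    simp only [B, Matrix.transpose_add, Matrix.transpose_one, Matrix.transpose_smul, add_mul,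
      mul_add, one_mul, mul_one, Matrix.smul_mul, Matrix.mul_smul, smul_add, smul_smul, pow_two]
    abel
  have h2 : HasDerivAt (fun t l m ↦ B t l m) (fun l m ↦ (C.transpose * A 0 + A 0 * C) l m) 0 := by
    refine hasDerivAt_pi.2 fun l ↦ hasDerivAt_pi.2 fun m ↦ ?_
    simp only [hB, Matrix.add_apply, Matrix.smul_apply, smul_eq_mul]
    have h := (((hasDerivAt_id (0 : ℝ)).mul_const ((C.transpose * A 0 + A 0 * C) l m)).const_add
      (A 0 l m)).add (((hasDerivAt_id (0 : ℝ)).pow 2).mul_const ((C.transpose * A 0 * C) l m))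
    convert! h using 1
    simp
  have hB0 : (fun l m ↦ B 0 l m) = fun l m ↦ A 0 l m := by simp [hB]
  have h3 := (hdet (fun l m ↦ A 0 l m)).hasFDerivAt.comp_hasDerivAt (0 : ℝ) h1
  have h4 := HasFDerivAt.comp_hasDerivAt (0 : ℝ)
    (by rw [hB0]; exact (hdet (fun l m ↦ A 0 l m)).hasFDerivAt) h2
  have h5 : HasDerivAt (fun t ↦ (B t).det) (2 * C.trace * (A 0).det) 0 := by
    simp only [B, Matrix.det_mul, Matrix.det_transpose]
    have h := ((hasDerivAt_det_one_add_smul C).mul_const (A 0).det).mul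
      (hasDerivAt_det_one_add_smul C)
    convert! h using 1
    simp
    ring
  rw [h5.unique h4]
  exact h3

open MeasureTheory in
theorem integral_fderiv_eq_zero {E : Type*} [NormedAddCommGroup E] [NormedSpace ℝ E]
    [FiniteDimensional ℝ E] [MeasurableSpace E] [BorelSpace E] (ν : Measure E) [ν.IsAddHaarMeasure]
    {f : E → ℝ} (hf : ContDiff ℝ 1 f) (hc : HasCompactSupport f) (v : E) :
    ∫ y, fderiv ℝ f y v ∂ν = 0 := by
  have h1 : Integrable f ν := hf.continuous.integrable_of_hasCompactSupport hc
  have h2 : Integrable (fun y ↦ fderiv ℝ f y v) ν :=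
    ((hf.continuous_fderiv (by simp)).clm_apply continuous_const).integrable_of_hasCompactSupport
      (hc.fderiv_apply ℝ v)
  have h := integral_mul_fderiv_eq_neg_fderiv_mul_of_integrable (μ := ν) (f := fun _ ↦ (1 : ℝ))
    (g := f) (v := v) (by simp) (by simpa using h2) (by simpa using h1) (by simp)
    fun y _ ↦ (hf.differentiable (by simp)) y
  simpa using h

end Calculus

end AlmostHermitian


namespace AlmostHermitian

variable {E : Type*} [NormedAddCommGroup E] [NormedSpace ℝ E] [FiniteDimensional ℝ E]
  {H : Type*} [TopologicalSpace H] (I : ModelWithCorners ℝ E H)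
  {M : Type*} [TopologicalSpace M] [ChartedSpace H M] [IsManifold I ∞ M]

/-- The coordinate vector fields of the chart at `p`. -/
def chartFrame (p : M) (k : Fin (Module.finrank ℝ E)) : Π x : M, TangentSpace I x :=
  (trivializationAt E (fun x : M ↦ TangentSpace I x) p).localFrame (Module.finBasis ℝ E) k

/-- The coordinate functions of vectors with respect to the chart at `p`. -/
def chartCoeff (p : M) (k : Fin (Module.finrank ℝ E)) (x : M) : TangentSpace I x →ₗ[ℝ] ℝ :=
  (trivializationAt E (fun x : M ↦ TangentSpace I x) p).localFrameCoeff I (Module.finBasis ℝ E) k x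

variable {I} {p x : M}

theorem chartFrame_eq (hx : x ∈ (chartAt H p).source) (k : Fin (Module.finrank ℝ E)) :
    chartFrame I p k x = (trivializationAt E (fun x : M ↦ TangentSpace I x) p).symmL ℝ x
      (Module.finBasis ℝ E k) := by
  have hx' : x ∈ (trivializationAt E (fun x : M ↦ TangentSpace I x) p).baseSet := hx
  rw [chartFrame, Trivialization.localFrame_apply_of_mem_baseSet _ _ hx',
    Trivialization.symmL_apply _ hx']
  simp [Trivialization.basisAt]

/-- A constant vector field on a vector space. -/
def constField (v : E) (y : E) : TangentSpace 𝓘(ℝ, E) y := v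

theorem mfderiv_extChartAt_chartFrame (hx : x ∈ (chartAt H p).source)
    (k : Fin (Module.finrank ℝ E)) :
    mfderiv I 𝓘(ℝ, E) (extChartAt I p) x (chartFrame I p k x)
      = constField (Module.finBasis ℝ E k) (extChartAt I p x) := by
  have h := congrArg (fun L ↦ L (chartFrame I p k x))
    (TangentBundle.continuousLinearMapAt_trivializationAt hx)
  refine h.symm.trans ?_
  rw [chartFrame_eq hx]
  exact Trivialization.continuousLinearMapAt_symmL _ hx _

theorem sum_chartCoeff_smul (hx : x ∈ (chartAt H p).source) (v : TangentSpace I x) :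
    ∑ k, chartCoeff I p k x v • chartFrame I p k x = v := by
  obtain h := Trivialization.eq_sum_localFrameCoeff_smul (I := I) (b := Module.finBasis ℝ E)
    (e := trivializationAt E (fun x : M ↦ TangentSpace I x) p) (s := FiberBundle.extend E v) hx
  rw [FiberBundle.extend_apply_self] at h
  exact h.symm

theorem contMDiffAt_chartFrame (hx : x ∈ (chartAt H p).source) (k : Fin (Module.finrank ℝ E)) :
    CMDiffAt ∞ (T% (chartFrame I p k)) x :=
  contMDiffAt_localFrame_of_mem _ _ _ _ hx

theorem contMDiffAt_chartCoeff (hx : x ∈ (chartAt H p).source) (k : Fin (Module.finrank ℝ E))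
    {V : Π x : M, TangentSpace I x} (hV : CMDiffAt ∞ (T% V) x) :
    CMDiffAt ∞ (fun y ↦ chartCoeff I p k y (V y)) x :=
  contMDiffAt_localFrameCoeff _ hx hV k

theorem chartFrame_eventuallyEq_mpullback (hx : x ∈ (chartAt H p).source)
    (k : Fin (Module.finrank ℝ E)) :
    chartFrame I p k =ᶠ[nhds x]
      mpullback I 𝓘(ℝ, E) (extChartAt I p) (constField (Module.finBasis ℝ E k)) := by
  filter_upwards [(chartAt H p).open_source.mem_nhds hx] with y hy
  rw [mpullback_apply, ← mfderiv_extChartAt_chartFrame hy k]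
  obtain ⟨e, he⟩ := isInvertible_mfderiv_extChartAt (I := I) (x := p) (y := y)
    (by rwa [extChartAt_source])
  rw [← he, ContinuousLinearMap.inverse_equiv]
  exact (e.symm_apply_apply _).symm

omit [FiniteDimensional ℝ E] in
theorem mdifferentiableAt_constField (v y : E) : MDiffAt (T% (constField v)) y :=
  (contMDiff_vectorSpace_iff_contDiff (n := 1).2 contDiff_const y).mdifferentiableAt (by simp)

omit [FiniteDimensional ℝ E] in
theorem mlieBracket_constField (v w y : E) :
    mlieBracket 𝓘(ℝ, E) (constField v) (constField w) y = 0 := by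
  rw [← mlieBracketWithin_univ, mlieBracketWithin_eq_lieBracketWithin]
  change fderivWithin ℝ (fun _ ↦ w) Set.univ y v - fderivWithin ℝ (fun _ ↦ v) Set.univ y w = 0
  simp

theorem mlieBracket_chartFrame (hx : x ∈ (chartAt H p).source) (k l : Fin (Module.finrank ℝ E)) :
    mlieBracket I (chartFrame I p k) (chartFrame I p l) x = 0 := by
  have := FiniteDimensional.complete ℝ E
  have : IsManifold I (minSmoothness ℝ 2) M := IsManifold.of_le (n := ∞) (by simp; norm_cast)
  rw [(chartFrame_eventuallyEq_mpullback hx k).mlieBracket_vectorField_eq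
    (chartFrame_eventuallyEq_mpullback hx l), ← mpullback_mlieBracket (n := ∞)
    (mdifferentiableAt_constField _ _) (mdifferentiableAt_constField _ _)
    (contMDiffAt_extChartAt' hx) (by simp; norm_cast), mpullback_apply, mlieBracket_constField,
    map_zero]

variable [I.Boundaryless]

omit [FiniteDimensional ℝ E] in
theorem hasFDerivAt_comp_extChartAt_symm (hx : x ∈ (chartAt H p).source) {f : M → ℝ}
    (hf : MDiffAt f x) :
    HasFDerivAt (f ∘ (extChartAt I p).symm) (mvfderiv I f x ∘L
      (trivializationAt E (fun x : M ↦ TangentSpace I x) p).symmL ℝ x) (extChartAt I p x) := by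
  have hx' : x ∈ (extChartAt I p).source := by rwa [extChartAt_source]
  have h1 := mdifferentiableWithinAt_extChartAt_symm ((extChartAt I p).map_source hx')
  have h2 := h1.hasMFDerivWithinAt
  rw [← TangentBundle.symmL_trivializationAt hx] at h2
  rw [ModelWithCorners.Boundaryless.range_eq_univ] at h2
  have h3 (z : M) (hz : z = x) : HasMFDerivAt I 𝓘(ℝ, ℝ) f z (mvfderiv I f x : E →L[ℝ] ℝ) := by
    subst hz
    exact hf.hasMFDerivAt
  exact hasMFDerivAt_iff_hasFDerivAt.1
    (HasMFDerivAt.comp _ (h3 _ ((extChartAt I p).left_inv hx')) (hasMFDerivWithinAt_univ.1 h2))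

end AlmostHermitian


namespace AlmostHermitian

section LinearAlgebra

/-- The trace of an endomorphism may be computed with any two resolutions of the identity. -/
theorem sum_apply_eq_sum_apply {V : Type*} [AddCommGroup V] [Module ℝ V] {ι κ : Type*} [Fintype ι]
    [Fintype κ] {c : ι → V →ₗ[ℝ] ℝ} {a : ι → V} {d : κ → V →ₗ[ℝ] ℝ} {b : κ → V}
    (hc : ∀ v, ∑ i, c i v • a i = v) (hd : ∀ v, ∑ k, d k v • b k = v) (L : V →ₗ[ℝ] V) :
    ∑ i, c i (L (a i)) = ∑ k, d k (L (b k)) := by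
  calc ∑ i, c i (L (a i)) = ∑ i, c i (∑ k, d k (L (a i)) • b k) := by simp only [hd]
    _ = ∑ k, d k (L (∑ i, c i (b k) • a i)) := by
      simp only [map_sum, map_smul, smul_eq_mul]
      rw [Finset.sum_comm]
      simp only [mul_comm]
    _ = ∑ k, d k (L (b k)) := by simp only [hc]

end LinearAlgebra

variable {E : Type*} [NormedAddCommGroup E] [NormedSpace ℝ E] [FiniteDimensional ℝ E]
  {H : Type*} [TopologicalSpace H] {I : ModelWithCorners ℝ E H}
  {M : Type*} [TopologicalSpace M] [ChartedSpace H M] [IsManifold I ∞ M] {p x : M}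

theorem mdifferentiableAt_chartFrame (hx : x ∈ (chartAt H p).source)
    (k : Fin (Module.finrank ℝ E)) : MDiffAt (T% (chartFrame I p k)) x :=
  (contMDiffAt_chartFrame hx k).mdifferentiableAt (by simp)

theorem chartCoeff_chartFrame (hx : x ∈ (chartAt H p).source) (k l : Fin (Module.finrank ℝ E)) :
    chartCoeff I p k x (chartFrame I p l x) = if l = k then 1 else 0 := by
  have hx' : x ∈ (trivializationAt E (fun x : M ↦ TangentSpace I x) p).baseSet := hx
  rw [chartCoeff, chartFrame, Trivialization.localFrameCoeff_apply_of_mem_baseSet _ _ hx',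
    Trivialization.localFrame_apply_of_mem_baseSet _ _ hx', Module.Basis.repr_self,
    Finsupp.single_apply]

theorem linearIndependent_chartFrame (hx : x ∈ (chartAt H p).source) :
    LinearIndependent ℝ fun k ↦ chartFrame I p k x := by
  rw [Fintype.linearIndependent_iff]
  intro c hc k
  have h := congrArg (chartCoeff I p k x) hc
  simpa [chartCoeff_chartFrame hx] using h

variable [RiemannianBundle (fun x : M ↦ TangentSpace I x)]

variable (I) in
/-- The matrix of the metric in the chart at `p`. -/
def chartGram (p x : M) : Matrix (Fin (Module.finrank ℝ E)) (Fin (Module.finrank ℝ E)) ℝ :=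
  Matrix.gram ℝ fun k ↦ chartFrame I p k x

variable (I) in
/-- The Riemannian density in the chart at `p`. -/
def chartDensity (p x : M) : ℝ :=
  √(chartGram I p x).det

theorem chartGram_apply (p x : M) (k l : Fin (Module.finrank ℝ E)) :
    chartGram I p x k l = inner ℝ (chartFrame I p k x) (chartFrame I p l x) := rfl

theorem det_chartGram_pos (hx : x ∈ (chartAt H p).source) : 0 < (chartGram I p x).det := by
  have h : (chartGram I p x).PosDef :=
    Matrix.posDef_gram_of_linearIndependent (linearIndependent_chartFrame hx)
  exact h.det_pos

theorem chartDensity_pos (hx : x ∈ (chartAt H p).source) : 0 < chartDensity I p x :=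
  Real.sqrt_pos.2 (det_chartGram_pos hx)

variable [IsContMDiffRiemannianBundle I ∞ E (fun x : M ↦ TangentSpace I x)]

theorem contMDiffAt_chartDensity (hx : x ∈ (chartAt H p).source) :
    CMDiffAt ∞ (chartDensity I p) x := by
  have h1 (k l) : CMDiffAt ∞
      (fun y ↦ (inner ℝ (chartFrame I p k y) (chartFrame I p l y) : ℝ)) x :=
    ContMDiffAt.inner_bundle (contMDiffAt_chartFrame hx k) (contMDiffAt_chartFrame hx l)
  let n := Fin (Module.finrank ℝ E)
  have h2 : ContMDiffAt I 𝓘(ℝ, n → n → ℝ) ∞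
      (fun y k l ↦ (inner ℝ (chartFrame I p k y) (chartFrame I p l y) : ℝ)) x :=
    contMDiffAt_pi_space.2 fun k ↦ contMDiffAt_pi_space.2 (h1 k)
  have hdet : ContDiff ℝ ∞ fun B : n → n → ℝ ↦ (Matrix.of B).det := by
    simp only [Matrix.det_apply, Matrix.of_apply]
    fun_prop
  have h3 := hdet.contDiffAt.contMDiffAt.comp x h2
  exact (Real.contDiffAt_sqrt (det_chartGram_pos hx).ne').contMDiffAt.comp x h3

omit [RiemannianBundle (fun x : M ↦ TangentSpace I x)]
  [IsContMDiffRiemannianBundle I ∞ E (fun x : M ↦ TangentSpace I x)] [FiniteDimensional ℝ E] in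
theorem mdifferentiableAt_sum_smul {κ : Type*} (s : Finset κ) {f : κ → M → ℝ}
    {X : κ → Π x : M, TangentSpace I x} (hf : ∀ k ∈ s, MDiffAt (f k) x)
    (hX : ∀ k ∈ s, MDiffAt (T% (X k)) x) : MDiffAt (T% (∑ k ∈ s, f k • X k)) x := by
  have h : (∑ k ∈ s, f k • X k) = fun y ↦ ∑ k ∈ s, (f k • X k) y := by
    ext y
    rw [Finset.sum_apply]
  rw [h]
  exact MDifferentiableAt.sum_section fun k hk ↦ (hf k hk).smul_section (hX k hk)

/-- The Leibniz rule for the covariant derivative of a linear combination. -/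
theorem leviCivita_sum_smul {κ : Type*} (s : Finset κ) {f : κ → M → ℝ}
    {X : κ → Π x : M, TangentSpace I x} (hf : ∀ k ∈ s, MDiffAt (f k) x)
    (hX : ∀ k ∈ s, MDiffAt (T% (X k)) x) (w : TangentSpace I x) :
    leviCivita I M (∑ k ∈ s, f k • X k) x w
      = ∑ k ∈ s, (f k x • leviCivita I M (X k) x w + mvfderiv I (f k) x w • X k x) := by
  classical
  induction s using Finset.induction_on with
  | empty =>
    rw [Finset.sum_empty, Finset.sum_empty, (leviCivita I M).zero]
    rfl
  | insert a s ha ih =>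
    have hs : MDiffAt (T% (∑ k ∈ s, f k • X k)) x :=
      mdifferentiableAt_sum_smul s (fun k hk ↦ hf k (by simp [hk])) fun k hk ↦ hX k (by simp [hk])
    rw [Finset.sum_insert ha, Finset.sum_insert ha, ← ih (fun k hk ↦ hf k (by simp [hk]))
      (fun k hk ↦ hX k (by simp [hk])), (leviCivita I M).isCovariantDerivativeOn.add
      ((hf a (by simp)).smul_section (hX a (by simp))) hs,
      (leviCivita I M).isCovariantDerivativeOn.leibniz (hX a (by simp)) (hf a (by simp))]
    rfl

theorem mvfderiv_chartDensity [I.Boundaryless] (hx : x ∈ (chartAt H p).source)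
    (k : Fin (Module.finrank ℝ E)) :
    mvfderiv I (chartDensity I p) x (chartFrame I p k x) = chartDensity I p x
      * ∑ j, chartCoeff I p j x (leviCivita I M (chartFrame I p k) x (chartFrame I p j x)) := by
  have hx' : x ∈ (extChartAt I p).source := by rwa [extChartAt_source]
  have hline {f : M → ℝ} (hf : MDiffAt f x) : HasDerivAt
      (fun t : ℝ ↦ f ((extChartAt I p).symm (extChartAt I p x + t • Module.finBasis ℝ E k)))
      (mvfderiv I f x (chartFrame I p k x)) 0 := by
    have h1 := hasFDerivAt_comp_extChartAt_symm hx hf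
    have h2 : HasDerivAt (fun t : ℝ ↦ extChartAt I p x + t • Module.finBasis ℝ E k)
        (Module.finBasis ℝ E k) 0 := by
      simpa using ((hasDerivAt_id (0 : ℝ)).smul_const (Module.finBasis ℝ E k)).const_add
        (extChartAt I p x)
    rw [chartFrame_eq hx]
    exact HasFDerivAt.comp_hasDerivAt_of_eq (0 : ℝ) h1 h2 (by simp)
  set c : ℝ → M := fun t ↦ (extChartAt I p).symm (extChartAt I p x + t • Module.finBasis ℝ E k)
  have hc : c 0 = x := by
    simp only [c, zero_smul, add_zero]
    exact (extChartAt I p).left_inv hx'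
  let C : Matrix (Fin (Module.finrank ℝ E)) (Fin (Module.finrank ℝ E)) ℝ :=
    Matrix.of fun j l ↦
      chartCoeff I p j x (leviCivita I M (chartFrame I p l) x (chartFrame I p k x))
  have hC (l) : ∑ j, C j l • chartFrame I p j x
      = leviCivita I M (chartFrame I p l) x (chartFrame I p k x) := sum_chartCoeff_smul hx _
  have htr : C.trace
      = ∑ j, chartCoeff I p j x (leviCivita I M (chartFrame I p k) x (chartFrame I p j x)) := by
    refine Finset.sum_congr rfl fun j _ ↦ ?_
    have h := mlieBracket_chartFrame (I := I) hx k j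
    rw [mlieBracket_eq (mdifferentiableAt_chartFrame hx k) (mdifferentiableAt_chartFrame hx j),
      sub_eq_zero] at h
    simp [C, h]
  have h1 := hasDerivAt_det (A := fun t ↦ chartGram I p (c t)) (C := C)
    fun l m ↦ by
      have h2 := hline (mdifferentiableAt_inner (mdifferentiableAt_chartFrame (I := I) hx l)
        (mdifferentiableAt_chartFrame (I := I) hx m))
      have h3 := leviCivita_metric (mdifferentiableAt_chartFrame (I := I) hx k)
        (mdifferentiableAt_chartFrame (I := I) hx l) (mdifferentiableAt_chartFrame (I := I) hx m)
      rw [lieDeriv] at h3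
      rw [h3, ← hC, ← hC] at h2
      convert! h2 using 1
      simp [Matrix.mul_apply, hc, chartGram_apply, sum_inner, inner_sum, inner_smul_left,
        inner_smul_right, mul_comm]
  have h4 := hline ((contMDiffAt_chartDensity (I := I) hx).mdifferentiableAt (by simp))
  have hpos := det_chartGram_pos (I := I) hx
  have h5 := h1.sqrt (by simpa only [hc] using hpos.ne')
  rw [h4.unique h5, htr]
  simp only [chartDensity, hc]
  have hs := Real.sq_sqrt hpos.le
  have hs0 := (Real.sqrt_pos.2 hpos).ne'
  field_simp
  rw [hs]

/-- The coordinate expression of the divergence. -/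
theorem sum_mvfderiv_chartDensity_mul [I.Boundaryless] (hx : x ∈ (chartAt H p).source)
    {V : Π x : M, TangentSpace I x} (hV : CMDiffAt ∞ (T% V) x) :
    ∑ k, mvfderiv I (fun y ↦ chartDensity I p y * chartCoeff I p k y (V y)) x (chartFrame I p k x)
      = chartDensity I p x * ∑ k, chartCoeff I p k x (leviCivita I M V x (chartFrame I p k x)) := by
  have hμ := (contMDiffAt_chartDensity (I := I) hx).mdifferentiableAt (n := ∞) (by simp)
  have hX := mdifferentiableAt_chartFrame (I := I) hx
  have hf (k) : MDiffAt (fun y ↦ chartCoeff I p k y (V y)) x :=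
    (contMDiffAt_chartCoeff hx k hV).mdifferentiableAt (by simp)
  have hsum : MDiffAt (T% (∑ k, (fun y ↦ chartCoeff I p k y (V y)) • chartFrame I p k)) x :=
    mdifferentiableAt_sum_smul _ (fun k _ ↦ hf k) fun k _ ↦ hX k
  have h1 : leviCivita I M V x
      = leviCivita I M (∑ k, (fun y ↦ chartCoeff I p k y (V y)) • chartFrame I p k) x := by
    refine (leviCivita I M).isCovariantDerivativeOn.congr_of_eventuallyEq
      (hV.mdifferentiableAt (by simp)) hsum Filter.univ_mem ?_
    filter_upwards [(chartAt H p).open_source.mem_nhds hx] with y hy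
    simp only [Finset.sum_apply, Pi.smul_apply']
    exact (sum_chartCoeff_smul hy _).symm
  rw [h1]
  simp only [leviCivita_sum_smul Finset.univ (fun k _ ↦ hf k) (fun k _ ↦ hX k), map_sum, map_add,
    map_smul, chartCoeff_chartFrame hx, mvfderiv_fun_mul hμ (hf _), add_apply, smul_apply,
    mvfderiv_chartDensity hx, smul_eq_mul, mul_ite, mul_one, mul_zero, Finset.sum_add_distrib,
    Finset.sum_ite_eq', Finset.mem_univ, if_true, mul_add, Finset.mul_sum]
  rw [add_comm]
  congr 1
  rw [Finset.sum_comm]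
  exact Finset.sum_congr rfl fun _ _ ↦ Finset.sum_congr rfl fun _ _ ↦ by ring

end AlmostHermitian


namespace AlmostHermitian

open MeasureTheory

variable {E : Type*} [NormedAddCommGroup E] [NormedSpace ℝ E] [FiniteDimensional ℝ E]
  {H : Type*} [TopologicalSpace H] {I : ModelWithCorners ℝ E H}
  {M : Type*} [TopologicalSpace M] [ChartedSpace H M] [IsManifold I ∞ M] {p q x : M}

theorem chartFrame_eq_tangentCoordChange (hx : x ∈ (chartAt H p).source)
    (k : Fin (Module.finrank ℝ E)) :
    chartFrame I p k x = tangentCoordChange I p x x (Module.finBasis ℝ E k) := by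
  rw [chartFrame_eq hx, TangentBundle.symmL_trivializationAt_eq_core hx]
  rfl

theorem chartFrame_eq_sum (hp : x ∈ (chartAt H p).source) (hq : x ∈ (chartAt H q).source)
    (k : Fin (Module.finrank ℝ E)) :
    chartFrame I q k x = ∑ l, LinearMap.toMatrix (Module.finBasis ℝ E) (Module.finBasis ℝ E)
      (tangentCoordChange I q p x : E →ₗ[ℝ] E) l k • chartFrame I p l x := by
  have h1 : tangentCoordChange I q p x (Module.finBasis ℝ E k)
      = ∑ l, LinearMap.toMatrix (Module.finBasis ℝ E) (Module.finBasis ℝ E)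
        (tangentCoordChange I q p x : E →ₗ[ℝ] E) l k • Module.finBasis ℝ E l := by
    simp only [LinearMap.toMatrix_apply]
    exact ((Module.finBasis ℝ E).sum_repr _).symm
  have h2 := tangentCoordChange_comp (I := I) (w := q) (x := p) (y := x) (z := x)
    (v := Module.finBasis ℝ E k) (by simp [hp, hq])
  rw [h1, map_sum] at h2
  simp only [map_smul] at h2
  rw [chartFrame_eq_tangentCoordChange hq, ← h2]
  exact Finset.sum_congr rfl fun l _ ↦ by
    rw [chartFrame_eq_tangentCoordChange hp]
    rfl

section Density

variable [RiemannianBundle (fun x : M ↦ TangentSpace I x)]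

theorem chartDensity_eq_abs_det_mul (hp : x ∈ (chartAt H p).source)
    (hq : x ∈ (chartAt H q).source) :
    chartDensity I q x = |(tangentCoordChange I q p x).det| * chartDensity I p x := by
  set D := LinearMap.toMatrix (Module.finBasis ℝ E) (Module.finBasis ℝ E)
      (tangentCoordChange I q p x : E →ₗ[ℝ] E) with hD
  have h1 : chartGram I q x = D.transpose * chartGram I p x * D := by
    ext k l
    rw [chartGram_apply, chartFrame_eq_sum hp hq k, chartFrame_eq_sum hp hq l, ← hD]
    simp only [sum_inner, inner_sum, real_inner_smul_left, real_inner_smul_right,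
      Matrix.mul_apply, Matrix.transpose_apply, chartGram_apply, Finset.sum_mul]
    exact Finset.sum_congr rfl fun _ _ ↦ Finset.sum_congr rfl fun _ _ ↦ by ring
  have h2 : D.det = (tangentCoordChange I q p x).det := LinearMap.det_toMatrix _ _
  rw [chartDensity, h1, Matrix.det_mul, Matrix.det_mul, Matrix.det_transpose, h2, chartDensity,
    ← Real.sqrt_sq_eq_abs, ← Real.sqrt_mul (sq_nonneg _)]
  congr 1
  ring

variable [MeasurableSpace E] [BorelSpace E] (ν : Measure E) [ν.IsAddHaarMeasure]

variable (I) in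
/-- The integral, with respect to the Riemannian density, of a function supported in the domain of
the chart at `p`. -/
def chartIntegral (p : M) (f : M → ℝ) : ℝ :=
  ∫ y in (extChartAt I p).target,
    f ((extChartAt I p).symm y) * chartDensity I p ((extChartAt I p).symm y) ∂ν

variable [I.Boundaryless]

theorem chartIntegral_eq {f : M → ℝ} (hp : ∀ x ∉ (chartAt H p).source, f x = 0)
    (hq : ∀ x ∉ (chartAt H q).source, f x = 0) :
    chartIntegral I ν p f = chartIntegral I ν q f := by
  let τ : E → E := extChartAt I p ∘ (extChartAt I q).symm
  let s : Set E := (extChartAt I q).target ∩ (extChartAt I q).symm ⁻¹' (extChartAt I p).source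
  have hs : IsOpen s := (continuousOn_extChartAt_symm q).isOpen_inter_preimage
    (isOpen_extChartAt_target q) (isOpen_extChartAt_source p)
  have hinj : Set.InjOn τ s := by
    intro y hy z hz h
    exact (extChartAt I q).symm.injOn hy.1 hz.1 ((extChartAt I p).injOn hy.2 hz.2 h)
  have hsub : τ '' s ⊆ (extChartAt I p).target := by
    rintro _ ⟨y, hy, rfl⟩
    exact (extChartAt I p).map_source hy.2
  have hder : ∀ y ∈ s, HasFDerivWithinAt τ
      (tangentCoordChange I q p ((extChartAt I q).symm y)) s y := by
    intro y hy
    have h := hasFDerivWithinAt_tangentCoordChange (I := I) (x := q) (y := p)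
      (z := (extChartAt I q).symm y) ⟨(extChartAt I q).map_target hy.1, hy.2⟩
    rw [(extChartAt I q).right_inv hy.1, I.range_eq_univ] at h
    exact h.mono (Set.subset_univ _)
  have h1 : chartIntegral I ν p f = ∫ y in τ '' s,
      f ((extChartAt I p).symm y) * chartDensity I p ((extChartAt I p).symm y) ∂ν := by
    refine setIntegral_eq_of_subset_of_forall_sdiff_eq_zero
      (isOpen_extChartAt_target p).measurableSet hsub ?_
    rintro y ⟨hy, hy'⟩
    rw [hq, zero_mul]
    intro h
    have h' : (extChartAt I p).symm y ∈ (extChartAt I q).source := by rwa [extChartAt_source]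
    refine hy' ⟨extChartAt I q ((extChartAt I p).symm y), ⟨(extChartAt I q).map_source h', ?_⟩, ?_⟩
    · rw [Set.mem_preimage, (extChartAt I q).left_inv h']
      exact (extChartAt I p).map_target hy
    · simp only [τ, Function.comp_apply]
      rw [(extChartAt I q).left_inv h', (extChartAt I p).right_inv hy]
  have h2 : chartIntegral I ν q f = ∫ y in s,
      f ((extChartAt I q).symm y) * chartDensity I q ((extChartAt I q).symm y) ∂ν := by
    refine setIntegral_eq_of_subset_of_forall_sdiff_eq_zero
      (isOpen_extChartAt_target q).measurableSet Set.inter_subset_left ?_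
    rintro y ⟨hy, hy'⟩
    rw [hp, zero_mul]
    intro h
    exact hy' ⟨hy, by rwa [Set.mem_preimage, extChartAt_source]⟩
  rw [h1, h2, integral_image_eq_integral_abs_det_fderiv_smul ν hs.measurableSet hder hinj]
  refine setIntegral_congr_fun hs.measurableSet fun y hy ↦ ?_
  have hy1 := (extChartAt I q).map_target hy.1
  have hy2 : (extChartAt I q).symm y ∈ (extChartAt I p).source := hy.2
  simp only [τ, Function.comp_apply]
  rw [extChartAt_source] at hy1
  rw [(extChartAt I p).left_inv hy2, chartDensity_eq_abs_det_mul (p := p) (q := q)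
    (by rwa [extChartAt_source] at hy2) hy1, smul_eq_mul]
  ring

variable [CompactSpace M] {K : Set M}
  [IsContMDiffRiemannianBundle I ∞ E (fun x : M ↦ TangentSpace I x)]

omit [MeasurableSpace E] [BorelSpace E] [I.Boundaryless] [CompactSpace M] in
theorem continuousOn_chartIntegrand {f : M → ℝ} (hf : Continuous f) :
    ContinuousOn (fun y ↦ f ((extChartAt I p).symm y) * chartDensity I p ((extChartAt I p).symm y))
      (extChartAt I p).target := by
  have h := continuousOn_extChartAt_symm (I := I) p
  refine (hf.comp_continuousOn h).mul (ContinuousOn.comp (g := chartDensity I p)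
    (t := (extChartAt I p).source) ?_ h (extChartAt I p).mapsTo_symm)
  intro x hx
  exact
    (contMDiffAt_chartDensity (by rwa [extChartAt_source] at hx)).continuousAt.continuousWithinAt

omit [FiniteDimensional ℝ E] [IsManifold I ∞ M] [RiemannianBundle (fun x : M ↦ TangentSpace I x)]
  [MeasurableSpace E] [BorelSpace E] [I.Boundaryless]
  [IsContMDiffRiemannianBundle I ∞ E (fun x : M ↦ TangentSpace I x)] in
theorem isCompact_image_extChartAt (hK : IsClosed K) (hKp : K ⊆ (chartAt H p).source) :
    IsCompact (extChartAt I p '' K) :=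
  hK.isCompact.image_of_continuousOn
    ((continuousOn_extChartAt p).mono (by rwa [extChartAt_source]))

theorem integrableOn_chartIntegrand {f : M → ℝ} (hf : Continuous f) (hK : IsClosed K)
    (hKp : K ⊆ (chartAt H p).source) (hfK : ∀ x ∉ K, f x = 0) :
    IntegrableOn
      (fun y ↦ f ((extChartAt I p).symm y) * chartDensity I p ((extChartAt I p).symm y))
      (extChartAt I p).target ν := by
  have hKc := isCompact_image_extChartAt (I := I) hK hKp
  have hsub : extChartAt I p '' K ⊆ (extChartAt I p).target := by
    rintro _ ⟨x, hx, rfl⟩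
    exact (extChartAt I p).map_source (by rw [extChartAt_source]; exact hKp hx)
  have h := ((continuousOn_chartIntegrand (I := I) (p := p) hf).mono hsub).integrableOn_compact
    (μ := ν) hKc
  refine h.of_forall_sdiff_eq_zero (isOpen_extChartAt_target p).measurableSet ?_
  rintro y ⟨hy, hy'⟩
  rw [hfK, zero_mul]
  intro hy''
  exact hy' ⟨_, hy'', (extChartAt I p).right_inv hy⟩

theorem chartIntegral_sum {κ : Type*} {s : Finset κ} {f : κ → M → ℝ}
    (hf : ∀ i ∈ s, Continuous (f i)) (hK : IsClosed K) (hKp : K ⊆ (chartAt H p).source)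
    (hfK : ∀ i ∈ s, ∀ x ∉ K, f i x = 0) :
    chartIntegral I ν p (fun x ↦ ∑ i ∈ s, f i x) = ∑ i ∈ s, chartIntegral I ν p (f i) := by
  simp only [chartIntegral, Finset.sum_mul]
  exact integral_finsetSum _ fun i hi ↦
    integrableOn_chartIntegrand ν (hf i hi) hK hKp (hfK i hi)

theorem chartIntegral_add {f g : M → ℝ} (hf : Continuous f) (hg : Continuous g)
    (hK : IsClosed K) (hKp : K ⊆ (chartAt H p).source) (hfK : ∀ x ∉ K, f x = 0)
    (hgK : ∀ x ∉ K, g x = 0) :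
    chartIntegral I ν p (fun x ↦ f x + g x) = chartIntegral I ν p f + chartIntegral I ν p g := by
  simp only [chartIntegral, add_mul]
  exact integral_add (integrableOn_chartIntegrand ν hf hK hKp hfK)
    (integrableOn_chartIntegrand ν hg hK hKp hgK)

omit [CompactSpace M] [MeasurableSpace E] [BorelSpace E] [I.Boundaryless] [ν.IsAddHaarMeasure]
  [IsContMDiffRiemannianBundle I ∞ E (fun x : M ↦ TangentSpace I x)] in
theorem chartIntegrand_nonneg {f : M → ℝ} (h0 : ∀ x, 0 ≤ f x) (y : E) :
    0 ≤ f ((extChartAt I p).symm y) * chartDensity I p ((extChartAt I p).symm y) :=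
  mul_nonneg (h0 _) (Real.sqrt_nonneg _)

omit [CompactSpace M] [ν.IsAddHaarMeasure]
  [IsContMDiffRiemannianBundle I ∞ E (fun x : M ↦ TangentSpace I x)] in
theorem chartIntegral_nonneg {f : M → ℝ} (h0 : ∀ x, 0 ≤ f x) : 0 ≤ chartIntegral I ν p f :=
  setIntegral_nonneg (isOpen_extChartAt_target p).measurableSet fun y _ ↦ chartIntegrand_nonneg h0 y

theorem eq_zero_of_chartIntegral_eq_zero {f : M → ℝ} (hf : Continuous f) (hK : IsClosed K)
    (hKp : K ⊆ (chartAt H p).source) (hfK : ∀ x ∉ K, f x = 0) (h0 : ∀ x, 0 ≤ f x)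
    (h : chartIntegral I ν p f = 0) (x : M) : f x = 0 := by
  by_cases hx : x ∈ K
  swap
  · exact hfK x hx
  have ho := isOpen_extChartAt_target (I := I) p
  have h1 := (setIntegral_eq_zero_iff_of_nonneg_ae
    ((ae_restrict_iff' ho.measurableSet).2 (.of_forall fun y _ ↦ chartIntegrand_nonneg h0 y))
    (integrableOn_chartIntegrand ν hf hK hKp hfK)).1 h
  have h2 := Measure.eqOn_open_of_ae_eq h1 ho (continuousOn_chartIntegrand hf) continuousOn_const
  have hx' : x ∈ (extChartAt I p).source := by rw [extChartAt_source]; exact hKp hx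
  have h3 := h2 ((extChartAt I p).map_source hx')
  simp only [(extChartAt I p).left_inv hx', Pi.zero_apply] at h3
  exact (mul_eq_zero.1 h3).resolve_right (chartDensity_pos (hKp hx)).ne'

end Density

end AlmostHermitian


namespace AlmostHermitian

open MeasureTheory

variable {E : Type*} [NormedAddCommGroup E] [NormedSpace ℝ E] [FiniteDimensional ℝ E]
  {H : Type*} [TopologicalSpace H] {I : ModelWithCorners ℝ E H}
  {M : Type*} [TopologicalSpace M] [ChartedSpace H M] [IsManifold I ∞ M] {p x : M}
  [I.Boundaryless] [CompactSpace M] {K : Set M}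
  [MeasurableSpace E] [BorelSpace E] (ν : Measure E) [ν.IsAddHaarMeasure]

section Chart

omit [MeasurableSpace E] [BorelSpace E] [FiniteDimensional ℝ E] in
/-- A function on `M` which is supported in the domain of a chart, read in this chart. -/
theorem contDiff_indicator_comp_extChartAt_symm {u : M → ℝ}
    (hu : ∀ x ∈ (chartAt H p).source, CMDiffAt ∞ u x) (hK : IsClosed K)
    (hKp : K ⊆ (chartAt H p).source) (huK : ∀ x ∉ K, u x = 0) :
    ContDiff ℝ 1 ((extChartAt I p).target.indicator (u ∘ (extChartAt I p).symm)) := by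
  have hKc := isCompact_image_extChartAt (I := I) hK hKp
  refine contDiff_iff_contDiffAt.2 fun y ↦ ?_
  by_cases hy : y ∈ (extChartAt I p).target
  · have hx := (extChartAt I p).map_target hy
    rw [extChartAt_source] at hx
    have h1 := (contMDiffOn_extChartAt_symm (I := I) (n := ∞) p).contMDiffAt
      ((isOpen_extChartAt_target (I := I) p).mem_nhds hy)
    have h2 := contMDiffAt_iff_contDiffAt.1 (ContMDiffAt.comp y (hu _ hx) h1)
    refine (h2.of_le (by norm_cast)).congr_of_eventuallyEq ?_
    filter_upwards [(isOpen_extChartAt_target (I := I) p).mem_nhds hy] with z hz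
    exact Set.indicator_of_mem hz _
  · have hy' : y ∉ extChartAt I p '' K := by
      rintro ⟨x, hx, rfl⟩
      exact hy ((extChartAt I p).map_source (by rw [extChartAt_source]; exact hKp hx))
    refine (contDiffAt_const (c := 0)).congr_of_eventuallyEq ?_
    filter_upwards [hKc.isClosed.isOpen_compl.mem_nhds hy'] with z hz
    rw [Set.indicator_apply_eq_zero]
    intro hz'
    exact huK _ fun h ↦ hz ⟨_, h, (extChartAt I p).right_inv hz'⟩

theorem setIntegral_mvfderiv_chartFrame {u : M → ℝ}
    (hu : ∀ x ∈ (chartAt H p).source, CMDiffAt ∞ u x) (hK : IsClosed K)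
    (hKp : K ⊆ (chartAt H p).source) (huK : ∀ x ∉ K, u x = 0) (k : Fin (Module.finrank ℝ E)) :
    IntegrableOn (fun y ↦ mvfderiv I u ((extChartAt I p).symm y)
        (chartFrame I p k ((extChartAt I p).symm y))) (extChartAt I p).target ν ∧
      ∫ y in (extChartAt I p).target, mvfderiv I u ((extChartAt I p).symm y)
        (chartFrame I p k ((extChartAt I p).symm y)) ∂ν = 0 := by
  have hKc := isCompact_image_extChartAt (I := I) hK hKp
  have ho := isOpen_extChartAt_target (I := I) p
  have hC := contDiff_indicator_comp_extChartAt_symm (I := I) hu hK hKp huK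
  set w := (extChartAt I p).target.indicator (u ∘ (extChartAt I p).symm) with hw
  have hw0 : ∀ y ∉ extChartAt I p '' K, w y = 0 := by
    intro y hy
    rw [hw, Set.indicator_apply_eq_zero]
    intro hy'
    exact huK _ fun h ↦ hy ⟨_, h, (extChartAt I p).right_inv hy'⟩
  have hwc : HasCompactSupport w := HasCompactSupport.intro hKc hw0
  have hder : ∀ y ∈ (extChartAt I p).target, mvfderiv I u ((extChartAt I p).symm y)
      (chartFrame I p k ((extChartAt I p).symm y)) = fderiv ℝ w y (Module.finBasis ℝ E k) := by
    intro y hy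
    have hx := (extChartAt I p).map_target hy
    rw [extChartAt_source] at hx
    have h1 := hasFDerivAt_comp_extChartAt_symm hx ((hu _ hx).mdifferentiableAt (by simp))
    rw [(extChartAt I p).right_inv hy] at h1
    have h2 : w =ᶠ[nhds y] u ∘ (extChartAt I p).symm := by
      filter_upwards [ho.mem_nhds hy] with z hz
      exact Set.indicator_of_mem hz _
    rw [(h1.congr_of_eventuallyEq h2).fderiv, chartFrame_eq hx]
    rfl
  have hint : Integrable (fun y ↦ fderiv ℝ w y (Module.finBasis ℝ E k)) ν :=
    ((hC.continuous_fderiv (by simp)).clm_apply continuous_const).integrable_of_hasCompactSupport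
      (hwc.fderiv_apply ℝ _)
  constructor
  · exact (hint.integrableOn (s := (extChartAt I p).target)).congr_fun (fun y hy ↦ (hder y hy).symm)
      ho.measurableSet
  · rw [setIntegral_congr_fun ho.measurableSet hder,
      setIntegral_eq_integral_of_forall_compl_eq_zero, integral_fderiv_eq_zero ν hC hwc]
    intro y hy
    have h1 : w =ᶠ[nhds y] fun _ ↦ 0 := by
      have hy' : y ∉ extChartAt I p '' K := by
        rintro ⟨x, hx, rfl⟩
        exact hy ((extChartAt I p).map_source (by rw [extChartAt_source]; exact hKp hx))
      filter_upwards [hKc.isClosed.isOpen_compl.mem_nhds hy'] with z hz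
      exact hw0 z hz
    rw [h1.fderiv_eq]
    simp

variable [RiemannianBundle (fun x : M ↦ TangentSpace I x)]
  [IsContMDiffRiemannianBundle I ∞ E (fun x : M ↦ TangentSpace I x)]

theorem chartIntegral_divergence {V : Π x : M, TangentSpace I x} (hV : IsSmoothField I V)
    (hK : IsClosed K) (hKp : K ⊆ (chartAt H p).source) (hVK : ∀ x ∉ K, V x = 0) :
    chartIntegral I ν p
      (fun x ↦ ∑ k, chartCoeff I p k x (leviCivita I M V x (chartFrame I p k x))) = 0 := by
  have ho := isOpen_extChartAt_target (I := I) p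
  let u (k : Fin (Module.finrank ℝ E)) (y : M) : ℝ := chartDensity I p y * chartCoeff I p k y (V y)
  have hu (k) : ∀ x ∈ (chartAt H p).source, CMDiffAt ∞ (u k) x := fun x hx ↦
    (contMDiffAt_chartDensity hx).mul (contMDiffAt_chartCoeff hx k (hV x))
  have huK (k) : ∀ x ∉ K, u k x = 0 := fun x hx ↦ by simp [u, hVK x hx]
  have h (k) := setIntegral_mvfderiv_chartFrame ν (hu k) hK hKp (huK k) k
  calc _ = ∫ y in (extChartAt I p).target, ∑ k, mvfderiv I (u k) ((extChartAt I p).symm y)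
        (chartFrame I p k ((extChartAt I p).symm y)) ∂ν := by
        refine setIntegral_congr_fun ho.measurableSet fun y hy ↦ ?_
        have hx := (extChartAt I p).map_target hy
        rw [extChartAt_source] at hx
        exact (mul_comm _ _).trans (sum_mvfderiv_chartDensity_mul hx (hV _)).symm
    _ = 0 := by
        rw [integral_finsetSum _ fun k _ ↦ (h k).1]
        exact Finset.sum_eq_zero fun k _ ↦ (h k).2

end Chart

section Divergence

variable [RiemannianBundle (fun x : M ↦ TangentSpace I x)]
  [IsContMDiffRiemannianBundle I ∞ E (fun x : M ↦ TangentSpace I x)] [T2Space M] [Nontrivial E]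

namespace DualFrame

variable (F : DualFrame I M)

omit [I.Boundaryless] [MeasurableSpace E] [BorelSpace E] in
theorem div_apply_eq_sum_chartCoeff (V : SmoothField I M) (hx : x ∈ (chartAt H p).source) :
    F.calculus.div V x
      = ∑ k, chartCoeff I p k x (leviCivita I M V x (chartFrame I p k x)) := by
  have h : F.calculus.div V x
      = ∑ i, inner ℝ (leviCivita I M V x (F.e i x)) (F.e' i x) :=
    SmoothFunction.sum_apply _ _ _
  have h' := sum_apply_eq_sum_apply (c := fun i ↦ (innerₗ (TangentSpace I x) (F.e' i x)))
    (a := fun i ↦ F.e i x) (fun v ↦ by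
      simp only [innerₗ_apply_apply, real_inner_comm v]
      exact F.sum_frame x v)
    (sum_chartCoeff_smul hx) (leviCivita I M V x : TangentSpace I x →ₗ[ℝ] TangentSpace I x)
  exact h.trans ((Finset.sum_congr rfl fun i _ ↦ real_inner_comm _ _).trans h')

theorem chartIntegral_div (V : SmoothField I M)
    (hK : IsClosed K) (hKp : K ⊆ (chartAt H p).source) (hVK : ∀ x ∉ K, V x = 0) :
    chartIntegral I ν p (F.calculus.div V) = 0 := by
  rw [← chartIntegral_divergence ν V.isSmoothField hK hKp hVK]
  refine setIntegral_congr_fun (isOpen_extChartAt_target p).measurableSet fun y hy ↦ ?_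
  have hx := (extChartAt I p).map_target hy
  rw [extChartAt_source] at hx
  simp only [F.div_apply_eq_sum_chartCoeff V hx]

omit [MeasurableSpace E] [BorelSpace E] in
/-- On a compact manifold a divergence which is nonnegative vanishes. -/
theorem div_eq_zero_of_nonneg (V : SmoothField I M) (h : ∀ x, 0 ≤ F.calculus.div V x) :
    F.calculus.div V = 0 := by
  let : MeasurableSpace E := borel E
  have : BorelSpace E := ⟨rfl⟩
  let ν : Measure E := Measure.addHaar
  obtain ⟨ρ, hρ⟩ := SmoothPartitionOfUnity.exists_isSubordinate_chartAt_source I M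
  have hfin := ρ.locallyFinite.finite_nonempty_of_compact
  let t : Finset M := hfin.toFinset
  have hsum (x : M) : ∑ i ∈ t, ρ i x = 1 := by
    rw [← ρ.sum_eq_one (Set.mem_univ x), finsum_eq_sum_of_support_subset]
    intro i hi
    simp only [t, Set.Finite.coe_toFinset, Set.mem_ofPred_eq]
    exact ⟨x, hi⟩
  have hK (i : M) : IsClosed (tsupport (ρ i)) := isClosed_tsupport _
  have hρK (i x : M) (hx : x ∉ tsupport (ρ i)) : ρ i x = 0 := image_eq_zero_of_notMem_tsupport hx
  have hVK (i x : M) (hx : x ∉ tsupport (ρ i)) : lieDeriv I V (ρ i) x = 0 := by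
    have h1 : (ρ i : M → ℝ) =ᶠ[nhds x] fun _ ↦ 0 := notMem_tsupport_iff_eventuallyEq.1 hx
    rw [lieDeriv, mvfderiv, ContinuousLinearMap.comp_apply, Filter.EventuallyEq.mfderiv_eq h1,
      mfderiv_const]
    exact map_zero _
  have hVc (i : M) : Continuous (lieDeriv I V (ρ i)) :=
    (V.isSmoothField.contMDiff_lieDeriv (ρ i).contMDiff).continuous
  have hDc : Continuous (F.calculus.div V) := (F.calculus.div V).contMDiff.continuous
  have hρc (i : M) : Continuous (ρ i) := (ρ i).contMDiff.continuous
  have hρD (i : M) : Continuous fun x ↦ ρ i x * F.calculus.div V x := (hρc i).mul hDc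
  have hρV (i j : M) : Continuous fun x ↦ ρ j x * lieDeriv I V (ρ i) x := (hρc j).mul (hVc i)
  have h1 (i : M) : chartIntegral I ν i (fun x ↦ ρ i x * F.calculus.div V x)
      = - ∑ j ∈ t, chartIntegral I ν j (fun x ↦ ρ j x * lieDeriv I V (ρ i) x) := by
    have h2 := F.chartIntegral_div ν ((ρ i : SmoothFunction I M) • V) (hK i) (hρ i)
      fun x hx ↦ by rw [SmoothField.smul_apply]; simp [hρK i x hx]
    have h3 : ⇑(F.calculus.div ((ρ i : SmoothFunction I M) • V))
        = fun x ↦ ρ i x * F.calculus.div V x + lieDeriv I V (ρ i) x := by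
      rw [F.calculus.div_smul]
      rfl
    rw [h3, chartIntegral_add ν (hρD i) (hVc i) (hK i) (hρ i)
      (fun x hx ↦ by rw [hρK i x hx, zero_mul]) (hVK i)] at h2
    have h4 : lieDeriv I V (ρ i) = fun x ↦ ∑ j ∈ t, ρ j x * lieDeriv I V (ρ i) x := by
      ext x
      rw [← Finset.sum_mul, hsum, one_mul]
    have h5 : chartIntegral I ν i (lieDeriv I V (ρ i))
        = ∑ j ∈ t, chartIntegral I ν j (fun x ↦ ρ j x * lieDeriv I V (ρ i) x) := by
      conv_lhs => rw [h4]
      rw [chartIntegral_sum ν (fun j _ ↦ hρV i j) (hK i) (hρ i)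
        fun j _ x hx ↦ by rw [hVK i x hx, mul_zero]]
      refine Finset.sum_congr rfl fun j _ ↦ chartIntegral_eq ν (fun x hx ↦ ?_) fun x hx ↦ ?_
      · rw [hVK i x fun h ↦ hx (hρ i h), mul_zero]
      · rw [hρK j x fun h ↦ hx (hρ j h), zero_mul]
    linarith
  have h6 : ∑ i ∈ t, chartIntegral I ν i (fun x ↦ ρ i x * F.calculus.div V x) = 0 := by
    simp only [h1, Finset.sum_neg_distrib, neg_eq_zero]
    rw [Finset.sum_comm]
    refine Finset.sum_eq_zero fun j _ ↦ ?_
    rw [← chartIntegral_sum ν (fun i _ ↦ hρV i j) (hK j) (hρ j)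
        fun i _ x hx ↦ by rw [hρK j x hx, zero_mul]]
    have h7 (x : M) : ∑ i ∈ t, ρ j x * lieDeriv I V (ρ i) x = 0 := by
      have h8 : SmoothField.der I M V (∑ i ∈ t, (ρ i : SmoothFunction I M)) = 0 := by
        have h9 : ∑ i ∈ t, (ρ i : SmoothFunction I M) = 1 := by
          ext x
          rw [SmoothFunction.sum_apply]
          exact hsum x
        rw [h9, Derivation.map_one_eq_zero]
      rw [map_sum] at h8
      have h10 := congrArg (fun f : SmoothFunction I M ↦ f x) h8
      rw [SmoothFunction.sum_apply] at h10
      rw [← Finset.mul_sum]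
      exact mul_eq_zero_of_right _ h10
    simp [h7, chartIntegral]
  have hnn (i x : M) : 0 ≤ ρ i x * F.calculus.div V x := mul_nonneg (ρ.nonneg i x) (h x)
  have h7 := (Finset.sum_eq_zero_iff_of_nonneg fun i _ ↦ chartIntegral_nonneg ν (hnn i)).1 h6
  ext x
  have h8 : ∑ i ∈ t, ρ i x * F.calculus.div V x = 0 := Finset.sum_eq_zero fun i hi ↦
    eq_zero_of_chartIntegral_eq_zero ν (hρD i) (hK i) (hρ i)
      (fun x hx ↦ by rw [hρK i x hx, zero_mul]) (hnn i) (h7 i hi) x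
  rw [← Finset.sum_mul, hsum, one_mul] at h8
  exact h8

end DualFrame

end Divergence

end AlmostHermitian


namespace AlmostHermitian

section LinearAlgebra

variable {V : Type*} [NormedAddCommGroup V] [InnerProductSpace ℝ V]

/-- The norm of a bilinear form may be computed in any pair of dual frames. -/
theorem sum_sum_dual_mul (β : V →ₗ[ℝ] V →ₗ[ℝ] ℝ) {ι κ : Type*} [Fintype ι] [Fintype κ]
    {a a' : κ → V} (b : OrthonormalBasis ι ℝ V) (h : ∀ v, ∑ k, inner ℝ v (a' k) • a k = v) :
    ∑ k, ∑ l, β (a k) (a l) * β (a' k) (a' l) = ∑ i, ∑ j, β (b i) (b j) * β (b i) (b j) := by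
  have h1 (k : κ) : ∑ l, β (a k) (a l) * β (a' k) (a' l) = ∑ j, β (a k) (b j) * β (a' k) (b j) :=
    sum_dual_eq_sum_orthonormalBasis (B := (LinearMap.mul ℝ ℝ).compl₁₂ (β (a k)) (β (a' k))) b h
  have h2 (j : ι) : ∑ k, β (a k) (b j) * β (a' k) (b j) = ∑ i, β (b i) (b j) * β (b i) (b j) :=
    sum_dual_eq_sum_orthonormalBasis
      (B := (LinearMap.mul ℝ ℝ).compl₁₂ (β.flip (b j)) (β.flip (b j))) b h
  simp only [h1]
  rw [Finset.sum_comm]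
  simp only [h2]
  exact Finset.sum_comm

theorem eq_zero_of_sum_mul_self (β : V →ₗ[ℝ] V →ₗ[ℝ] ℝ) {ι : Type*} [Fintype ι]
    (b : OrthonormalBasis ι ℝ V) (h : ∑ i, ∑ j, β (b i) (b j) * β (b i) (b j) = 0) : β = 0 := by
  rw [Finset.sum_eq_zero_iff_of_nonneg
    fun i _ ↦ Finset.sum_nonneg fun j _ ↦ mul_self_nonneg _] at h
  refine b.toBasis.ext fun i ↦ b.toBasis.ext fun j ↦ ?_
  have h1 := (Finset.sum_eq_zero_iff_of_nonneg fun j _ ↦ mul_self_nonneg _).1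
    (h i (Finset.mem_univ _)) j (Finset.mem_univ _)
  simpa using h1

/-- The trace is invariant under an orthogonal complex structure. -/
theorem sum_apply_J_J {P : Type*} [AddCommGroup P] [Module ℝ P] (B : V →ₗ[ℝ] V →ₗ[ℝ] P)
    {ι : Type*} [Fintype ι] (b : OrthonormalBasis ι ℝ V) {J : V →L[ℝ] V}
    (hJ : ∀ v, J (J v) = -v) (hg : ∀ v w, inner ℝ (J v) (J w) = inner ℝ v w) :
    ∑ i, B (J (b i)) (J (b i)) = ∑ i, B (b i) (b i) := by
  refine sum_dual_eq_sum_orthonormalBasis (a := fun i ↦ J (b i)) (a' := fun i ↦ J (b i)) b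
    fun v ↦ ?_
  have h := congrArg J (b.sum_repr' (J v))
  rw [map_sum] at h
  simp only [map_smul, hJ, real_inner_comm, inner_J_left hJ hg, neg_smul, map_neg] at h
  rw [Finset.sum_neg_distrib, neg_inj] at h
  simpa only [real_inner_comm] using h

end LinearAlgebra

variable {E : Type*} [NormedAddCommGroup E] [NormedSpace ℝ E] [FiniteDimensional ℝ E]
  {H : Type*} [TopologicalSpace H] {I : ModelWithCorners ℝ E H}
  {M : Type*} [TopologicalSpace M] [ChartedSpace H M] [IsManifold I ∞ M]
  [RiemannianBundle (fun x : M ↦ TangentSpace I x)]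
  [IsContMDiffRiemannianBundle I ∞ E (fun x : M ↦ TangentSpace I x)]

omit [FiniteDimensional ℝ E] [IsManifold I ∞ M]
  [RiemannianBundle (fun x : M ↦ TangentSpace I x)]
  [IsContMDiffRiemannianBundle I ∞ E (fun x : M ↦ TangentSpace I x)] in
theorem SmoothFunction.ofNat_apply (n : ℕ) [n.AtLeastTwo] (x : M) :
    (ofNat(n) : SmoothFunction I M) x = ofNat(n) :=
  map_ofNat (ContMDiffMap.evalRingHom x) n

namespace DualFrame

variable (F : DualFrame I M) [T2Space M] [Nontrivial E]

theorem calculus_div_apply [SigmaCompactSpace M] (X : SmoothField I M) (x : M) :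
    F.calculus.div X x = ∑ i, inner ℝ
      (leviCivita I M X x (stdOrthonormalBasis ℝ (TangentSpace I x) i))
      (stdOrthonormalBasis ℝ (TangentSpace I x) i) :=
  (SmoothFunction.sum_apply _ _ _).trans (sum_dual_eq_sum_orthonormalBasis
    (B := innerₗ (TangentSpace I x) ∘ₗ
      (leviCivita I M X x : TangentSpace I x →ₗ[ℝ] TangentSpace I x))
    _ (F.sum_frame x))

/-- A bilinear form on a compact manifold whose square norm is a divergence vanishes. -/
theorem eq_zero_of_div_eq [CompactSpace M] [I.Boundaryless]
    {B : SmoothField I M → SmoothField I M → SmoothFunction I M}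
    (β : ∀ x : M, TangentSpace I x →ₗ[ℝ] TangentSpace I x →ₗ[ℝ] ℝ)
    (hB : ∀ X Y x, B X Y x = β x (X x) (Y x))
    (h : ∃ X, F.calculus.div X
      = ∑ i, ∑ j, B (F.calculus.e i) (F.calculus.e j) * B (F.calculus.e' i) (F.calculus.e' j))
    (x : M) : β x = 0 := by
  obtain ⟨X, hX⟩ := h
  have h1 (x : M) : F.calculus.div X x = ∑ i, ∑ j,
      β x (stdOrthonormalBasis ℝ (TangentSpace I x) i) (stdOrthonormalBasis ℝ (TangentSpace I x) j)
      * β x (stdOrthonormalBasis ℝ (TangentSpace I x) i)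
        (stdOrthonormalBasis ℝ (TangentSpace I x) j) := by
    rw [hX, ← sum_sum_dual_mul (β x) _ (F.sum_frame x)]
    simp only [SmoothFunction.sum_apply, ContMDiffMap.coe_mul, Pi.mul_apply, hB]
    rfl
  have h2 := F.div_eq_zero_of_nonneg X fun x ↦ by
    rw [h1]
    exact Finset.sum_nonneg fun i _ ↦ Finset.sum_nonneg fun j _ ↦ mul_self_nonneg _
  exact eq_zero_of_sum_mul_self _ _
    ((h1 x).symm.trans (congrArg (fun f : SmoothFunction I M ↦ f x) h2))

end DualFrame

namespace AlmostHermitianStructure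

variable (S : AlmostHermitianStructure I M)

omit [FiniteDimensional ℝ E] [IsContMDiffRiemannianBundle I ∞ E (fun x : M ↦ TangentSpace I x)] in
/-- The almost complex structure on smooth vector fields. -/
def mapSmoothField : SmoothField I M →ₗ[SmoothFunction I M] SmoothField I M where
  toFun X := ⟨_, X.isSmoothField.mapField S⟩
  map_add' X Y := by ext x; exact map_add (S.J x) _ _
  map_smul' f X := by ext x; exact map_smul (S.J x) _ _

omit [FiniteDimensional ℝ E] [IsContMDiffRiemannianBundle I ∞ E (fun x : M ↦ TangentSpace I x)] in
theorem mapSmoothField_apply (X : SmoothField I M) (x : M) :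
    S.mapSmoothField X x = S.J x (X x) := rfl

theorem sum_nablaJ {κ : Type*} [Fintype κ] {x : M} {a a' : κ → TangentSpace I x}
    (h : ∀ v, ∑ k, inner ℝ v (a' k) • a k = v) :
    ∑ k, S.nablaJ x (a k) (a' k) = ∑ i, S.nablaJ x (stdOrthonormalBasis ℝ (TangentSpace I x) i)
      (stdOrthonormalBasis ℝ (TangentSpace I x) i) :=
  sum_dual_eq_sum_orthonormalBasis (B := (ContinuousLinearMap.coeLM ℝ) ∘ₗ
    (S.nablaJ x : TangentSpace I x →ₗ[ℝ] TangentSpace I x →L[ℝ] TangentSpace I x)) _ h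

variable [T2Space M] [SigmaCompactSpace M] [Nontrivial E]

theorem calculus_dJ_apply (F : DualFrame I M) (X Y : SmoothField I M) (x : M) :
    F.calculus.dJ S.mapSmoothField X Y x = S.nablaJ x (X x) (Y x) :=
  (S.nablaJ_apply (Y.isSmoothField.mdifferentiableAt x) _).symm

theorem exists_smoothField_eq_leeSharp (F : DualFrame I M) :
    ∃ ξ : SmoothField I M, ⇑ξ = S.leeSharp := by
  refine ⟨- S.mapSmoothField (∑ i, F.calculus.dJ S.mapSmoothField (F.e i) (F.e' i)), ?_⟩
  ext x
  rw [SmoothField.neg_apply, mapSmoothField_apply, SmoothField.sum_apply, leeSharp_eq,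
    ← S.sum_nablaJ (F.sum_frame x)]
  simp only [calculus_dJ_apply]

omit [SigmaCompactSpace M] [Nontrivial E] [T2Space M] in
theorem nablaOneForm_lee {ξ : SmoothField I M} (hξ : ⇑ξ = S.leeSharp)
    {X Y : Π x : M, TangentSpace I x} (hX : IsSmoothField I X) (hY : IsSmoothField I Y) (x : M) :
    nablaOneForm I S.lee X Y x = inner ℝ (leviCivita I M ξ x (X x)) (Y x) := by
  have h := leviCivita_metric (hX.mdifferentiableAt x) (ξ.isSmoothField.mdifferentiableAt x)
    (hY.mdifferentiableAt x)
  simp only [nablaOneForm, lee_apply, ← hξ, h]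
  ring

theorem isHermitianSurface (hE : Module.finrank ℝ E = 4) (hS : S.IsIntegrable) (F : DualFrame I M)
    {ξ : SmoothField I M} (hξ : ⇑ξ = S.leeSharp) :
    F.calculus.IsHermitianSurface S.mapSmoothField ξ where
  J_J X := by ext x; exact S.J_J x _
  g_J X Y := by ext x; exact inner_J_left (S.J_J x) (S.inner_J_J x) _ _
  sum_g := by
    ext x
    have h := sum_dual_eq_sum_orthonormalBasis (B := innerₗ (TangentSpace I x))
      (stdOrthonormalBasis ℝ (TangentSpace I x)) (F.sum_frame x)
    have h4 : Module.finrank ℝ (TangentSpace I x) = 4 := hE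
    refine (SmoothFunction.sum_apply _ _ _).trans (h.trans ?_)
    rw [SmoothFunction.ofNat_apply]
    simp [h4]
  J_lee := by
    ext x
    rw [mapSmoothField_apply, hξ, leeSharp_eq, map_neg, S.J_J, neg_neg,
      ← S.sum_nablaJ (F.sum_frame x), SmoothField.sum_apply]
    simp only [calculus_dJ_apply]
    rfl
  two_g_dJ X Y Z := by
    ext x
    have h := (S.isHermitianDerivative x).two_inner_T hE
      (stdOrthonormalBasis ℝ (TangentSpace I x)) (S.leeSharp_eq x)
      (fun v w ↦ by rw [← nijenhuis_eq, hS x]; rfl) (X x) (Y x) (Z x)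
    rw [← hξ, ← calculus_dJ_apply S F, ← SmoothFunction.ofNat_apply (I := I) 2 x] at h
    exact h

variable {S} in
/-- On a compact almost Hermitian surface the equality `-4Φ = d(Jθ)` forces the structure to be
Vaisman. -/
theorem NegFourPhiEq.isVaisman [CompactSpace M] [I.Boundaryless] (hE : Module.finrank ℝ E = 4)
    (h : S.NegFourPhiEq) : S.IsVaisman := by
  obtain ⟨F⟩ := S.nonempty_dualFrame hE
  obtain ⟨ξ, hξ⟩ := S.exists_smoothField_eq_leeSharp F
  let b (x : M) : TangentSpace I x →ₗ[ℝ] TangentSpace I x →ₗ[ℝ] ℝ := innerₗ (TangentSpace I x) ∘ₗ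
    (leviCivita I M ξ x : TangentSpace I x →ₗ[ℝ] TangentSpace I x)
  have hb (X Y : SmoothField I M) (x : M) : F.calculus.dform ξ X Y x = b x (X x) (Y x) := rfl
  have h1 (x : M) (v w : TangentSpace I x) : b x v (S.J x w) - b x w (S.J x v)
      = -(1 / 2) * twoFormInner x (S.nijenhuisForm x (S.J x v)) (S.nijenhuisForm x w)
        - (1 / 2) * S.nijenhuisForm x (S.J x (S.leeSharp x)) v w := by
    obtain ⟨X, rfl⟩ := SmoothField.exists_apply_eq x v
    obtain ⟨Y, rfl⟩ := SmoothField.exists_apply_eq x w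
    rw [← (S.negFourPhiEq_iff hE).1 h X Y X.isSmoothField Y.isSmoothField x,
      S.nablaOneForm_lee hξ X.isSmoothField (Y.isSmoothField.mapField S),
      S.nablaOneForm_lee hξ Y.isSmoothField (X.isSmoothField.mapField S)]
    rfl
  have h2 (x : M) (v : TangentSpace I x) : b x v v + b x (S.J x v) (S.J x v)
      = (1 / 2) * twoFormInner x (S.nijenhuisForm x (S.J x v)) (S.nijenhuisForm x (S.J x v)) := by
    have h3 := h1 x v (S.J x v)
    have h4 : S.nijenhuis x v (S.J x v) = 0 := by
      rw [nijenhuis_eq, (S.isHermitianDerivative x).nijenhuisOf_J_right, nijenhuisOf_self, map_zero,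
        neg_zero]
    rw [S.J_J, map_neg, nijenhuisForm, h4, inner_zero_left] at h3
    linarith
  have hnn (x : M) (φ : TangentSpace I x → TangentSpace I x → ℝ) : 0 ≤ twoFormInner x φ φ :=
    mul_nonneg (by norm_num) (Finset.sum_nonneg fun i _ ↦ Finset.sum_nonneg fun j _ ↦
      mul_self_nonneg _)
  have h5 (x : M) : 4 * F.calculus.div ξ x = ∑ i, twoFormInner x
      (S.nijenhuisForm x (S.J x (stdOrthonormalBasis ℝ (TangentSpace I x) i)))
      (S.nijenhuisForm x (S.J x (stdOrthonormalBasis ℝ (TangentSpace I x) i))) := by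
    have h6 : F.calculus.div ξ x = ∑ i, b x (stdOrthonormalBasis ℝ (TangentSpace I x) i)
      (stdOrthonormalBasis ℝ (TangentSpace I x) i) := F.calculus_div_apply ξ x
    have h7 := sum_apply_J_J (b x) (stdOrthonormalBasis ℝ (TangentSpace I x)) (S.J_J x)
      (S.inner_J_J x)
    have h8 := Finset.sum_congr rfl fun i (_ : i ∈ Finset.univ) ↦
      h2 x (stdOrthonormalBasis ℝ (TangentSpace I x) i)
    rw [Finset.sum_add_distrib, ← Finset.mul_sum, h7, ← h6] at h8
    linarith
  have hdiv : F.calculus.div ξ = 0 := F.div_eq_zero_of_nonneg ξ fun x ↦ by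
    have := Finset.sum_nonneg fun i (_ : i ∈ Finset.univ) ↦
      hnn x (S.nijenhuisForm x (S.J x (stdOrthonormalBasis ℝ (TangentSpace I x) i)))
    linarith [h5 x]
  have hint : S.IsIntegrable := by
    intro x
    have h6 := (h5 x).symm
    rw [hdiv, ContMDiffMap.coe_zero, Pi.zero_apply, mul_zero,
      Finset.sum_eq_zero_iff_of_nonneg fun i _ ↦ hnn x _] at h6
    let u := stdOrthonormalBasis ℝ (TangentSpace I x)
    have h7 (i k l) : inner ℝ (S.nijenhuis x (u k) (u l)) (S.J x (u i)) = 0 := by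
      have h8 := (mul_eq_zero.1 (h6 i (Finset.mem_univ _))).resolve_left (by norm_num)
      have h9 := (Finset.sum_eq_zero_iff_of_nonneg fun k _ ↦ Finset.sum_nonneg fun l _ ↦
        mul_self_nonneg _).1 h8 k (Finset.mem_univ _)
      exact mul_self_eq_zero.1 ((Finset.sum_eq_zero_iff_of_nonneg fun l _ ↦
        mul_self_nonneg _).1 h9 l (Finset.mem_univ _))
    have h8 (k l) : S.nijenhuis x (u k) (u l) = 0 := by
      have h9 : S.J x (S.nijenhuis x (u k) (u l)) = 0 := by
        refine InnerProductSpace.ext_inner_right_basis u.toBasis fun i ↦ ?_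
        rw [inner_J_left (S.J_J x) (S.inner_J_J x), OrthonormalBasis.coe_toBasis, h7, neg_zero,
          inner_zero_left]
      have h10 := S.J_J x (S.nijenhuis x (u k) (u l))
      rw [h9, map_zero] at h10
      exact neg_eq_zero.1 h10.symm
    refine ContinuousLinearMap.coe_injective (u.toBasis.ext fun k ↦
      ContinuousLinearMap.coe_injective (u.toBasis.ext fun l ↦ ?_))
    simpa using h8 k l
  have hsurf := S.isHermitianSurface hE hint F hξ
  have hB (X Y : SmoothField I M) : F.calculus.dform ξ (S.mapSmoothField X) (S.mapSmoothField Y)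
      = - F.calculus.dform ξ Y X := by
    ext x
    have h6 := h1 x (S.J x (X x)) (Y x)
    rw [S.J_J, map_neg] at h6
    simp only [nijenhuisForm, hint x, twoFormInner, zero_apply, inner_zero_left, mul_zero,
      Finset.sum_const_zero, sub_zero, sub_neg_eq_add] at h6
    exact eq_neg_of_add_eq_zero_left h6
  have h6 := F.eq_zero_of_div_eq (B := F.calculus.ext ξ) (fun x ↦ b x - (b x).flip)
    (fun _ _ _ ↦ rfl) (hsurf.exists_div_eq_ext hB)
  have hsymm (X Y : SmoothField I M) : F.calculus.dform ξ X Y = F.calculus.dform ξ Y X := by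
    ext x
    have h7 := congrArg (fun β ↦ β (X x) (Y x)) (h6 x)
    exact sub_eq_zero.1 h7
  have h7 := F.eq_zero_of_div_eq b hb (hsurf.exists_div_eq_dform hB hsymm hdiv)
  refine ⟨hint, fun X Y hX hY x ↦ ?_⟩
  rw [S.nablaOneForm_lee hξ hX hY]
  exact congrArg (fun β ↦ β (X x) (Y x)) (h7 x)

end AlmostHermitianStructure

end AlmostHermitian

end

theorem proposition2p3 {M : Type*} [TopologicalSpace M] [T2Space M]
    [ChartedSpace (EuclideanSpace ℝ (Fin 4)) M] [IsManifold (𝓡 4) ∞ M]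
    [RiemannianBundle (fun x : M ↦ TangentSpace (𝓡 4) x)]
    [IsContMDiffRiemannianBundle (𝓡 4) ∞ (EuclideanSpace ℝ (Fin 4))
      (fun x : M ↦ TangentSpace (𝓡 4) x)]
    (S : AlmostHermitian.AlmostHermitianStructure (𝓡 4) M) :
    (S.NegFourPhiEq ↔
      ∀ X Y : Π x : M, TangentSpace (𝓡 4) x,
        AlmostHermitian.IsSmoothField (𝓡 4) X → AlmostHermitian.IsSmoothField (𝓡 4) Y → ∀ x : M,
          AlmostHermitian.nablaOneForm (𝓡 4) S.lee X (S.mapField Y) x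
              - AlmostHermitian.nablaOneForm (𝓡 4) S.lee Y (S.mapField X) x
            = -(1 / 2) * AlmostHermitian.twoFormInner x
                (S.nijenhuisForm x (S.J x (X x))) (S.nijenhuisForm x (Y x))
              - (1 / 2) * S.nijenhuisForm x (S.J x (S.leeSharp x)) (X x) (Y x)) ∧
    (CompactSpace M → (S.NegFourPhiEq ↔ S.IsVaisman)) := by
  have hE : Module.finrank ℝ (EuclideanSpace ℝ (Fin 4)) = 4 := by simp
  exact ⟨S.negFourPhiEq_iff hE, fun _ ↦
    ⟨fun h ↦ h.isVaisman hE, fun h ↦ h.negFourPhiEq S hE⟩⟩
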